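/- Let $n\ge 1$, let $E$ be the $n\times n$ unit matrix and let $A^+$ denote the conjugate transpose. Put $\phi_d=\begin{pmatrix}E&0\\0&-E\end{pmatrix}$, $\phi_a=i\begin{pmatrix}0&-E\\E&0\end{pmatrix}$, $\mathcal C=\frac1{\sqrt2}\begin{pmatrix}E&-iE\\-iE&E\end{pmatrix}$ (so that $\mathcal C^+\phi_d\,\mathcal C=\phi_a$), and let $U(n,n)=\{g: g^+\phi_d g=\phi_d\}$ and $\widetilde{U(n,n)}=\{g: g^+\phi_a g=\phi_a\}$, with Lie algebras $\mathbf u(n,n)$, $\widetilde{\mathbf u(n,n)}$. Write $H(n)$ for the hermitian $n\times n$ matrices and $T^*U(n)\cong U(n)\times iH(n)$. Define $J_{+-}(\eta,\xi)=i\begin{pmatrix}-\eta\eta^+&\eta\xi^+\\-\xi\eta^+&\xi\xi^+\end{pmatrix}$, $\tilde J_{+-}(\upsilon,\zeta)=\begin{pmatrix}\upsilon\zeta^+&-\upsilon\upsilon^+\\\zeta\zeta^+&-\zeta\upsilon^+\end{pmatrix}$, $J_0(Z,\rho)=\begin{pmatrix}-Z\rho Z^+&Z\rho\\(Z\rho)^+&\rho\end{pmatrix}$,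 $\tilde J_0(Y,X)=\begin{pmatrix}YX&-YXY\\X&-XY\end{pmatrix}$, where $\eta,\xi,\upsilon,\zeta\in\mathbb C^n$, $Z\in U(n)$, $\rho\in iH(n)$, $X,Y\in H(n)$. Consider the following manifolds, each with a (possibly degenerate) closed 2-form and a Hamiltonian function: * $\mathcal T^0_{+-}=\{(\eta,\xi)\ne0:\eta^+\eta=\xi^+\xi\}$ with $d\gamma_{+-}$, $\gamma_{+-}=i(\eta^+d\eta-\xi^+d\xi)$, and $I_{++}=\eta^+\eta+\xi^+\xi$; * $\tilde{\mathcal T}^0_{+-}=\{(\upsilon,\zeta)\ne0:\zeta^+\upsilon=\upsilon^+\zeta\}$ with $d\tilde\gamma_{+-}$, $\tilde\gamma_{+-}=\upsilon^+d\zeta-\zeta^+d\upsilon$, and $\tilde I_{++}=\upsilon^+\upsilon+\zeta^+\zeta$; * $\mathcal O_{10}\subset U(n)\times iH(n)$, the orbit of $(E,\,i\,\mathrm{diag}(1,0,\dots,0))$ under the action $\Lambda_g(Z,\rho)=((AZ+B)(CZ+D)^{-1},(CZ+D)\rho(CZ+D)^+)$ of $g=\begin{pmatrix}A&B\\C&D\end{pmatrix}\in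 U(n,n)$, with $d\gamma_0$, $\gamma_0=\mathrm{Tr}(\rho Z^+dZ)$, and $I_0=-2i\,\mathrm{Tr}\,\rho$; * $\dot{\tilde{\mathcal O}}_{10}=\{(Y,X)\in H(n)\times H(n): X\ge0,\ \mathrm{rank}\,X=1\}$ with $d\tilde\gamma_0$, $\tilde\gamma_0=-\mathrm{Tr}(X\,dY)$, and $\tilde I_0=\mathrm{Tr}(X(E+Y^2))$. For each of them let $/_\sim$ denote the passage to the space of degeneracy leaves of its 2-form (the leaves of the kernel distribution). Further let $\mathcal N_{10}$ be the adjoint $U(n,n)$-orbit of $J_0(E,i\,\mathrm{diag}(1,0,\dots,0))$ and $\tilde{\mathcal N}_{10}$ the adjoint $\widetilde{U(n,n)}$-orbit of $\tilde J_0(0,\mathrm{diag}(1,0,\dots,0))$. Equip both with their Kirillov forms $\omega_M([A,M],[B,M])=\mathrm{Tr}(M[A,B])$ ($A,B$ in the respective Lie algebra) and with the Hamiltonians $L_{\mathfrak X_{+-}}(M)=\mathrm{Tr}(\mathfrak X_{+-}M)$, resp. $L_{\tilde{\mathfrak X}_{+-}}(M)=\mathrm{Tr}(\tilde{\mathfrak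 X}_{+-}M)$, where $\mathfrak X_{+-}=i\begin{pmatrix}E&0\\0&-E\end{pmatrix}$ and $\tilde{\mathfrak X}_{+-}=\mathcal C^+\mathfrak X_{+-}\mathcal C$. Then the orbits $\mathcal N_{10}$, $\tilde{\mathcal N}_{10}$ and the four quotients by $\sim$ are symplectic manifolds of dimension $2(2n-1)$; on each quotient the 2-form and the Hamiltonian descend from the manifold upstairs. Moreover: (i) The Hamiltonian systems $(\mathcal T^0_{+-}/_\sim,I_{++}/_\sim)$, $(\tilde{\mathcal T}^0_{+-}/_\sim,\tilde I_{++}/_\sim)$ and $(\mathcal O_{10}/_\sim,I_0/_\sim)$ are isomorphic to $(\mathcal N_{10},L_{\mathfrak X_{+-}})$; isomorphisms (symplectic diffeomorphisms intertwining the Hamiltonians) are induced by $J_{+-}$, by $v\mapsto\mathcal C\,\tilde J_{+-}(v)\,\mathcal C^+$ and by $J_0$, respectively. (ii) The Hamiltonian system $(\dot{\tilde{\mathcal O}}_{10}/_\sim,\tilde I_0/_\sim)$ possesses two extensions (regularizations), given by the maps $\dot{\tilde{\mathcal O}}_{10}/_\sim\hookrightarrow\mathcal O_{10}/_\sim$ and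 $\dot{\tilde{\mathcal O}}_{10}/_\sim\hookrightarrow\tilde{\mathcal N}_{10}$ induced by $T^*_{\mathcal C}(Y,X)=\big((Y-iE)(-iY+E)^{-1},\tfrac i2(-iY+E)X(-iY+E)^+\big)$ and by $\tilde J_0$, respectively; both are injective symplectomorphisms (symplectic diffeomorphisms onto open subsets) and intertwine the Hamiltonian $\tilde I_0/_\sim$ with $I_0/_\sim$ and with $L_{\tilde{\mathfrak X}_{+-}}$, respectively. -/

import Mathlib

open Diffeology Matrix Set
open scoped ContDiff Topology ComplexOrder

attribute [local instance] Matrix.normedAddCommGroup Matrix.normedSpace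

noncomputable section

namespace Kepler

/-! ### Smooth structures: subsets and quotients

All spaces below are subsets of finite-dimensional vector spaces or quotients of such, and they
carry the canonical smooth structure, recorded as a diffeology: the smooth maps
`ℝᵐ → X` ("plots").  For smooth manifolds (embedded submanifolds, quotients by submersions) this
is the usual manifold structure, and smooth maps are the usual smooth maps. -/

/-- The model space `ℝᵐ`. -/
abbrev E (m : ℕ) : Type := EuclideanSpace ℝ (Fin m)

/-- The subset diffeology: a plot of a subset `S` of a normed space `V` is a
smooth map `ℝᵐ → V` with values in `S`. -/
instance subsetDiffeology {V : Type*} [NormedAddCommGroup V] [NormedSpace ℝ V] (S : Set V) :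
    DiffeologicalSpace S :=
  DiffeologicalSpace.ofCorePlotsOn
    { isPlotOn := fun {_ u} _ p => ContDiffOn ℝ ∞ (fun x => (p x : V)) u
      isPlotOn_congr := fun _ _ _ h => contDiffOn_congr fun x hx => by rw [h hx]
      isPlot := fun p => ContDiff ℝ ∞ (fun x => (p x : V))
      isPlotOn_univ := contDiffOn_univ
      isPlot_const := fun _ => contDiff_const
      isPlotOn_reparam := fun _ _ _ h hp hf => hp.comp hf h.subset_preimage
      locality := fun _ _ h => fun x hxu => by
        let ⟨v, hv, hxv, hv'⟩ := h x hxu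
        exact ((hv' x hxv).contDiffAt (hv.mem_nhds hxv)).contDiffWithinAt }

theorem isPlot_subset_iff {V : Type*} [NormedAddCommGroup V] [NormedSpace ℝ V] {S : Set V}
    {m : ℕ} {p : E m → S} : IsPlot p ↔ ContDiff ℝ ∞ (fun x => (p x : V)) := Iff.rfl

/-- Every neighbourhood of `x` in `ℝᵐ` contains the range of a smooth map `ℝᵐ → ℝᵐ` that is the
identity near `x`. -/
theorem exists_contDiff_germ_id {m : ℕ} (x : E m) {u : Set (E m)} (hu : IsOpen u) (hx : x ∈ u) :
    ∃ h : E m → E m, ContDiff ℝ ∞ h ∧ (∀ y, h y ∈ u) ∧ h =ᶠ[𝓝 x] id := by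
  obtain ⟨ε, hε, hb⟩ := Metric.isOpen_iff.1 hu x hx
  let χ : ContDiffBump x := ⟨ε / 4, ε / 2, by positivity, by linarith⟩
  refine ⟨fun y => x + χ y • (y - x), ?_, fun y => hb ?_, ?_⟩
  · exact contDiff_const.add (χ.contDiff.smul (contDiff_id.sub contDiff_const))
  · rw [Metric.mem_ball, dist_eq_norm, add_sub_cancel_left, norm_smul, Real.norm_of_nonneg χ.nonneg]
    by_cases hy : dist y x < ε / 2
    · calc χ y * ‖y - x‖ ≤ 1 * ‖y - x‖ :=
            mul_le_mul_of_nonneg_right χ.le_one (norm_nonneg _)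
        _ < ε := by rw [one_mul, ← dist_eq_norm]; linarith
    · rw [χ.zero_of_le_dist (not_lt.1 hy), zero_mul]; exact hε
  · filter_upwards [χ.eventuallyEq_one] with y hy
    simp [hy]

/-- The quotient diffeology: plots are the maps that locally lift to plots upstairs. -/
instance quotientDiffeology {X : Type*} [DiffeologicalSpace X] (s : Setoid X) :
    DiffeologicalSpace (Quotient s) where
  plots m := {p | ∀ x, ∃ q : E m → X, IsPlot q ∧ (fun y => Quotient.mk s (q y)) =ᶠ[𝓝 x] p}
  constant_plots y := fun _ => by
    obtain ⟨a, rfl⟩ := Quotient.exists_rep y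
    exact ⟨fun _ => a, isPlot_const, Filter.EventuallyEq.rfl⟩
  plot_reparam {m k p f} hp hf x := by
    obtain ⟨q, hq, h⟩ := hp (f x)
    exact ⟨q ∘ f, isPlot_reparam hq hf, hf.continuous.continuousAt.eventually h⟩
  locality {m p} hp x := by
    obtain ⟨u, hu, hxu, h⟩ := hp x
    obtain ⟨g, hg, hgu, hgx⟩ := exists_contDiff_germ_id x hu hxu
    obtain ⟨q, hq, hqx⟩ := h hgu hg x
    refine ⟨q, hq, ?_⟩
    filter_upwards [hqx, hgx] with y hy hy'
    rw [hy, Function.comp_apply, hy', id]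

theorem dSmooth_quotientMk {X : Type*} [DiffeologicalSpace X] (s : Setoid X) :
    DSmooth (Quotient.mk s) :=
  fun _ p hp _ => ⟨p, hp, Filter.EventuallyEq.rfl⟩

theorem dSmooth_restrict {V : Type*} [NormedAddCommGroup V] [NormedSpace ℝ V] {S : Set V}
    {f : V → ℝ} (hf : ContDiff ℝ ∞ f) : DSmooth fun x : S => f x :=
  fun _ _ hp => (hf.comp (isPlot_subset_iff.1 hp)).isPlot

/-! ### Manifolds -/

/-- `φ : ℝᵈ → X` is (the inverse of) a chart: a diffeomorphism of `ℝᵈ` onto an open subset. -/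
structure IsChart {X : Type*} [DiffeologicalSpace X] {d : ℕ} (φ : E d → X) : Prop where
  smooth : IsPlot φ
  injective : Function.Injective φ
  isOpen_range : IsOpen[DiffeologicalSpace.dTopology] (range φ)
  smooth_inv : ∀ {m : ℕ} (f : E m → E d), IsPlot (φ ∘ f) → ContDiff ℝ ∞ f

/-- `X` is a smooth manifold of dimension `d`: Hausdorff, second countable, and
every point lies in an open set diffeomorphic to `ℝᵈ`. -/
structure IsSmoothManifold (X : Type*) [DiffeologicalSpace X] (d : ℕ) : Prop where
  t2 : @T2Space X DiffeologicalSpace.dTopology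
  secondCountable : @SecondCountableTopology X DiffeologicalSpace.dTopology
  exists_chart : ∀ x : X, ∃ φ : E d → X, IsChart φ ∧ x ∈ range φ

/-! ### Differential forms -/

/-- A differential `k`-form on `X`: for each plot `p : ℝᵐ → X` a smooth `k`-form `p^*α` on
`ℝᵐ`, compatibly with smooth changes of parameters. -/
@[ext]
structure DForm (k : ℕ) (X : Type*) [DiffeologicalSpace X] where
  pull : ∀ {m : ℕ} (p : E m → X), IsPlot p → E m → (E m) [⋀^Fin k]→L[ℝ] ℝ
  smooth : ∀ {m : ℕ} (p : E m → X) (hp : IsPlot p), ContDiff ℝ ∞ (pull p hp)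
  compat : ∀ {l m : ℕ} (p : E m → X) (hp : IsPlot p) (f : E l → E m) (hf : ContDiff ℝ ∞ f)
    (x : E l), pull (p ∘ f) (isPlot_reparam hp hf) x =
      (pull p hp (f x)).compContinuousLinearMap (fderiv ℝ f x)

/-- Pullback of a form along a smooth map. -/
def DForm.pullback {k : ℕ} {X Y : Type*} [DiffeologicalSpace X] [DiffeologicalSpace Y]
    (β : DForm k Y) {f : X → Y} (hf : DSmooth f) : DForm k X where
  pull p hp := β.pull (f ∘ p) (hf _ p hp)
  smooth _ _ := β.smooth _ _
  compat p hp g hg x := β.compat (f ∘ p) (hf _ p hp) g hg x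

/-- `dα = 0`. -/
def DForm.IsClosed {k : ℕ} {X : Type*} [DiffeologicalSpace X] (α : DForm k X) : Prop :=
  ∀ {m : ℕ} (p : E m → X) (hp : IsPlot p) (x : E m), extDeriv (α.pull p hp) x = 0

/-- A 2-form on a `d`-dimensional manifold is nondegenerate. -/
def DForm.IsNondegenerate {X : Type*} [DiffeologicalSpace X] (α : DForm 2 X) (d : ℕ) : Prop :=
  ∀ (φ : E d → X) (hφ : IsChart φ) (x v : E d),
    (∀ w : E d, α.pull φ hφ.smooth x ![v, w] = 0) → v = 0

theorem contDiff_compContinuousLinearMap {D F G : Type*} [NormedAddCommGroup D] [NormedSpace ℝ D]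
    [NormedAddCommGroup F] [NormedSpace ℝ F] [NormedAddCommGroup G] [NormedSpace ℝ G]
    [FiniteDimensional ℝ G] {k : ℕ} {β : D → F [⋀^Fin k]→L[ℝ] ℝ} {L : D → G →L[ℝ] F}
    (hβ : ContDiff ℝ ∞ β) (hL : ContDiff ℝ ∞ L) :
    ContDiff ℝ ∞ (fun x => (β x).compContinuousLinearMap (L x)) := by
  induction k with
  | zero =>
    have h : (fun x => (β x).compContinuousLinearMap (L x)) = fun x =>
        ContinuousAlternatingMap.compContinuousLinearMapCLM (0 : G →L[ℝ] F) (β x) := by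
      funext x
      ext v
      simp only [ContinuousAlternatingMap.compContinuousLinearMap_apply,
        ContinuousAlternatingMap.compContinuousLinearMapCLM_apply]
      exact congrArg _ (Subsingleton.elim _ _)
    rw [h]
    exact (ContinuousLinearMap.contDiff _).comp hβ
  | succ k ih =>
    have hc : ContDiff ℝ ∞ (fun x => ((β x).compContinuousLinearMap (L x)).curryLeft) := by
      rw [contDiff_clm_apply_iff]
      intro v
      simp only [ContinuousAlternatingMap.curryLeft_compContinuousLinearMap]
      refine ih ?_
      have h1 : ContDiff ℝ ∞ (fun x => (β x).curryLeft) := by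
        have h2 : IsBoundedLinearMap ℝ
            (fun f : F [⋀^Fin (k + 1)]→L[ℝ] ℝ => f.curryLeft) :=
          ⟨⟨fun _ _ => rfl, fun _ _ => rfl⟩, 1, one_pos, fun f => by
            rw [ContinuousAlternatingMap.norm_curryLeft, one_mul]⟩
        exact (IsBoundedLinearMap.contDiff (E := F [⋀^Fin (k + 1)]→L[ℝ] ℝ)
          (F := F →L[ℝ] F [⋀^Fin k]→L[ℝ] ℝ) h2).comp hβ
      exact h1.clm_apply (hL.clm_apply contDiff_const)
    have h : (fun x => (β x).compContinuousLinearMap (L x)) = fun x => ((k + 1 : ℕ) : ℝ)⁻¹ •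
        ContinuousAlternatingMap.alternatizeUncurryFinCLM ℝ G ℝ
          ((β x).compContinuousLinearMap (L x)).curryLeft := by
      funext x
      rw [ContinuousAlternatingMap.alternatizeUncurryFinCLM_apply,
        ContinuousAlternatingMap.alternatizeUncurryFin_curryLeft, ← Nat.cast_smul_eq_nsmul ℝ,
        smul_smul, inv_mul_cancel₀ (by positivity), one_smul]
    rw [h]
    have h1 := ContDiff.continuousLinearMap_comp (E := D) (F := G →L[ℝ] G [⋀^Fin k]→L[ℝ] ℝ)
      (G := G [⋀^Fin (k + 1)]→L[ℝ] ℝ)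
      (ContinuousAlternatingMap.alternatizeUncurryFinCLM ℝ G ℝ) hc
    exact ContDiff.const_smul (((k + 1 : ℕ) : ℝ)⁻¹) h1

/-- The restriction to a subset `S ⊆ V` of a differential form on the vector space `V`. -/
def DForm.restrict {k : ℕ} {V : Type*} [NormedAddCommGroup V] [NormedSpace ℝ V] (S : Set V)
    (β : V → V [⋀^Fin k]→L[ℝ] ℝ) (hβ : ContDiff ℝ ∞ β) : DForm k S where
  pull p _ x := (β (p x)).compContinuousLinearMap (fderiv ℝ (fun y => (p y : V)) x)
  smooth p hp := by
    have hp' : ContDiff ℝ ∞ (fun y => (p y : V)) := hp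
    exact contDiff_compContinuousLinearMap (hβ.comp hp') (hp'.fderiv_right (by simp))
  compat p hp f hf x := by
    have hp' : ContDiff ℝ ∞ (fun y => (p y : V)) := hp
    have h := fderiv_comp x (hp'.differentiable (by simp)).differentiableAt
      (hf.differentiable (by simp)).differentiableAt
    ext v
    change (β _) _ = (β _) _
    rw [show (fun y => ((p ∘ f) y : V)) = (fun y => (p y : V)) ∘ f from rfl, h]
    rfl

/-- The exterior derivative `dγ` of a one-form `γ` on a vector space `V`. -/
def dOneForm {V : Type*} [NormedAddCommGroup V] [NormedSpace ℝ V] [FiniteDimensional ℝ V]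
    (γ : V → V →ₗ[ℝ] ℝ) : V → V [⋀^Fin 2]→L[ℝ] ℝ :=
  extDeriv fun v => ContinuousAlternatingMap.ofSubsingleton ℝ V ℝ (0 : Fin 1)
    (LinearMap.toContinuousLinearMap (γ v))

theorem contDiff_dOneForm {V : Type*} [NormedAddCommGroup V] [NormedSpace ℝ V]
    [FiniteDimensional ℝ V] {γ : V → V →ₗ[ℝ] ℝ} (hγ : ∀ w, ContDiff ℝ ∞ fun v => γ v w) :
    ContDiff ℝ ∞ (dOneForm γ) := by
  have h0 : ContDiff ℝ ∞ (fun v => LinearMap.toContinuousLinearMap (γ v)) :=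
    contDiff_clm_apply_iff.2 hγ
  have h1 := (ContinuousAlternatingMap.ofSubsingletonLIE (𝕜 := ℝ) (E := V) (F := ℝ)
      (0 : Fin 1)).contDiff.comp h0
  exact (ContinuousAlternatingMap.alternatizeUncurryFinCLM ℝ V ℝ).contDiff.comp
    (h1.fderiv_right (m := ∞) (by simp))

/-! ### Degeneracy leaves and reduced Hamiltonian systems -/

/-- A smooth curve tangent to the kernel of the 2-form `α`: whenever `c` locally factors through
a plot `P` as `P ∘ a`, the velocity of `a` is annihilated by `P^*α`. -/
def IsDegeneracyCurve {X : Type*} [DiffeologicalSpace X] (α : DForm 2 X) (c : ℝ → X) : Prop :=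
  DSmooth c ∧ ∀ {m : ℕ} (P : E m → X) (hP : IsPlot P) (a : ℝ → E m), ContDiff ℝ ∞ a →
    ∀ t : ℝ, P ∘ a =ᶠ[𝓝 t] c → ∀ w : E m, α.pull P hP (a t) ![deriv a t, w] = 0

/-- The equivalence relation `∼` whose classes are the degeneracy leaves of `α`: two points
are equivalent if they can be joined by finitely many curves tangent to the kernel of `α`. -/
def leafSetoid {X : Type*} [DiffeologicalSpace X] (α : DForm 2 X) : Setoid X :=
  Relation.EqvGen.setoid fun x y => ∃ c : ℝ → X, IsDegeneracyCurve α c ∧ c 0 = x ∧ c 1 = y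

/-- The space `X/∼` of degeneracy leaves of `α`. -/
abbrev LeafSpace {X : Type*} [DiffeologicalSpace X] (α : DForm 2 X) : Type _ :=
  Quotient (leafSetoid α)

/-- The leaf through `x`. -/
abbrev leaf {X : Type*} [DiffeologicalSpace X] (α : DForm 2 X) (x : X) : LeafSpace α :=
  Quotient.mk (leafSetoid α) x

/-- A space with a (possibly degenerate) 2-form and a smooth Hamiltonian function. -/
structure PreHamiltonianSystem (X : Type*) [DiffeologicalSpace X] where
  form : DForm 2 X
  ham : X → ℝ
  ham_smooth : DSmooth ham

/-- A Hamiltonian system with `k` degrees of freedom: a symplectic manifold of dimension `2k`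
and a smooth Hamiltonian function on it. -/
structure HamiltonianSystem (X : Type*) [DiffeologicalSpace X] (k : ℕ) extends
    PreHamiltonianSystem X where
  manifold : IsSmoothManifold X (2 * k)
  closed : form.IsClosed
  nondegenerate : form.IsNondegenerate (2 * k)

/-- `R` is the reduction of `A`: it lives on the space of degeneracy leaves of the form of `A`,
and its form and Hamiltonian pull back to those of `A` along the projection. -/
structure IsReduction {X : Type*} [DiffeologicalSpace X] {k : ℕ} (A : PreHamiltonianSystem X)
    (R : HamiltonianSystem (LeafSpace A.form) k) : Prop where
  form_eq : R.form.pullback (dSmooth_quotientMk (leafSetoid A.form)) = A.form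
  ham_eq : ∀ x : X, R.ham (leaf A.form x) = A.ham x

/-- `f` exhibits the Hamiltonian system `B` as an extension of `A`: it is an injective
symplectomorphism (a symplectic diffeomorphism onto an open subset) intertwining the
Hamiltonians. -/
structure IsExtension {X Y : Type*} [DiffeologicalSpace X] [DiffeologicalSpace Y] {k : ℕ}
    (A : HamiltonianSystem X k) (B : HamiltonianSystem Y k) (f : X → Y) : Prop where
  injective : Function.Injective f
  isOpen_range : IsOpen[DiffeologicalSpace.dTopology] (range f)
  smooth : DSmooth f
  smooth_inv : ∀ {m : ℕ} (p : E m → X), IsPlot (f ∘ p) → IsPlot p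
  form_eq : B.form.pullback smooth = A.form
  ham_eq : ∀ x : X, B.ham (f x) = A.ham x

/-- `f` is an isomorphism of Hamiltonian systems: a symplectic diffeomorphism of `X` onto `Y`
intertwining the Hamiltonians. -/
structure IsIsomorphism {X Y : Type*} [DiffeologicalSpace X] [DiffeologicalSpace Y] {k : ℕ}
    (A : HamiltonianSystem X k) (B : HamiltonianSystem Y k) (f : X → Y) : Prop extends
    IsExtension A B f where
  surjective : Function.Surjective f

/-! ### Smoothness of matrix functions -/

theorem contDiff_matrix_iff {V : Type*} [NormedAddCommGroup V] [NormedSpace ℝ V]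
    {ι κ : Type*} [Fintype ι] [Fintype κ] {f : V → Matrix ι κ ℂ} :
    ContDiff ℝ ∞ f ↔ ∀ i j, ContDiff ℝ ∞ fun x => f x i j :=
  contDiff_pi.trans (forall_congr' fun _ => contDiff_pi)

theorem contDiff_matrix_mul {V : Type*} [NormedAddCommGroup V] [NormedSpace ℝ V] {n : ℕ}
    {f g : V → Matrix (Fin n) (Fin n) ℂ} (hf : ContDiff ℝ ∞ f) (hg : ContDiff ℝ ∞ g) :
    ContDiff ℝ ∞ fun x => f x * g x := by
  rw [contDiff_matrix_iff] at *
  intro i j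
  simp only [Matrix.mul_apply]
  exact ContDiff.sum fun k _ => (hf i k).mul (hg k j)

theorem contDiff_re_trace {V : Type*} [NormedAddCommGroup V] [NormedSpace ℝ V] {n : ℕ}
    {f : V → Matrix (Fin n) (Fin n) ℂ} (hf : ContDiff ℝ ∞ f) :
    ContDiff ℝ ∞ fun x => (trace (f x)).re :=
  Complex.reCLM.contDiff.comp (ContDiff.sum fun i _ => contDiff_matrix_iff.1 hf i i)

theorem contDiff_star_dotProduct {V : Type*} [NormedAddCommGroup V] [NormedSpace ℝ V] {n : ℕ}
    {f g : V → Fin n → ℂ} (hf : ContDiff ℝ ∞ f) (hg : ContDiff ℝ ∞ g) :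
    ContDiff ℝ ∞ fun x => star (f x) ⬝ᵥ g x := by
  rw [contDiff_pi] at hf hg
  exact ContDiff.sum fun i _ => (Complex.conjCLE.contDiff.comp (hf i)).mul (hg i)

/-! ### Pseudo-unitary groups and adjoint orbits -/

/-- Complex `n × n` matrices. -/
abbrev Mat (n : ℕ) : Type := Matrix (Fin n) (Fin n) ℂ

/-- Complex `2n × 2n` matrices, in block form. -/
abbrev Mat2 (n : ℕ) : Type := Matrix (Fin n ⊕ Fin n) (Fin n ⊕ Fin n) ℂ

/-- `ℂ²ⁿ = ℂⁿ ⊕ ℂⁿ`. -/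
abbrev Twistor (n : ℕ) : Type := (Fin n → ℂ) × (Fin n → ℂ)

/-- The diagonal realization `φ_d = (E, 0; 0, -E)` of the hermitian form. -/
def phiD (n : ℕ) : Mat2 n := fromBlocks 1 0 0 (-1)

/-- The anti-diagonal realization `φ_a = i (0, -E; E, 0)` of the hermitian form. -/
def phiA (n : ℕ) : Mat2 n := Complex.I • fromBlocks 0 (-1) 1 0

/-- The group of `g` with `g⁺ φ g = φ`. -/
def pseudoUnitary {n : ℕ} (φ : Mat2 n) : Set (Mat2 n) := {g | gᴴ * φ * g = φ}

/-- Its Lie algebra: the `A` with `A⁺ φ + φ A = 0`. -/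
def pseudoUnitaryLie {n : ℕ} (φ : Mat2 n) : Set (Mat2 n) := {A | Aᴴ * φ + φ * A = 0}

/-- The adjoint orbit of `M`. -/
def adOrbit {n : ℕ} (φ M : Mat2 n) : Set (Mat2 n) :=
  {M' | ∃ g ∈ pseudoUnitary φ, M' = g * M * g⁻¹}

/-- `α` is the Kirillov form of the orbit `N`: at `M ∈ N`,
`α ([A, M], [B, M]) = Tr (M [A, B])` for `A`, `B` in the Lie algebra, the dual of
the Lie algebra being identified with the Lie algebra by the trace form. -/
def IsKirillovForm {n : ℕ} (φ : Mat2 n) {N : Set (Mat2 n)} (α : DForm 2 N) : Prop :=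
  ∀ {m : ℕ} (p : E m → N) (hp : IsPlot p) (x v w : E m),
    ∃ A ∈ pseudoUnitaryLie φ, ∃ B ∈ pseudoUnitaryLie φ,
      fderiv ℝ (fun y => (p y : Mat2 n)) x v = A * p x - p x * A ∧
      fderiv ℝ (fun y => (p y : Mat2 n)) x w = B * p x - p x * B ∧
      α.pull p hp x ![v, w] = (trace ((p x : Mat2 n) * (A * B - B * A))).re

/-- The linear function `L_A (M) = Tr (A M)`; it is real on the Lie algebra. -/
def linearHam {n : ℕ} (A M : Mat2 n) : ℝ := (trace (A * M)).re

/-- `𝔛₊₋ = i (E, 0; 0, -E)`. -/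
def xPM (n : ℕ) : Mat2 n := Complex.I • fromBlocks 1 0 0 (-1)

/-- The Cayley matrix `𝒞 = (1/√2) (E, -iE; -iE, E)`. -/
def cayley (n : ℕ) : Mat2 n :=
  ((1 / Real.sqrt 2 : ℝ) : ℂ) • fromBlocks 1 (-(Complex.I • 1)) (-(Complex.I • 1)) 1

/-- `𝔛₊₋` in the anti-diagonal realization: `𝒞⁺ 𝔛₊₋ 𝒞 = (0, E; -E, 0)`. -/
def xPMt (n : ℕ) : Mat2 n := (cayley n)ᴴ * xPM n * cayley n

/-- The diagonal matrix with `k` entries `1`, then `l` entries `-1`, then zeros. -/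
def sigmaKL (n k l : ℕ) : Mat n :=
  diagonal fun j => if (j : ℕ) < k then 1 else if (j : ℕ) < k + l then -1 else 0

/-! ### The cotangent bundle `T^*U(n) = U(n) × i H(n)` -/

/-- The momentum map `J₀ (Z, ρ) = (-ZρZ⁺, Zρ; (Zρ)⁺, ρ)`. -/
def J0 {n : ℕ} (q : Mat n × Mat n) : Mat2 n :=
  fromBlocks (-(q.1 * q.2 * q.1ᴴ)) (q.1 * q.2) (q.1 * q.2)ᴴ q.2

/-- The action `Λ_g (Z, ρ) = ((AZ + B)(CZ + D)⁻¹, (CZ + D) ρ (CZ + D)⁺)`, `g = (A, B; C, D)`. -/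
def lambdaAct {n : ℕ} (g : Mat2 n) (q : Mat n × Mat n) : Mat n × Mat n :=
  ((g.toBlocks₁₁ * q.1 + g.toBlocks₁₂) * (g.toBlocks₂₁ * q.1 + g.toBlocks₂₂)⁻¹,
    (g.toBlocks₂₁ * q.1 + g.toBlocks₂₂) * q.2 * (g.toBlocks₂₁ * q.1 + g.toBlocks₂₂)ᴴ)

/-- `𝒪_{kl}`: the `Λ(U(n,n))`-orbit of `(E, ρ_{kl})`, `ρ_{kl} = i diag(1,…,1,-1,…,-1,0,…,0)`. -/
def orbitO (n k l : ℕ) : Set (Mat n × Mat n) :=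
  {q | ∃ g ∈ pseudoUnitary (phiD n), q = lambdaAct g (1, Complex.I • sigmaKL n k l)}

/-- `𝒩_{kl}`: the adjoint orbit of `J₀ (E, ρ_{kl})`. -/
def orbitN (n k l : ℕ) : Set (Mat2 n) :=
  adOrbit (phiD n) (J0 (1, Complex.I • sigmaKL n k l))

/-- The canonical one-form `γ₀ = Tr (ρ Z⁺ dZ)` on `U(n) × i H(n)` (the trace is real there). -/
def gamma0 {n : ℕ} (q : Mat n × Mat n) : (Mat n × Mat n) →ₗ[ℝ] ℝ where
  toFun := fun w => (trace (q.2 * q.1ᴴ * w.1)).re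
  map_add' := fun w w' => by simp [mul_add]
  map_smul' := fun r w => by simp

theorem contDiff_gamma0 (n : ℕ) :
    ∀ w, ContDiff ℝ ∞ fun v => gamma0 (n := n) v w := by
  intro w
  refine contDiff_re_trace (contDiff_matrix_mul (contDiff_matrix_mul contDiff_snd ?_)
    contDiff_const)
  rw [contDiff_matrix_iff]
  intro i j
  exact Complex.conjCLE.contDiff.comp (contDiff_matrix_iff.1 contDiff_fst j i)

/-- `(𝒪₁₀, dγ₀, I₀)` with `I₀ = -2i Tr ρ`. -/
def sysO (n : ℕ) : PreHamiltonianSystem (orbitO n 1 0) where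
  form := DForm.restrict _ (dOneForm gamma0) (contDiff_dOneForm (contDiff_gamma0 n))
  ham q := (-2 * Complex.I * trace q.1.2).re
  ham_smooth := by
    refine dSmooth_restrict (f := fun q : Mat n × Mat n => (-2 * Complex.I * trace q.2).re) ?_
    refine Complex.reCLM.contDiff.comp (contDiff_const.mul ?_)
    exact ContDiff.sum fun i _ => contDiff_matrix_iff.1 contDiff_snd i i

/-! ### Null twistors -/

/-- The momentum map `J₊₋ (η, ξ) = i (-ηη⁺, ηξ⁺; -ξη⁺, ξξ⁺)`. -/
def JPM {n : ℕ} (v : Twistor n) : Mat2 n :=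
  Complex.I • fromBlocks (-vecMulVec v.1 (star v.1)) (vecMulVec v.1 (star v.2))
    (-vecMulVec v.2 (star v.1)) (vecMulVec v.2 (star v.2))

/-- The nonzero null twistors: `η⁺η - ξ⁺ξ = 0`, `(η, ξ) ≠ 0`. -/
def nullT (n : ℕ) : Set (Twistor n) :=
  {v | v ≠ 0 ∧ star v.1 ⬝ᵥ v.1 - star v.2 ⬝ᵥ v.2 = 0}

/-- The one-form `γ₊₋ = i (η⁺dη - ξ⁺dξ)`, or rather its real part: the imaginary part
`d (η⁺η - ξ⁺ξ) / 2` is closed, so that both have the same exterior derivative. -/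
def gammaPM {n : ℕ} (v : Twistor n) : Twistor n →ₗ[ℝ] ℝ where
  toFun := fun w => (Complex.I * (star v.1 ⬝ᵥ w.1 - star v.2 ⬝ᵥ w.2)).re
  map_add' := fun w w' => by simp; ring
  map_smul' := fun r w => by simp; ring

theorem contDiff_gammaPM (n : ℕ) :
    ∀ w, ContDiff ℝ ∞ fun v => gammaPM (n := n) v w := by
  intro w
  exact Complex.reCLM.contDiff.comp (contDiff_const.mul
    ((contDiff_star_dotProduct contDiff_fst contDiff_const).sub
      (contDiff_star_dotProduct contDiff_snd contDiff_const)))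

/-- `(𝒯⁰₊₋, dγ₊₋, I₊₊)` with `I₊₊ = η⁺η + ξ⁺ξ`. -/
def sysT (n : ℕ) : PreHamiltonianSystem (nullT n) where
  form := DForm.restrict _ (dOneForm gammaPM) (contDiff_dOneForm (contDiff_gammaPM n))
  ham v := (star v.1.1 ⬝ᵥ v.1.1 + star v.1.2 ⬝ᵥ v.1.2).re
  ham_smooth := by
    refine dSmooth_restrict (f := fun v : Twistor n => (star v.1 ⬝ᵥ v.1 + star v.2 ⬝ᵥ v.2).re) ?_
    exact Complex.reCLM.contDiff.comp ((contDiff_star_dotProduct contDiff_fst contDiff_fst).add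
      (contDiff_star_dotProduct contDiff_snd contDiff_snd))

/-! ### The anti-diagonal realization -/

/-- The momentum map `J̃₊₋ (υ, ζ) = (υζ⁺, -υυ⁺; ζζ⁺, -ζυ⁺)`. -/
def JPMt {n : ℕ} (v : Twistor n) : Mat2 n :=
  fromBlocks (vecMulVec v.1 (star v.2)) (-vecMulVec v.1 (star v.1))
    (vecMulVec v.2 (star v.2)) (-vecMulVec v.2 (star v.1))

/-- The nonzero null twistors: `i (ζ⁺υ - υ⁺ζ) = 0`, `(υ, ζ) ≠ 0`. -/
def nullTt (n : ℕ) : Set (Twistor n) :=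
  {v | v ≠ 0 ∧ Complex.I * (star v.2 ⬝ᵥ v.1 - star v.1 ⬝ᵥ v.2) = 0}

/-- The one-form `γ̃₊₋ = υ⁺dζ - ζ⁺dυ`, or rather its real part: the imaginary part
is `d (Im υ⁺ζ)`, so that both have the same exterior derivative. -/
def gammaPMt {n : ℕ} (v : Twistor n) : Twistor n →ₗ[ℝ] ℝ where
  toFun := fun w => (star v.1 ⬝ᵥ w.2 - star v.2 ⬝ᵥ w.1).re
  map_add' := fun w w' => by simp; ring
  map_smul' := fun r w => by simp; ring

theorem contDiff_gammaPMt (n : ℕ) :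
    ∀ w, ContDiff ℝ ∞ fun v => gammaPMt (n := n) v w := by
  intro w
  exact Complex.reCLM.contDiff.comp
    ((contDiff_star_dotProduct contDiff_fst contDiff_const).sub
      (contDiff_star_dotProduct contDiff_snd contDiff_const))

/-- `(𝒯̃⁰₊₋, dγ̃₊₋, Ĩ₊₊)` with `Ĩ₊₊ = υ⁺υ + ζ⁺ζ`. -/
def sysTt (n : ℕ) : PreHamiltonianSystem (nullTt n) where
  form := DForm.restrict _ (dOneForm gammaPMt) (contDiff_dOneForm (contDiff_gammaPMt n))
  ham v := (star v.1.1 ⬝ᵥ v.1.1 + star v.1.2 ⬝ᵥ v.1.2).re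
  ham_smooth := by
    refine dSmooth_restrict (f := fun v : Twistor n => (star v.1 ⬝ᵥ v.1 + star v.2 ⬝ᵥ v.2).re) ?_
    exact Complex.reCLM.contDiff.comp ((contDiff_star_dotProduct contDiff_fst contDiff_fst).add
      (contDiff_star_dotProduct contDiff_snd contDiff_snd))

/-- The momentum map `J̃₀ (Y, X) = (YX, -YXY; X, -XY)` on `H(n) × H(n)`. -/
def J0t {n : ℕ} (q : Mat n × Mat n) : Mat2 n :=
  fromBlocks (q.1 * q.2) (-(q.1 * q.2 * q.1)) q.2 (-(q.2 * q.1))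

/-- `𝒩̃_{kl}`, the orbit `𝒩_{kl}` in the anti-diagonal realization: the adjoint orbit of
`J̃₀ (0, diag(1,…,1,-1,…,-1,0,…,0))`. -/
def orbitNt (n k l : ℕ) : Set (Mat2 n) :=
  adOrbit (phiA n) (J0t (0, sigmaKL n k l))

/-- The pairs `(Y, X)` of hermitian matrices with `X ≥ 0` of rank one. -/
def orbitOt (n : ℕ) : Set (Mat n × Mat n) :=
  {q | q.1.IsHermitian ∧ q.2.PosSemidef ∧ q.2.rank = 1}

/-- The one-form `γ̃₀ = -Tr (X dY)` on `H(n) × H(n)` (the trace is real there). -/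
def gamma0t {n : ℕ} (q : Mat n × Mat n) : (Mat n × Mat n) →ₗ[ℝ] ℝ where
  toFun := fun w => -(trace (q.2 * w.1)).re
  map_add' := fun w w' => by simp [mul_add]; ring
  map_smul' := fun r w => by simp

theorem contDiff_gamma0t (n : ℕ) :
    ∀ w, ContDiff ℝ ∞ fun v => gamma0t (n := n) v w := by
  intro w
  exact (contDiff_re_trace (contDiff_matrix_mul contDiff_snd contDiff_const)).neg

/-- The system with `dγ̃₀` and `Ĩ₀ = Tr (X (E + Y²))` on the pairs `(Y, X)` above. -/
def sysOt (n : ℕ) : PreHamiltonianSystem (orbitOt n) where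
  form := DForm.restrict _ (dOneForm gamma0t) (contDiff_dOneForm (contDiff_gamma0t n))
  ham q := (trace (q.1.2 * (1 + q.1.1 ^ 2))).re
  ham_smooth := by
    refine dSmooth_restrict (f := fun q : Mat n × Mat n => (trace (q.2 * (1 + q.1 ^ 2))).re) ?_
    refine contDiff_re_trace (contDiff_matrix_mul contDiff_snd (contDiff_const.add ?_))
    simp only [pow_two]
    exact contDiff_matrix_mul contDiff_fst contDiff_fst

/-- The lifted Cayley transform
`T^*_𝒞 (Y, X) = ((Y - iE)(-iY + E)⁻¹, (i/2) (-iY + E) X (-iY + E)⁺)`. -/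
def cayleyT {n : ℕ} (q : Mat n × Mat n) : Mat n × Mat n :=
  ((q.1 - Complex.I • 1) * (-(Complex.I • q.1) + 1)⁻¹,
    (Complex.I / 2) • ((-(Complex.I • q.1) + 1) * q.2 * (-(Complex.I • q.1) + 1)ᴴ))

end Kepler

end

open Kepler

/-! Every quotient is compared with the single orbit `orbitNt`. A point of either orbit is the
momentum `-i V V⁺ φ` of a nonzero vector `V` with `V⁺ φ V = 0`, and `V` is unique up to a phase
(`mem_orbitN_iff`, `mem_orbitNt_iff`, `exists_phase`). The Cayley matrix is unitary and carries one
hermitian form to the other, so `orbitN` is a conjugate copy of `orbitNt`. The orbit `orbitO`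
consists of the pairs `(Z, i ξ ξ⁺)` with `Z` unitary and `ξ ≠ 0`, whose momentum is that of the null
vector `(Zξ, ξ)`; likewise `(Y, ζ ζ⁺)` has the momentum of `(Yζ, ζ)`.

The symplectic structure of the orbit comes from a global potential, `theta = -Re (Tr (M dM φ) / Tr
(M φ))`. If `M = c ρ d` with `d c = 0` and `ρ` of rank one, then `M dM = Tr (ρ d dc) M`, so `theta`
pulls back to `-Re Tr (ρ d dc)` (`theta_factor`). For the factorizations coming from the four
momentum maps this is exactly the given one-form, which yields all four identities of 2-forms at the
level of primitives. Charts are obtained by making one component of `V` positive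
(`exists_chart_ne_zero`, `exists_charts_orbitNt`). Nondegeneracy holds because the form, paired with
the rotated vector `(-z, u)`, is positive definite in `(u, z)` (`eq_zero_of_chartLift`). That the
form is the Kirillov form follows by lifting to null vectors, where each tangent vector is `A V`
with `A` in the Lie algebra (`exists_lie`).

The quotients are handled by one reduction principle, `exists_reduction`. Let `J` be smooth into a
symplectic manifold, with local sections through every point depending smoothly on that point, and
with fibres connected by smooth curves. Then the degeneracy leaves of the pulled back form are the
fibres of `J`, and the leaf space is an open piece of the target. The sections are explicit:
projection to a line for twistors, a hermitian correction of `Y`, and a product of two reflections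
correcting `Z`. The fibres are circles of phases, affine spaces of hermitian matrices, and cosets of
the stabilizer of a vector in `U(n)`, which is connected by a Cayley transform
(`exists_unitary_path`).

Three of the momentum maps are onto, which gives (i). The fourth misses the momenta with `ζ = 0`, so
it gives only an extension. Inverting the isomorphism of the reduced `orbitO` gives the other one,
and `cayleyT_mem` identifies it with the lifted Cayley transform. -/

namespace Kepler

/-! ### Diffeological manifolds, open embeddings and transport of Hamiltonian systems -/

section Diffeological

variable {X Y Z : Type*} [DiffeologicalSpace X] [DiffeologicalSpace Y] [DiffeologicalSpace Z]

theorem isPlot_of_eventuallyEq {m : ℕ} {p : E m → X}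
    (h : ∀ x, ∃ q : E m → X, IsPlot q ∧ q =ᶠ[𝓝 x] p) : IsPlot p :=
  DiffeologicalSpace.locality fun x => by
    obtain ⟨q, hq, he⟩ := h x
    obtain ⟨u, hsub, hu, hx⟩ := mem_nhds_iff.1 he
    refine ⟨u, hu, hx, fun {k f} hf hfs => ?_⟩
    rw [show p ∘ f = q ∘ f from funext fun y => (hsub (hf y)).symm]
    exact isPlot_reparam hq hfs

/-- A map `g` that is the identity near `x` does not change the pullback at `x`. If it takes values
where `p` and `q` agree, then `p ∘ g` and `q ∘ g` are the same plot. -/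
theorem DForm.pull_congr {k m : ℕ} (α : DForm k X) {p q : E m → X} (hp : IsPlot p)
    (hq : IsPlot q) {x : E m} (h : p =ᶠ[𝓝 x] q) : α.pull p hp x = α.pull q hq x := by
  obtain ⟨u, hsub, hu, hx⟩ := mem_nhds_iff.1 h
  obtain ⟨g, hg, hgu, hgx⟩ := exists_contDiff_germ_id x hu hx
  have key : ∀ (r : E m → X) (hr : IsPlot r),
      α.pull r hr x = α.pull (r ∘ g) (isPlot_reparam hr hg) x := by
    intro r hr
    rw [α.compat r hr g hg x, hgx.fderiv_eq, hgx.eq_of_nhds, fderiv_id]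
    rfl
  have hpq : p ∘ g = q ∘ g := funext fun y => hsub (hgu y)
  rw [key p hp, key q hq]
  simp only [hpq]

/-- A diffeomorphism onto an open subset. -/
structure IsOpenEmb (f : X → Y) : Prop where
  injective : Function.Injective f
  isOpen_range : IsOpen[DiffeologicalSpace.dTopology] (range f)
  smooth : DSmooth f
  smooth_inv : ∀ {m : ℕ} (p : E m → X), IsPlot (f ∘ p) → IsPlot p

theorem IsExtension.isOpenEmb {k : ℕ} {A : HamiltonianSystem X k} {B : HamiltonianSystem Y k}
    {f : X → Y} (h : IsExtension A B f) : IsOpenEmb f :=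
  ⟨h.injective, h.isOpen_range, h.smooth, h.smooth_inv⟩

/-- Plots live on all of `ℝᵐ`, so the parameter is first squeezed into the open preimage of the
range by a map that is the identity near `x`. -/
theorem IsOpenEmb.exists_lift {f : X → Y} (hf : IsOpenEmb f) {m : ℕ} {p : E m → Y} (hp : IsPlot p)
    {x : E m} (hx : p x ∈ range f) : ∃ q : E m → X, IsPlot q ∧ f ∘ q =ᶠ[𝓝 x] p := by
  obtain ⟨g, hg, hgu, hgx⟩ := exists_contDiff_germ_id x
    (isOpen_iff_preimages_plots.1 hf.isOpen_range m p hp) hx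
  choose q hq using hgu
  have hq' : f ∘ q = p ∘ g := funext hq
  refine ⟨q, hf.smooth_inv q (hq' ▸ isPlot_reparam hp hg), ?_⟩
  rw [hq']
  filter_upwards [hgx] with y hy
  simp [hy]

theorem IsOpenEmb.isOpen_image {f : X → Y} (hf : IsOpenEmb f) {U : Set X}
    (hU : IsOpen[DiffeologicalSpace.dTopology] U) :
    IsOpen[DiffeologicalSpace.dTopology] (f '' U) := by
  refine isOpen_iff_preimages_plots.2 fun m p hp => isOpen_iff_mem_nhds.2 ?_
  rintro x ⟨a, ha, hax⟩
  obtain ⟨q, hq, he⟩ := hf.exists_lift hp ⟨a, hax⟩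
  have hqx : q x = a := hf.injective (he.eq_of_nhds.trans hax.symm)
  have := (isOpen_iff_preimages_plots.1 hU m q hq).mem_nhds (show x ∈ q ⁻¹' U by
    rwa [mem_preimage, hqx])
  filter_upwards [this, he] with y hy hy'
  exact ⟨q y, hy, hy'⟩

theorem IsOpenEmb.isOpenEmbedding {f : X → Y} (hf : IsOpenEmb f) :
    @Topology.IsOpenEmbedding X Y DiffeologicalSpace.dTopology DiffeologicalSpace.dTopology f := by
  let _ : TopologicalSpace X := DiffeologicalSpace.dTopology
  let _ : TopologicalSpace Y := DiffeologicalSpace.dTopology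
  exact .of_continuous_injective_isOpenMap hf.smooth.continuous hf.injective
    fun U hU => hf.isOpen_image hU

theorem IsOpenEmb.comp {f : X → Y} {g : Y → Z} (hg : IsOpenEmb g) (hf : IsOpenEmb f) :
    IsOpenEmb (g ∘ f) where
  injective := hg.injective.comp hf.injective
  isOpen_range := by rw [range_comp]; exact hg.isOpen_image hf.isOpen_range
  smooth := hg.smooth.comp hf.smooth
  smooth_inv p hp := hf.smooth_inv p (hg.smooth_inv _ hp)

theorem IsOpenEmb.of_comp {f : X → Y} {g : Y → Z} (hg : IsOpenEmb g) (h : IsOpenEmb (g ∘ f)) :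
    IsOpenEmb f where
  injective := h.injective.of_comp
  isOpen_range := by
    have := (@continuous_def _ _ (_) (_) _).1 hg.smooth.continuous _ h.isOpen_range
    rwa [range_comp, preimage_image_eq _ hg.injective] at this
  smooth _ p hp := hg.smooth_inv _ (h.smooth _ p hp)
  smooth_inv p hp := h.smooth_inv p (hg.smooth _ _ hp)

/-- A smooth bijection with a smooth inverse. -/
theorem IsOpenEmb.of_inverse {f : X → Y} {g : Y → X} (hf : DSmooth f) (hg : DSmooth g)
    (hgf : Function.LeftInverse g f) (hfg : Function.RightInverse g f) : IsOpenEmb f where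
  injective := hgf.injective
  isOpen_range := by
    rw [hfg.surjective.range_eq]
    exact @isOpen_univ _ (_)
  smooth := hf
  smooth_inv p hp := by
    have := hg _ _ hp
    rwa [show g ∘ f ∘ p = p from funext fun x => hgf (p x)] at this

theorem IsChart.isOpenEmb {d : ℕ} {φ : E d → X} (h : IsChart φ) : IsOpenEmb φ :=
  ⟨h.injective, h.isOpen_range, h.smooth.dSmooth, fun p hp => h.smooth_inv p hp⟩

theorem IsOpenEmb.isChart {d : ℕ} {φ : E d → X} (h : IsOpenEmb φ) : IsChart φ :=
  ⟨h.smooth d id contDiff_id.isPlot, h.injective, h.isOpen_range, fun f hf => h.smooth_inv f hf⟩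

/-- Every neighbourhood in `ℝᵈ` contains an open set diffeomorphic to `ℝᵈ`. -/
theorem exists_isChart_subset {d : ℕ} {V : Set (E d)} (hV : IsOpen V) {e : E d} (he : e ∈ V) :
    ∃ β : E d → E d, IsChart β ∧ e ∈ range β ∧ range β ⊆ V := by
  obtain ⟨ε, hε, hb⟩ := Metric.isOpen_iff.1 hV e he
  have hr : range (OpenPartialHomeomorph.univBall e ε) = Metric.ball e ε := by
    rw [← OpenPartialHomeomorph.univBall_target e hε,
      ← (OpenPartialHomeomorph.univBall e ε).image_source_eq_target]
    simp
  refine ⟨OpenPartialHomeomorph.univBall e ε,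
    ⟨OpenPartialHomeomorph.contDiff_univBall, ?_, ?_, ?_⟩, ?_, ?_⟩
  · have := (OpenPartialHomeomorph.univBall e ε).injOn
    rwa [OpenPartialHomeomorph.univBall_source, injOn_univ] at this
  · rw [hr]; exact Metric.isOpen_ball
  · intro m f hf
    have h1 : ContDiff ℝ ∞ (OpenPartialHomeomorph.univBall e ε ∘ f) := hf
    have h2 : ∀ x, (OpenPartialHomeomorph.univBall e ε).symm
        (OpenPartialHomeomorph.univBall e ε (f x)) = f x := fun x =>
      (OpenPartialHomeomorph.univBall e ε).left_inv (by simp)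
    have := (OpenPartialHomeomorph.contDiffOn_univBall_symm (c := e) (r := ε)).comp
      h1.contDiffOn (s := univ) fun x _ => by
        rw [← hr]; exact ⟨f x, rfl⟩
    exact contDiffOn_univ.1 (this.congr fun x _ => (h2 x).symm)
  · rw [hr]; exact Metric.mem_ball_self hε
  · rw [hr]; exact hb

theorem IsOpenEmb.isSmoothManifold {f : X → Y} (hf : IsOpenEmb f) {d : ℕ}
    (hY : IsSmoothManifold Y d) : IsSmoothManifold X d where
  t2 := by
    let _ : TopologicalSpace X := DiffeologicalSpace.dTopology
    let _ : TopologicalSpace Y := DiffeologicalSpace.dTopology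
    have : T2Space Y := hY.t2
    exact hf.isOpenEmbedding.isEmbedding.t2Space
  secondCountable := by
    let _ : TopologicalSpace X := DiffeologicalSpace.dTopology
    let _ : TopologicalSpace Y := DiffeologicalSpace.dTopology
    have : SecondCountableTopology Y := hY.secondCountable
    exact hf.isOpenEmbedding.isEmbedding.secondCountableTopology
  exists_chart x := by
    obtain ⟨φ, hφ, e, he⟩ := hY.exists_chart (f x)
    have hV : IsOpen (φ ⁻¹' range f) :=
      isOpen_iff_preimages_plots.1 hf.isOpen_range d φ hφ.smooth
    -- The chart `φ` may leave the range of `f`, so it is shrunk to a cell mapped into that range;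
    -- `q` is the shrunken chart read in `X`.
    obtain ⟨β, hβ, ⟨e', he'⟩, hsub⟩ := exists_isChart_subset hV (e := e) ⟨x, he.symm⟩
    choose q hq using fun y => hsub (mem_range_self (f := β) y)
    have hq' : f ∘ q = φ ∘ β := funext hq
    refine ⟨q, (hf.of_comp ?_).isChart, e', hf.injective ?_⟩
    · rw [hq']; exact hφ.isOpenEmb.comp hβ.isOpenEmb
    · rw [hq, he', he]

theorem DForm.IsClosed.pullback {k : ℕ} {β : DForm k Y} (hβ : β.IsClosed) {f : X → Y}
    (hf : DSmooth f) : (β.pullback hf).IsClosed :=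
  fun p hp x => hβ (f ∘ p) (hf _ p hp) x

theorem DForm.IsNondegenerate.pullback {β : DForm 2 Y} {d : ℕ} (hβ : β.IsNondegenerate d)
    {f : X → Y} (hf : IsOpenEmb f) : (β.pullback hf.smooth).IsNondegenerate d :=
  fun φ hφ => hβ (f ∘ φ) (hf.comp hφ.isOpenEmb).isChart

/-- The restriction of a Hamiltonian system along a diffeomorphism onto an open subset. -/
def HamiltonianSystem.restrict {k : ℕ} (B : HamiltonianSystem Y k) {f : X → Y}
    (hf : IsOpenEmb f) : HamiltonianSystem X k where
  form := B.form.pullback hf.smooth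
  ham := B.ham ∘ f
  ham_smooth := B.ham_smooth.comp hf.smooth
  manifold := hf.isSmoothManifold B.manifold
  closed := DForm.IsClosed.pullback B.closed hf.smooth
  nondegenerate := DForm.IsNondegenerate.pullback B.nondegenerate hf

theorem HamiltonianSystem.restrict_isExtension {k : ℕ} (B : HamiltonianSystem Y k) {f : X → Y}
    (hf : IsOpenEmb f) : IsExtension (B.restrict hf) B f where
  injective := hf.injective
  isOpen_range := hf.isOpen_range
  smooth := hf.smooth
  smooth_inv := hf.smooth_inv
  form_eq := rfl
  ham_eq _ := rfl

theorem IsExtension.of_comp {k : ℕ} {A : HamiltonianSystem X k} {B : HamiltonianSystem Y k}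
    {C : HamiltonianSystem Z k} {f : X → Y} {g : Y → Z} (hg : IsExtension B C g)
    (h : IsExtension A C (g ∘ f)) : IsExtension A B f := by
  have hf := hg.isOpenEmb.of_comp h.isOpenEmb
  refine ⟨hf.injective, hf.isOpen_range, hf.smooth, hf.smooth_inv, ?_, fun x => ?_⟩
  · rw [← h.form_eq, ← hg.form_eq]; rfl
  · rw [← h.ham_eq, ← hg.ham_eq]; rfl

/-- The map is `g⁻¹ ∘ h`; it produces the isomorphisms onto `orbitN` and the first regularization.
-/
theorem IsExtension.exists_factor {k : ℕ} {A : HamiltonianSystem X k}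
    {B : HamiltonianSystem Y k} {C : HamiltonianSystem Z k} {g : Y → Z} (hg : IsIsomorphism B C g)
    {h : X → Z} (hh : IsExtension A C h) :
    ∃ f : X → Y, IsExtension A B f ∧ ∀ x, g (f x) = h x := by
  choose f hf using fun x => hg.surjective (h x)
  have hgf : g ∘ f = h := funext hf
  exact ⟨f, .of_comp hg.toIsExtension (hgf ▸ hh), hf⟩

theorem IsOpenEmb.transition {d : ℕ} {φ ψ : E d → X} (hφ : IsChart φ) (hψ : IsChart ψ) {x y : E d}
    (h : φ x = ψ y) : ∃ f : E d → E d, ContDiff ℝ ∞ f ∧ ψ ∘ f =ᶠ[𝓝 x] φ ∧ f x = y := by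
  obtain ⟨f, hf, he⟩ := hψ.isOpenEmb.exists_lift hφ.smooth (x := x) ⟨y, h.symm⟩
  exact ⟨f, hf, he, hψ.injective (he.eq_of_nhds.trans h)⟩

theorem DForm.pull_of_comp {k m d : ℕ} (α : DForm k X) {ψ : E d → X} (hψ : IsPlot ψ)
    {p : E m → X} (hp : IsPlot p) {f : E m → E d} (hf : ContDiff ℝ ∞ f) {x : E m}
    (h : ψ ∘ f =ᶠ[𝓝 x] p) :
    α.pull p hp x = (α.pull ψ hψ (f x)).compContinuousLinearMap (fderiv ℝ f x) := by
  rw [← α.compat ψ hψ f hf x, α.pull_congr hp (isPlot_reparam hψ hf) h.symm]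

theorem matrix_two_comp {U W : Type*} (f : U → W) (a b : U) : f ∘ ![a, b] = ![f a, f b] := by
  funext i; fin_cases i <;> rfl

theorem DForm.pull_two_of_comp {m d : ℕ} (α : DForm 2 X) {ψ : E d → X} (hψ : IsPlot ψ)
    {p : E m → X} (hp : IsPlot p) {f : E m → E d} (hf : ContDiff ℝ ∞ f) {x : E m}
    (h : ψ ∘ f =ᶠ[𝓝 x] p) (v w : E m) :
    α.pull p hp x ![v, w] = α.pull ψ hψ (f x) ![fderiv ℝ f x v, fderiv ℝ f x w] := by
  rw [α.pull_of_comp hψ hp hf h, ContinuousAlternatingMap.compContinuousLinearMap_apply,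
    matrix_two_comp]

/-- Nondegeneracy need only be checked in one chart around each point. -/
theorem DForm.isNondegenerate_of_exists {α : DForm 2 X} {d : ℕ}
    (h : ∀ x : X, ∃ (ψ : E d → X) (hψ : IsChart ψ), x ∈ range ψ ∧ ∀ y v,
      (∀ w, α.pull ψ hψ.smooth y ![v, w] = 0) → v = 0) : α.IsNondegenerate d := by
  intro φ hφ x v hv
  obtain ⟨ψ, hψ, ⟨y, hy⟩, hnd⟩ := h (φ x)
  obtain ⟨f, hf, hfe, hfx⟩ := IsOpenEmb.transition hφ hψ hy.symm
  obtain ⟨g, hg, hge, hgy⟩ := IsOpenEmb.transition hψ hφ hy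
  have hgf : g ∘ f =ᶠ[𝓝 x] id := by
    have h1 : ∀ᶠ z in 𝓝 x, (φ ∘ g) (f z) = ψ (f z) :=
      hf.continuous.continuousAt.eventually (p := fun u => (φ ∘ g) u = ψ u) (by rwa [hfx])
    filter_upwards [h1, hfe] with z hz hz'
    exact hφ.injective (hz.trans hz')
  have hfg : f ∘ g =ᶠ[𝓝 y] id := by
    have h1 : ∀ᶠ z in 𝓝 y, (ψ ∘ f) (g z) = φ (g z) :=
      hg.continuous.continuousAt.eventually (p := fun u => (ψ ∘ f) u = φ u) (by rwa [hgy])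
    filter_upwards [h1, hge] with z hz hz'
    exact hψ.injective (hz.trans hz')
  have hdf : ∀ z, DifferentiableAt ℝ f z := fun z => (hf.differentiable (by simp)) z
  have hdg : ∀ z, DifferentiableAt ℝ g z := fun z => (hg.differentiable (by simp)) z
  have e1 : ∀ u, fderiv ℝ g y (fderiv ℝ f x u) = u := fun u => by
    have := fderiv_comp x (hdg (f x)) (hdf x)
    rw [hgf.fderiv_eq, fderiv_id, hfx] at this
    exact (DFunLike.congr_fun this u).symm
  have e2 : ∀ u, fderiv ℝ f x (fderiv ℝ g y u) = u := fun u => by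
    have := fderiv_comp y (hdf (g y)) (hdg y)
    rw [hfg.fderiv_eq, fderiv_id, hgy] at this
    exact (DFunLike.congr_fun this u).symm
  -- The transition maps `f` and `g` are inverse germs, so every test vector `w` of the chart `ψ` is
  -- the image of a test vector of `φ`.
  have key : fderiv ℝ f x v = 0 := hnd y _ fun w => by
    have := hv (fderiv ℝ g y w)
    rwa [α.pull_two_of_comp hψ.smooth hφ.smooth hf hfe, hfx, e2] at this
  rw [← e1 v, key, map_zero]

/-- A space covered by countably many charts is second countable. -/
theorem secondCountable_of_charts {ι : Type*} [Countable ι] {d : ℕ} {φ : ι → E d → X}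
    (hφ : ∀ i, IsChart (φ i)) (hc : ∀ x, ∃ i, x ∈ range (φ i)) :
    @SecondCountableTopology X DiffeologicalSpace.dTopology := by
  let _ : TopologicalSpace X := DiffeologicalSpace.dTopology
  have he : ∀ i, Topology.IsOpenEmbedding (φ i) := fun i => (hφ i).isOpenEmb.isOpenEmbedding
  have : ∀ i, SecondCountableTopology (range (φ i)) := fun i =>
    (he i).isEmbedding.toHomeomorph.symm.secondCountableTopology
  exact TopologicalSpace.secondCountableTopology_of_countable_cover
    (fun i => (he i).isOpen_range) (iUnion_eq_univ_iff.2 hc)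

end Diffeological

/-! ### Submersions onto symplectic manifolds and the reduction principle -/

section Subsets

variable {V W : Type*} [NormedAddCommGroup V] [NormedSpace ℝ V] [NormedAddCommGroup W]
  [NormedSpace ℝ W] {X : Set V} {Y : Set W}

/-- Turns a map defined only on an open set into a global plot with the same germ, by
reparametrizing into that set. -/
theorem exists_plot_germ {m : ℕ} {o : Set (E m)} (ho : IsOpen o) {x : E m} (hx : x ∈ o)
    {P : E m → V} (hP : ContDiffOn ℝ ∞ P o) (hPX : ∀ y ∈ o, P y ∈ X) :
    ∃ q : E m → X, IsPlot q ∧ ∀ᶠ y in 𝓝 x, (q y : V) = P y := by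
  obtain ⟨g, hg, hgo, hgx⟩ := exists_contDiff_germ_id x ho hx
  refine ⟨fun y => ⟨P (g y), hPX _ (hgo y)⟩, ?_, ?_⟩
  · exact isPlot_subset_iff.2 (contDiffOn_univ.1 (hP.comp hg.contDiffOn fun y _ => hgo y))
  · filter_upwards [hgx] with y hy
    simp [hy]

/-- The same for parameter spaces such as `ℝ × ℝᵏ`, which are `ℝᵐ` only up to a linear isomorphism
`L`. -/
theorem exists_plot_germ' {D : Type*} [NormedAddCommGroup D] [NormedSpace ℝ D]
    [FiniteDimensional ℝ D] {o : Set D} (ho : IsOpen o) {z : D} (hz : z ∈ o)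
    {P : D → V} (hP : ContDiffOn ℝ ∞ P o) (hPX : ∀ y ∈ o, P y ∈ X) :
    ∃ (m : ℕ) (L : D ≃L[ℝ] E m) (q : E m → X), IsPlot q ∧ ∀ᶠ y in 𝓝 z, (q (L y) : V) = P y := by
  have hs : ContDiff ℝ ∞ (toEuclidean (E := D)).symm := ContinuousLinearEquiv.contDiff _
  obtain ⟨q, hq, he⟩ := exists_plot_germ (X := X)
    (ho.preimage (toEuclidean (E := D)).symm.continuous) (x := toEuclidean z) (by simpa using hz)
    (hP.comp hs.contDiffOn fun y hy => hy) (fun y hy => hPX _ hy)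
  refine ⟨_, toEuclidean, q, hq, ?_⟩
  filter_upwards [(toEuclidean (E := D)).continuous.continuousAt.eventually he] with y hy
  simpa using hy

theorem DSmooth.contDiff_curve {c : ℝ → X} (hc : DSmooth c) : ContDiff ℝ ∞ fun t => (c t : V) := by
  have h1 : ContDiff ℝ ∞ fun z : E 1 => z 0 := by fun_prop
  have h2 : ContDiff ℝ ∞ (fun z : E 1 => (c (z 0) : V)) := hc 1 _ h1.isPlot
  have h3 : ContDiff ℝ ∞ (fun t : ℝ => (EuclideanSpace.single 0 t : E 1)) :=
    (contDiff_euclidean (𝕜 := ℝ)).2 fun i => by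
      simp only [Subsingleton.elim i 0, PiLp.single_apply, if_true]; exact contDiff_id
  simpa [Function.comp_def] using h2.comp h3

theorem dSmooth_curve {c : ℝ → X} (hc : ContDiff ℝ ∞ fun t => (c t : V)) : DSmooth c :=
  fun _ _ hp => hc.comp hp

theorem dSmooth_subset {J : X → Y} {F : V → W} (hF : ∀ x : X, ContDiffAt ℝ ∞ F x)
    (hJ : ∀ x : X, (J x : W) = F x) : DSmooth J := fun m p hp =>
  isPlot_subset_iff.2 <| contDiff_iff_contDiffAt.2 fun y => by
    simp only [Function.comp_apply, hJ]
    exact (hF (p y)).comp y (isPlot_subset_iff.1 hp).contDiffAt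

/-- `J` is a submersion in the following strong sense: near each point there is a smooth
family of local sections of `J`, one through every point of the source. -/
def HasLocalSplitting (J : X → Y) : Prop :=
  ∀ x₀ : X, ∃ (u : Set (V × W)) (S : V × W → V), IsOpen u ∧ ((x₀ : V), (J x₀ : W)) ∈ u ∧
    ContDiffOn ℝ ∞ S u ∧
    (∀ (x : X) (y : Y), ((x : V), (y : W)) ∈ u → ∃ h : S (x, y) ∈ X, J ⟨S (x, y), h⟩ = y) ∧
    ∀ x : X, ((x : V), (J x : W)) ∈ u → S (x, J x) = x

/-- The reference point is frozen at `x₀` and only the target point of the section varies. -/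
theorem HasLocalSplitting.exists_lift {J : X → Y} (hJ : HasLocalSplitting J) {m : ℕ}
    {p : E m → Y} (hp : IsPlot p) {x : E m} {x₀ : X} (hx : p x = J x₀) :
    ∃ q : E m → X, IsPlot q ∧ J ∘ q =ᶠ[𝓝 x] p := by
  obtain ⟨u, S, hu, hxu, hS, hSJ, -⟩ := hJ x₀
  have hp' : ContDiff ℝ ∞ fun y => ((x₀ : V), (p y : W)) :=
    contDiff_const.prodMk (isPlot_subset_iff.1 hp)
  have hmem : x ∈ (fun y => ((x₀ : V), (p y : W))) ⁻¹' u := by simpa [hx] using hxu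
  have ho := hu.preimage hp'.continuous
  obtain ⟨q, hq, he⟩ := exists_plot_germ (X := X) ho hmem
    (hS.comp hp'.contDiffOn fun y hy => hy) (fun y hy => (hSJ x₀ (p y) hy).1)
  refine ⟨q, hq, ?_⟩
  filter_upwards [he, ho.mem_nhds hmem] with y hy hyu
  obtain ⟨h1, h2⟩ := hSJ x₀ (p y) hyu
  rw [← h2]
  exact congrArg J (Subtype.ext hy)

theorem HasLocalSplitting.comp_equiv {V' : Type*} [NormedAddCommGroup V'] [NormedSpace ℝ V']
    {X' : Set V'} {J : X → Y} (hJ : HasLocalSplitting J) (e : V' ≃L[ℝ] V) {F : X' → X}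
    (hF : ∀ x, (F x : V) = e x) (hmem : ∀ v : V', e v ∈ X → v ∈ X') :
    HasLocalSplitting (J ∘ F) := by
  intro x₀
  obtain ⟨u, S, hu, hxu, hS, hSJ, hSx⟩ := hJ (F x₀)
  have he : ContDiff ℝ ∞ (fun z : V' × W => (e z.1, z.2)) :=
    (e.contDiff.comp contDiff_fst).prodMk contDiff_snd
  refine ⟨(fun z => (e z.1, z.2)) ⁻¹' u, fun z => e.symm (S (e z.1, z.2)),
    hu.preimage he.continuous, by simpa [hF] using hxu,
    e.symm.contDiff.comp_contDiffOn (hS.comp he.contDiffOn fun z hz => hz), ?_, ?_⟩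
  · intro x y hxy
    obtain ⟨h1, h2⟩ := hSJ (F x) y (by simpa [hF] using hxy)
    rw [hF] at h1
    refine ⟨hmem _ (by simpa using h1), ?_⟩
    exact (congrArg J (Subtype.ext (by simp [hF]))).trans h2
  · intro x hx
    have := hSx (F x) (by simpa [hF] using hx)
    rw [hF] at this
    exact (e.symm_apply_eq).2 this

/-- A degeneracy curve is mapped to a point by a submersion that pulls back a symplectic form
to the given form. -/
theorem IsDegeneracyCurve.apply_eq {k : ℕ} {α : DForm 2 X} {B : HamiltonianSystem Y k} {J : X → Y}
    (hJ : DSmooth J) (hform : B.form.pullback hJ = α) (hs : HasLocalSplitting J)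
    {c : ℝ → X} (hc : IsDegeneracyCurve α c) (s t : ℝ) : J (c s) = J (c t) := by
  subst hform
  have hcJ := DSmooth.contDiff_curve (hJ.comp hc.1)
  refine Subtype.ext (is_const_of_deriv_eq_zero (f := fun t => (J (c t) : W))
    (hcJ.differentiable (by simp)) (fun t₀ => ?_) s t)
  obtain ⟨ψ, hψ, e₀, he₀⟩ := B.manifold.exists_chart (J (c t₀))
  have h1 : ContDiff ℝ ∞ fun z : E 1 => z 0 := by fun_prop
  have h3 : ContDiff ℝ ∞ (fun t : ℝ => (EuclideanSpace.single 0 t : E 1)) :=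
    (contDiff_euclidean (𝕜 := ℝ)).2 fun i => by
      simp only [Subsingleton.elim i 0, PiLp.single_apply, if_true]; exact contDiff_id
  obtain ⟨g, hg, hge⟩ := hψ.isOpenEmb.exists_lift (hJ _ _ (hc.1 1 _ h1.isPlot))
    (x := (EuclideanSpace.single 0 t₀ : E 1)) ⟨e₀, by simpa using he₀⟩
  let γ : ℝ → E (2 * k) := fun t => g (EuclideanSpace.single 0 t)
  have hγ : ContDiff ℝ ∞ γ := (IsPlot.contDiff hg).comp h3
  have hγe : ∀ᶠ t in 𝓝 t₀, ψ (γ t) = J (c t) := by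
    filter_upwards [h3.continuous.continuousAt.eventually hge] with t ht
    simpa using ht
  have hγ0 : γ t₀ = e₀ := hψ.injective (hγe.self_of_nhds.trans he₀.symm)
  have hψs : ContDiff ℝ ∞ fun e => (ψ e : W) := isPlot_subset_iff.1 hψ.smooth
  obtain ⟨u, S, hu, hxu, hS, hSJ, hSx⟩ := hs (c t₀)
  have hP : ContDiff ℝ ∞ fun z : ℝ × E (2 * k) => ((c z.1 : V), (ψ z.2 : W)) :=
    ((DSmooth.contDiff_curve hc.1).comp contDiff_fst).prodMk (hψs.comp contDiff_snd)
  have ho := hu.preimage hP.continuous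
  have hmem : (t₀, e₀) ∈ (fun z : ℝ × E (2 * k) => ((c z.1 : V), (ψ z.2 : W))) ⁻¹' u := by
    simpa [he₀] using hxu
  -- The plot is `Q (t, e) = S (c t, ψ e)`. It satisfies `J ∘ Q = ψ ∘ snd`, and `c t = Q (t, γ t)`
  -- with `γ` the curve `J ∘ c` in the chart `ψ`. This is where sections through every point `c t`,
  -- and not only through `c t₀`, are needed.
  obtain ⟨m, L, Q, hQ, hQe⟩ := exists_plot_germ' (X := X) ho hmem
    (hS.comp hP.contDiffOn fun y hy => hy) (fun y hy => (hSJ (c y.1) (ψ y.2) hy).1)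
  let f : E m → E (2 * k) := fun w => (L.symm w).2
  have hf : ContDiff ℝ ∞ f := contDiff_snd.comp L.symm.contDiff
  let a : ℝ → E m := fun t => L (t, γ t)
  have ha : ContDiff ℝ ∞ a := L.contDiff.comp (contDiff_id.prodMk hγ)
  have hγpair : ContinuousAt (fun t => (t, γ t)) t₀ :=
    (contDiff_id.prodMk hγ).continuous.continuousAt
  have hγpair' : Filter.Tendsto (fun t => (t, γ t)) (𝓝 t₀) (𝓝 (t₀, e₀)) := by
    rw [← hγ0]; exact hγpair
  have hQa : Q ∘ a =ᶠ[𝓝 t₀] c := by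
    filter_upwards [hγpair'.eventually hQe, hγe, hγpair'.eventually (ho.mem_nhds hmem)]
      with t ht ht' htu
    refine Subtype.ext (Eq.trans ht ?_)
    simp only [Function.comp_apply, ht']
    exact hSx (c t) (by simpa [ht'] using htu)
  have hψf : ψ ∘ f =ᶠ[𝓝 (a t₀)] J ∘ Q := by
    have hL : Filter.Tendsto L.symm (𝓝 (a t₀)) (𝓝 (t₀, e₀)) := by
      have := L.symm.continuous.continuousAt (x := a t₀)
      rwa [ContinuousAt, show L.symm (a t₀) = (t₀, e₀) by simp [a, hγ0]] at this
    filter_upwards [hL.eventually hQe, hL.eventually (ho.mem_nhds hmem)] with w hw hwu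
    obtain ⟨h1, h2⟩ := hSJ (c (L.symm w).1) (ψ (L.symm w).2) hwu
    have : Q w = ⟨_, h1⟩ := Subtype.ext (by simpa using hw)
    simp only [Function.comp_apply, this, h2, f]
  have hfd : ∀ w v, fderiv ℝ f w v = (L.symm v).2 := fun w v => by
    have : f = ((ContinuousLinearMap.snd ℝ ℝ (E (2 * k))).comp
      (L.symm : _ →L[ℝ] ℝ × E (2 * k))) := rfl
    rw [this, ContinuousLinearMap.fderiv]
    rfl
  have hγd := (hγ.differentiable (by simp) t₀).hasDerivAt
  have had : deriv a t₀ = L (1, deriv γ t₀) := by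
    have := (L : ℝ × E (2 * k) →L[ℝ] E m).hasFDerivAt.comp_hasDerivAt t₀
      ((hasDerivAt_id t₀).prodMk hγd)
    exact this.deriv
  -- The velocity `(1, γ')` is paired with the directions `(0, w)`. Both sides depend only on the
  -- second components, so `γ'` lies in the kernel of a nondegenerate form.
  have key : deriv γ t₀ = 0 := B.nondegenerate ψ hψ (f (a t₀)) _ fun w => by
    have h := hc.2 Q hQ a ha t₀ hQa (L (0, w))
    have h' := B.form.pull_two_of_comp hψ.smooth (hJ _ Q hQ) hf hψf (deriv a t₀) (L (0, w))
    rw [hfd, hfd, had] at h'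
    simp only [ContinuousLinearEquiv.symm_apply_apply] at h'
    rw [← h', ← had]
    exact h
  have hfin : (fun t => (J (c t) : W)) =ᶠ[𝓝 t₀] (fun e => (ψ e : W)) ∘ γ := by
    filter_upwards [hγe] with t ht
    simp [ht]
  rw [hfin.deriv_eq, fderiv_comp_deriv _ (hψs.differentiable (by simp) _)
    (hγ.differentiable (by simp) _), key, map_zero]

/-- A curve in a fibre of a map that pulls back a symplectic form to the given form
is a degeneracy curve. -/
theorem isDegeneracyCurve_of_const {k : ℕ} {α : DForm 2 X} {B : HamiltonianSystem Y k} {J : X → Y}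
    (hJ : DSmooth J) (hform : B.form.pullback hJ = α) {c : ℝ → X} (hc : DSmooth c)
    (h : ∀ t, J (c t) = J (c 0)) : IsDegeneracyCurve α c := by
  subst hform
  refine ⟨hc, fun {m} P hP a ha t hPa w => ?_⟩
  obtain ⟨ψ, hψ, e₀, he₀⟩ := B.manifold.exists_chart (J (P (a t)))
  obtain ⟨f, hf, hfe⟩ := hψ.isOpenEmb.exists_lift (hJ _ P hP) (x := a t) ⟨e₀, he₀⟩
  have hf' : ContDiff ℝ ∞ f := IsPlot.contDiff hf
  -- Read in a chart of `Y`, the image of the curve is constant, so its velocity is killed by the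
  -- differential through which the pulled back form factors.
  have hconst : f ∘ a =ᶠ[𝓝 t] fun _ => f (a t) := by
    filter_upwards [hPa, ha.continuous.continuousAt.eventually hfe] with s hs hs'
    refine hψ.injective (hs'.trans ?_)
    rw [show ψ (f (a t)) = J (P (a t)) from hfe.self_of_nhds]
    have h1 : P (a s) = c s := hs
    have h2 : P (a t) = c t := hPa.self_of_nhds
    simp only [Function.comp_apply, h1, h2, h s, h t]
  have hd : fderiv ℝ f (a t) (deriv a t) = 0 := by
    rw [← fderiv_comp_deriv _ (hf'.differentiable (by simp) _) (ha.differentiable (by simp) _),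
      hconst.deriv_eq, deriv_const]
  have := B.form.pull_two_of_comp hψ.smooth (hJ _ P hP) hf' hfe (deriv a t) w
  rw [hd] at this
  exact this.trans (ContinuousAlternatingMap.map_coord_zero _ 0 rfl)

/-- If `J` is a submersion with connected fibres into a symplectic manifold, then it induces
a diffeomorphism from the space of degeneracy leaves of the pulled back form onto an open subset,
and the pulled back system descends to the space of leaves. -/
theorem exists_reduction {k : ℕ} (A : PreHamiltonianSystem X) (B : HamiltonianSystem Y k)
    {J : X → Y} (hJ : DSmooth J) (hform : B.form.pullback hJ = A.form)
    (hham : ∀ x, B.ham (J x) = A.ham x) (hs : HasLocalSplitting J)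
    (hfib : ∀ x x', J x = J x' → ∃ c : ℝ → X, DSmooth c ∧ (∀ t, J (c t) = J x) ∧
      c 0 = x ∧ c 1 = x') :
    ∃ (R : HamiltonianSystem (LeafSpace A.form) k) (f : LeafSpace A.form → Y),
      IsReduction A R ∧ IsExtension R B f ∧ ∀ x, f (leaf A.form x) = J x := by
  have hleaf : ∀ x x', (leafSetoid A.form).r x x' → J x = J x' := by
    intro x x' h
    induction h with
    | rel x y h =>
      obtain ⟨c, hc, rfl, rfl⟩ := h
      exact hc.apply_eq hJ hform hs 0 1
    | refl => rfl
    | symm _ _ _ ih => exact ih.symm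
    | trans _ _ _ _ _ ih₁ ih₂ => exact ih₁.trans ih₂
  let f : LeafSpace A.form → Y := Quotient.lift J hleaf
  have hf : ∀ x, f (leaf A.form x) = J x := fun _ => rfl
  have hinj : ∀ x x', J x = J x' → leaf A.form x = leaf A.form x' := by
    intro x x' h
    obtain ⟨c, hc, hcJ, h0, h1⟩ := hfib x x' h
    exact Quotient.sound (Relation.EqvGen.rel x x' ⟨c, isDegeneracyCurve_of_const hJ hform hc
      fun t => by rw [hcJ t, hcJ 0], h0, h1⟩)
  have hemb : IsOpenEmb f := by
    refine ⟨?_, ?_, ?_, ?_⟩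
    · rintro ⟨x⟩ ⟨x'⟩ h
      exact hinj x x' h
    · refine isOpen_iff_preimages_plots.2 fun m p hp => isOpen_iff_mem_nhds.2 ?_
      rintro x ⟨⟨x₀⟩, hx⟩
      obtain ⟨q, -, hqe⟩ := hs.exists_lift hp (x := x) (x₀ := x₀) hx.symm
      filter_upwards [hqe] with y hy
      exact ⟨leaf A.form (q y), hy⟩
    · intro m p hp
      refine isPlot_of_eventuallyEq fun x => ?_
      obtain ⟨q, hq, hqe⟩ := hp x
      refine ⟨J ∘ q, hJ _ q hq, ?_⟩
      filter_upwards [hqe] with y hy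
      simp only [Function.comp_apply, ← hy]
      rfl
    -- A plot of the leaf space is a map that lifts locally, and the local sections of `J` provide
    -- the lift.
    · intro m p hp x
      obtain ⟨x₀, hx₀⟩ := Quotient.exists_rep (p x)
      obtain ⟨q, hq, hqe⟩ := hs.exists_lift hp (x := x) (x₀ := x₀)
        (by rw [Function.comp_apply, ← hx₀]; rfl)
      refine ⟨q, hq, ?_⟩
      filter_upwards [hqe] with y hy
      obtain ⟨y₀, hy₀⟩ := Quotient.exists_rep (p y)
      have hy' : J (q y) = f (p y) := hy
      rw [← hy₀] at hy' ⊢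
      exact hinj _ _ hy'
  refine ⟨B.restrict hemb, f, ⟨?_, hham⟩, B.restrict_isExtension hemb, hf⟩
  -- Composing `f` with the projection is `J` by definition, so pulling back twice is literally the
  -- pullback along `J`.
  exact Eq.trans rfl hform

end Subsets

/-! ### Exact two-forms and their primitives -/

section ExactForms

variable {V W : Type*} [NormedAddCommGroup V] [NormedSpace ℝ V] [FiniteDimensional ℝ V]
  [NormedAddCommGroup W] [NormedSpace ℝ W] [FiniteDimensional ℝ W] {X : Set V} {Y : Set W}

/-- The one-form `γ` as a form with values in alternating maps. -/
noncomputable def oneForm (γ : V → V →ₗ[ℝ] ℝ) (v : V) : V [⋀^Fin 1]→L[ℝ] ℝ :=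
  ContinuousAlternatingMap.ofSubsingleton ℝ V ℝ (0 : Fin 1) (LinearMap.toContinuousLinearMap (γ v))

theorem contDiff_oneForm {γ : V → V →ₗ[ℝ] ℝ} (hγ : ∀ w, ContDiff ℝ ∞ fun v => γ v w) :
    ContDiff ℝ ∞ (oneForm γ) := by
  have h0 : ContDiff ℝ ∞ (fun v => LinearMap.toContinuousLinearMap (γ v)) :=
    contDiff_clm_apply_iff.2 hγ
  exact (ContinuousAlternatingMap.ofSubsingletonLIE (𝕜 := ℝ) (E := V) (F := ℝ)
      (0 : Fin 1)).contDiff.comp h0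

/-- The pullback of the one-form `γ` along `p`. -/
noncomputable def pullOne {m : ℕ} (γ : V → V →ₗ[ℝ] ℝ) (p : E m → V) (x : E m) :
    E m [⋀^Fin 1]→L[ℝ] ℝ :=
  (oneForm γ (p x)).compContinuousLinearMap (fderiv ℝ p x)

theorem pullOne_apply {m : ℕ} (γ : V → V →ₗ[ℝ] ℝ) (p : E m → V) (x : E m) (v : Fin 1 → E m) :
    pullOne γ p x v = γ (p x) (fderiv ℝ p x (v 0)) := rfl

theorem contDiff_pullOne {m : ℕ} {γ : V → V →ₗ[ℝ] ℝ} {p : E m → V} (hp : ContDiff ℝ ∞ p)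
    (hγ : ∀ x w, ContDiffAt ℝ ∞ (fun v => γ v w) (p x)) : ContDiff ℝ ∞ (pullOne γ p) := by
  have h1 : ContDiff ℝ ∞ fun x => LinearMap.toContinuousLinearMap (γ (p x)) :=
    contDiff_clm_apply_iff.2 fun w => contDiff_iff_contDiffAt.2 fun x =>
      (hγ x w).comp x hp.contDiffAt
  have h2 : ContDiff ℝ ∞ fun x => (LinearMap.toContinuousLinearMap (γ (p x))).comp (fderiv ℝ p x) :=
    h1.clm_comp (hp.fderiv_right (by simp))
  exact (ContinuousAlternatingMap.ofSubsingletonLIE (𝕜 := ℝ) (E := E m) (F := ℝ)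
      (0 : Fin 1)).contDiff.comp h2

theorem contDiff_extDeriv {m : ℕ} {β : E m → E m [⋀^Fin 1]→L[ℝ] ℝ} (hβ : ContDiff ℝ ∞ β) :
    ContDiff ℝ ∞ (extDeriv β) :=
  ContDiff.continuousLinearMap_comp (E := E m) (F := E m →L[ℝ] E m [⋀^Fin 1]→L[ℝ] ℝ)
    (G := E m [⋀^Fin 2]→L[ℝ] ℝ)
    (ContinuousAlternatingMap.alternatizeUncurryFinCLM ℝ (E m) ℝ)
    (hβ.fderiv_right (m := ∞) (by simp))

theorem minSmoothness_two_le : minSmoothness ℝ 2 ≤ (∞ : WithTop ℕ∞) := by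
  rw [minSmoothness_of_isRCLikeNormedField]
  exact WithTop.coe_le_coe.2 le_top

/-- The restriction to `X` of the form `dγ`, where the one-form `γ` is smooth near `X`. -/
noncomputable def DForm.exact (X : Set V) (γ : V → V →ₗ[ℝ] ℝ)
    (hγ : ∀ x : X, ∀ w, ContDiffAt ℝ ∞ (fun v => γ v w) x) : DForm 2 X where
  -- The exterior derivative is taken after pulling back, so `γ` may have poles away from `X`; the
  -- potential `theta` has them where `Tr (M φ) = 0`.
  pull p _ := extDeriv (pullOne γ fun y => (p y : V))
  smooth p hp := contDiff_extDeriv (contDiff_pullOne hp fun _ => hγ _)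
  compat p hp f hf x := by
    have hp' : ContDiff ℝ ∞ fun y => (p y : V) := hp
    rw [← extDeriv_pullback (r := ∞) ((contDiff_pullOne hp' fun _ => hγ _).differentiable (by simp) _)
      hf.contDiffAt minSmoothness_two_le]
    congr 1
    funext y
    ext v
    simp only [pullOne_apply, ContinuousAlternatingMap.compContinuousLinearMap_apply,
      Function.comp_apply]
    rw [show (fun y => (p (f y) : V)) = (fun y => (p y : V)) ∘ f from rfl,
      fderiv_comp _ (hp'.differentiable (by simp) _) (hf.differentiable (by simp) _)]
    rfl

theorem DForm.exact_isClosed (γ : V → V →ₗ[ℝ] ℝ)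
    (hγ : ∀ x : X, ∀ w, ContDiffAt ℝ ∞ (fun v => γ v w) x) : (DForm.exact X γ hγ).IsClosed :=
  fun _ hp x => congrFun (extDeriv_extDeriv (contDiff_pullOne (isPlot_subset_iff.1 hp) fun _ => hγ _)
    minSmoothness_two_le) x

theorem DForm.restrict_dOneForm_pull {γ : V → V →ₗ[ℝ] ℝ} (hγ : ∀ w, ContDiff ℝ ∞ fun v => γ v w)
    {m : ℕ} (p : E m → X) (hp : IsPlot p) :
    (DForm.restrict X (dOneForm γ) (contDiff_dOneForm hγ)).pull p hp =
      extDeriv (pullOne γ fun y => (p y : V)) := by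
  have hp' : ContDiff ℝ ∞ fun y => (p y : V) := hp
  funext x
  exact (extDeriv_pullback (r := ∞) ((contDiff_oneForm hγ).differentiable (by simp) _)
    hp'.contDiffAt minSmoothness_two_le).symm

/-- Since the exterior derivative commutes with pullback, it suffices to compare the primitives, and
only along plots of `X`, where the constraints defining `X` may be used. -/
theorem DForm.exact_pullback {γ : V → V →ₗ[ℝ] ℝ} (hγ : ∀ w, ContDiff ℝ ∞ fun v => γ v w)
    {θ : W → W →ₗ[ℝ] ℝ} (hθ : ∀ y : Y, ∀ w, ContDiffAt ℝ ∞ (fun v => θ v w) y) {J : X → Y}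
    (hJ : DSmooth J) (h : ∀ {m : ℕ} (p : E m → X), IsPlot p → ∀ x v,
      θ (J (p x)) (fderiv ℝ (fun y => (J (p y) : W)) x v) =
        γ (p x) (fderiv ℝ (fun y => (p y : V)) x v)) :
    (DForm.exact Y θ hθ).pullback hJ = DForm.restrict X (dOneForm γ) (contDiff_dOneForm hγ) := by
  refine DForm.ext ?_
  funext m p hp
  rw [DForm.restrict_dOneForm_pull hγ]
  change extDeriv _ = _
  congr 1
  funext x
  ext v
  exact h p hp x (v 0)

theorem DForm.exact_pullback_exact {γ : V → V →ₗ[ℝ] ℝ}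
    (hγ : ∀ x : X, ∀ w, ContDiffAt ℝ ∞ (fun v => γ v w) x)
    {θ : W → W →ₗ[ℝ] ℝ} (hθ : ∀ y : Y, ∀ w, ContDiffAt ℝ ∞ (fun v => θ v w) y) {J : X → Y}
    (hJ : DSmooth J) (h : ∀ {m : ℕ} (p : E m → X), IsPlot p → ∀ x v,
      θ (J (p x)) (fderiv ℝ (fun y => (J (p y) : W)) x v) =
        γ (p x) (fderiv ℝ (fun y => (p y : V)) x v)) :
    (DForm.exact Y θ hθ).pullback hJ = DForm.exact X γ hγ := by
  refine DForm.ext ?_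
  funext m p hp
  change extDeriv _ = extDeriv _
  congr 1
  funext x
  ext v
  exact h p hp x (v 0)

theorem dOneForm_apply {γ : V → V →ₗ[ℝ] ℝ} (hγ : ∀ w, ContDiff ℝ ∞ fun v => γ v w) (x a b : V) :
    dOneForm γ x ![a, b] = fderiv ℝ (fun v => γ v b) x a - fderiv ℝ (fun v => γ v a) x b := by
  have h := extDeriv_apply ((contDiff_oneForm hγ).differentiable (by simp) x) ![a, b]
  refine h.trans ((Fin.sum_univ_two _).trans ?_)
  simp only [Fin.val_zero, pow_zero, one_smul, Fin.val_one, pow_one, neg_smul,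
    cons_val_zero, cons_val_one, sub_eq_add_neg]
  rfl

end ExactForms

/-! ### Calculus of matrix-valued maps -/

section MatrixCalculus

set_option linter.unusedSectionVars false

variable {D : Type*} [NormedAddCommGroup D] [NormedSpace ℝ D]
variable {ι κ τ : Type*} [Fintype ι] [Fintype κ] [Fintype τ]

theorem contDiffAt_matrix_iff {f : D → Matrix ι κ ℂ} {x : D} :
    ContDiffAt ℝ ∞ f x ↔ ∀ i j, ContDiffAt ℝ ∞ (fun y => f y i j) x :=
  contDiffAt_pi.trans (forall_congr' fun _ => contDiffAt_pi)

@[fun_prop]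
theorem contDiffAt_matMul {f : D → Matrix ι κ ℂ} {g : D → Matrix κ τ ℂ} {x : D}
    (hf : ContDiffAt ℝ ∞ f x) (hg : ContDiffAt ℝ ∞ g x) :
    ContDiffAt ℝ ∞ (fun y => f y * g y) x := by
  rw [contDiffAt_matrix_iff] at *
  intro i j
  simp only [Matrix.mul_apply]
  exact ContDiffAt.sum fun k _ => (hf i k).mul (hg k j)

@[fun_prop]
theorem contDiff_matMul {f : D → Matrix ι κ ℂ} {g : D → Matrix κ τ ℂ}
    (hf : ContDiff ℝ ∞ f) (hg : ContDiff ℝ ∞ g) : ContDiff ℝ ∞ (fun y => f y * g y) :=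
  contDiff_iff_contDiffAt.2 fun _ => contDiffAt_matMul hf.contDiffAt hg.contDiffAt

theorem hasFDerivAt_entry {f : D → Matrix ι κ ℂ} {f' : D →L[ℝ] Matrix ι κ ℂ} {x : D}
    (hf : HasFDerivAt f f' x) (i : ι) (j : κ) :
    HasFDerivAt (fun y => f y i j) ((ContinuousLinearMap.proj (R := ℝ) j).comp
      ((ContinuousLinearMap.proj (R := ℝ) (φ := fun _ : ι => κ → ℂ) i).comp f')) x :=
  hasFDerivAt_pi'.1 (hasFDerivAt_pi'.1 hf i) j

theorem fderiv_entry {f : D → Matrix ι κ ℂ} {x : D} (hf : DifferentiableAt ℝ f x) (v : D) (i : ι)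
    (j : κ) : fderiv ℝ f x v i j = fderiv ℝ (fun y => f y i j) x v := by
  rw [(hasFDerivAt_entry hf.hasFDerivAt i j).fderiv]
  rfl

theorem differentiableAt_matrix_iff {f : D → Matrix ι κ ℂ} {x : D} :
    DifferentiableAt ℝ f x ↔ ∀ i j, DifferentiableAt ℝ (fun y => f y i j) x :=
  differentiableAt_pi.trans (forall_congr' fun _ => differentiableAt_pi)

theorem differentiableAt_matMul {f : D → Matrix ι κ ℂ} {g : D → Matrix κ τ ℂ} {x : D}
    (hf : DifferentiableAt ℝ f x) (hg : DifferentiableAt ℝ g x) :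
    DifferentiableAt ℝ (fun y => f y * g y) x := by
  rw [differentiableAt_matrix_iff] at *
  intro i j
  simp only [Matrix.mul_apply]
  exact DifferentiableAt.fun_sum fun k _ => (hf i k).mul (hg k j)

/-- The norm is the entrywise supremum norm, which is not submultiplicative, and the matrices may be
rectangular; hence the product rule is derived entry by entry. -/
theorem fderiv_matMul {f : D → Matrix ι κ ℂ} {g : D → Matrix κ τ ℂ} {x : D}
    (hf : DifferentiableAt ℝ f x) (hg : DifferentiableAt ℝ g x) (v : D) :
    fderiv ℝ (fun y => f y * g y) x v = fderiv ℝ f x v * g x + f x * fderiv ℝ g x v := by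
  ext i j
  have hf' := differentiableAt_matrix_iff.1 hf
  have hg' := differentiableAt_matrix_iff.1 hg
  rw [fderiv_entry (differentiableAt_matMul hf hg)]
  simp only [Matrix.mul_apply, Matrix.add_apply]
  rw [fderiv_fun_sum fun k _ => (hf' i k).fun_mul (hg' k j), _root_.sum_apply,
    ← Finset.sum_add_distrib]
  refine Finset.sum_congr rfl fun k _ => ?_
  rw [fderiv_fun_mul (hf' i k) (hg' k j), fderiv_entry hf, fderiv_entry hg]
  simp only [_root_.add_apply, _root_.smul_apply, smul_eq_mul]
  ring

/-- The conjugate transpose as a continuous linear map over the reals. -/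
noncomputable def conjTransposeCLM (ι κ : Type*) [Fintype ι] [Fintype κ] :
    Matrix ι κ ℂ →L[ℝ] Matrix κ ι ℂ :=
  LinearMap.toContinuousLinearMap
    { toFun := fun A => Aᴴ
      map_add' := fun _ _ => conjTranspose_add _ _
      map_smul' := fun r A => by simp }

@[fun_prop]
theorem contDiffAt_conjTranspose {f : D → Matrix ι κ ℂ} {x : D} (hf : ContDiffAt ℝ ∞ f x) :
    ContDiffAt ℝ ∞ (fun y => (f y)ᴴ) x :=
  (conjTransposeCLM ι κ).contDiff.contDiffAt.comp x hf

@[fun_prop]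
theorem contDiff_conjTranspose {f : D → Matrix ι κ ℂ} (hf : ContDiff ℝ ∞ f) :
    ContDiff ℝ ∞ (fun y => (f y)ᴴ) :=
  (conjTransposeCLM ι κ).contDiff.comp hf

/-- The trace as a continuous linear map over the reals. -/
noncomputable def traceCLM (ι : Type*) [Fintype ι] : Matrix ι ι ℂ →L[ℝ] ℂ :=
  LinearMap.toContinuousLinearMap (traceLinearMap ι ℝ ℂ)

@[fun_prop]
theorem contDiffAt_trace {f : D → Matrix ι ι ℂ} {x : D} (hf : ContDiffAt ℝ ∞ f x) :
    ContDiffAt ℝ ∞ (fun y => trace (f y)) x :=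
  (traceCLM ι).contDiff.contDiffAt.comp x hf

@[fun_prop]
theorem contDiff_trace {f : D → Matrix ι ι ℂ} (hf : ContDiff ℝ ∞ f) :
    ContDiff ℝ ∞ (fun y => trace (f y)) :=
  (traceCLM ι).contDiff.comp hf

@[fun_prop]
theorem contDiffAt_re {f : D → ℂ} {x : D} (hf : ContDiffAt ℝ ∞ f x) :
    ContDiffAt ℝ ∞ (fun y => (f y).re) x :=
  Complex.reCLM.contDiff.contDiffAt.comp x hf

@[fun_prop]
theorem contDiff_re {f : D → ℂ} (hf : ContDiff ℝ ∞ f) : ContDiff ℝ ∞ (fun y => (f y).re) :=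
  Complex.reCLM.contDiff.comp hf

@[fun_prop]
theorem contDiffAt_fromBlocks {f₁ : D → Matrix ι κ ℂ} {f₂ : D → Matrix ι τ ℂ} {σ : Type*}
    [Fintype σ] {f₃ : D → Matrix σ κ ℂ} {f₄ : D → Matrix σ τ ℂ} {x : D}
    (h₁ : ContDiffAt ℝ ∞ f₁ x) (h₂ : ContDiffAt ℝ ∞ f₂ x) (h₃ : ContDiffAt ℝ ∞ f₃ x)
    (h₄ : ContDiffAt ℝ ∞ f₄ x) : ContDiffAt ℝ ∞ (fun y => fromBlocks (f₁ y) (f₂ y) (f₃ y) (f₄ y)) x := by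
  refine contDiffAt_pi.2 fun i => contDiffAt_pi.2 fun j => ?_
  rcases i with i | i <;> rcases j with j | j
  · exact contDiffAt_pi.1 (contDiffAt_pi.1 h₁ i) j
  · exact contDiffAt_pi.1 (contDiffAt_pi.1 h₂ i) j
  · exact contDiffAt_pi.1 (contDiffAt_pi.1 h₃ i) j
  · exact contDiffAt_pi.1 (contDiffAt_pi.1 h₄ i) j

end MatrixCalculus

variable {n : ℕ}

/-! ### Null vectors and their momentum -/

/-- A twistor as a column. -/
noncomputable def col (w : Twistor n) : Matrix (Fin n ⊕ Fin n) Unit ℂ :=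
  fromRows (replicateCol Unit w.1) (replicateCol Unit w.2)

/-- The momentum `-i V V⁺ φ` of a vector `V`. -/
noncomputable def momentum (φ : Mat2 n) (V : Matrix (Fin n ⊕ Fin n) Unit ℂ) : Mat2 n :=
  -Complex.I • (V * Vᴴ * φ)

theorem col_conjTranspose (w : Twistor n) :
    (col w)ᴴ = fromCols (replicateRow Unit (star w.1)) (replicateRow Unit (star w.2)) := by
  rw [col, conjTranspose_fromRows_eq_fromCols_conjTranspose]
  simp

theorem exists_col (V : Matrix (Fin n ⊕ Fin n) Unit ℂ) : ∃ w : Twistor n, col w = V := by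
  refine ⟨(fun i => V (Sum.inl i) (), fun i => V (Sum.inr i) ()), ?_⟩
  ext i j
  rcases i with i | i <;> rfl

theorem col_injective : Function.Injective (col (n := n)) := by
  intro v w h
  ext i
  · exact congrFun (congrFun h (Sum.inl i)) ()
  · exact congrFun (congrFun h (Sum.inr i)) ()

theorem col_zero : col (0 : Twistor n) = 0 := by
  ext i j
  rcases i with i | i <;> rfl

theorem col_eq_zero {w : Twistor n} : col w = 0 ↔ w = 0 :=
  ⟨fun h => col_injective (h.trans col_zero.symm), fun h => h ▸ col_zero⟩

theorem col_smul (c : ℂ) (w : Twistor n) : col (c • w) = c • col w := by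
  ext i j
  rcases i with i | i <;> rfl

theorem col_mul_conjTranspose (w : Twistor n) : col w * (col w)ᴴ =
    fromBlocks (vecMulVec w.1 (star w.1)) (vecMulVec w.1 (star w.2)) (vecMulVec w.2 (star w.1))
      (vecMulVec w.2 (star w.2)) := by
  rw [col_conjTranspose, col, fromRows_mul_fromCols]
  simp only [← vecMulVec_eq]

theorem JPM_eq (v : Twistor n) : JPM v = momentum (phiD n) (col v) := by
  rw [momentum, col_mul_conjTranspose, phiD, fromBlocks_multiply, JPM]
  simp [fromBlocks_smul, fromBlocks_neg]

theorem JPMt_eq (w : Twistor n) : JPMt w = momentum (phiA n) (col w) := by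
  rw [momentum, col_mul_conjTranspose, phiA, Matrix.mul_smul, smul_smul, fromBlocks_multiply, JPMt]
  simp

theorem unit_matrix_eq (A : Matrix Unit Unit ℂ) : A = A () () • (1 : Matrix Unit Unit ℂ) := by
  ext; simp

theorem trace_unit_matrix (A : Matrix Unit Unit ℂ) : trace A = A () () := by
  simp [trace]

theorem col_phiD_col (v w : Twistor n) : ((col v)ᴴ * phiD n * col w) () () =
    star v.1 ⬝ᵥ w.1 - star v.2 ⬝ᵥ w.2 := by
  rw [col_conjTranspose, phiD, col, fromCols_mul_fromBlocks, fromCols_mul_fromRows]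
  simp [Matrix.mul_apply, dotProduct, sub_eq_add_neg]

theorem col_phiA_col (v w : Twistor n) : ((col v)ᴴ * phiA n * col w) () () =
    Complex.I * (star v.2 ⬝ᵥ w.1 - star v.1 ⬝ᵥ w.2) := by
  rw [col_conjTranspose, phiA, col, Matrix.mul_smul, Matrix.smul_mul, fromCols_mul_fromBlocks,
    fromCols_mul_fromRows]
  simp [Matrix.mul_apply, dotProduct, sub_eq_add_neg]

theorem col_conjTranspose_col (v w : Twistor n) : ((col v)ᴴ * col w) () () =
    star v.1 ⬝ᵥ w.1 + star v.2 ⬝ᵥ w.2 := by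
  rw [col_conjTranspose, col, fromCols_mul_fromRows]
  simp [Matrix.mul_apply, dotProduct]

theorem mem_nullT {v : Twistor n} : v ∈ nullT n ↔ v ≠ 0 ∧ (col v)ᴴ * phiD n * col v = 0 := by
  refine and_congr_right fun _ => ?_
  rw [← col_phiD_col]
  exact ⟨fun h => by rw [unit_matrix_eq (_ * col v), h, zero_smul], fun h => by rw [h]; rfl⟩

theorem mem_nullTt {v : Twistor n} : v ∈ nullTt n ↔ v ≠ 0 ∧ (col v)ᴴ * phiA n * col v = 0 := by
  refine and_congr_right fun _ => ?_
  rw [← col_phiA_col]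
  exact ⟨fun h => by rw [unit_matrix_eq (_ * col v), h, zero_smul], fun h => by rw [h]; rfl⟩

/-! ### The hermitian forms -/

theorem phiD_mul_phiD : phiD n * phiD n = 1 := by
  simp [phiD, fromBlocks_multiply]

theorem phiA_mul_phiA : phiA n * phiA n = 1 := by
  simp [phiA, fromBlocks_multiply, smul_smul, fromBlocks_smul]

theorem phiA_conjTranspose : (phiA n)ᴴ = phiA n := by
  simp [phiA, fromBlocks_conjTranspose, fromBlocks_smul]

theorem inv_sqrt_two_sq : (((1 / Real.sqrt 2 : ℝ) : ℂ)) * ((1 / Real.sqrt 2 : ℝ) : ℂ) = 1 / 2 := by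
  rw [← Complex.ofReal_mul, div_mul_div_comm, Real.mul_self_sqrt (by norm_num)]
  norm_num

theorem cayley_conjTranspose : (cayley n)ᴴ =
    ((1 / Real.sqrt 2 : ℝ) : ℂ) • fromBlocks 1 (Complex.I • 1) (Complex.I • 1) 1 := by
  rw [cayley, conjTranspose_smul, fromBlocks_conjTranspose]
  simp

theorem cayley_conjTranspose_mul : (cayley n)ᴴ * cayley n = 1 := by
  rw [cayley_conjTranspose, cayley, smul_mul_smul_comm, inv_sqrt_two_sq, fromBlocks_multiply,
    fromBlocks_smul, ← fromBlocks_one]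
  simp only [mul_one, one_mul, Matrix.mul_neg, smul_mul_smul_comm, Complex.I_mul_I]
  congr 1 <;> module

theorem cayley_mul_conjTranspose : cayley n * (cayley n)ᴴ = 1 :=
  mul_eq_one_comm.1 cayley_conjTranspose_mul

theorem cayley_phiD : (cayley n)ᴴ * phiD n * cayley n = phiA n := by
  rw [cayley_conjTranspose, cayley, Matrix.smul_mul, smul_mul_smul_comm, inv_sqrt_two_sq, phiD,
    fromBlocks_multiply, fromBlocks_multiply, phiA, fromBlocks_smul, fromBlocks_smul]
  simp only [mul_one, one_mul, Matrix.mul_neg, Matrix.neg_mul, mul_zero, add_zero, zero_add, smul_mul_smul_comm,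
    Complex.I_mul_I]
  congr 1 <;> module

theorem cayley_phiA : cayley n * phiA n * (cayley n)ᴴ = phiD n := by
  rw [← cayley_phiD]
  simp only [← Matrix.mul_assoc, cayley_mul_conjTranspose, one_mul]
  rw [Matrix.mul_assoc, cayley_mul_conjTranspose, mul_one]

theorem xPM_eq : xPM n = Complex.I • phiD n := rfl

theorem xPMt_eq : xPMt n = Complex.I • phiA n := by
  rw [xPMt, xPM_eq, Matrix.mul_smul, Matrix.smul_mul, cayley_phiD]

/-- The common source of equivariance: it covers both the adjoint action, with `U' = g⁻¹`, and the
Cayley transform, which changes the hermitian form. -/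
theorem momentum_conj {φ ψ U U' : Mat2 n} (h : φ * U' = Uᴴ * ψ)
    (V : Matrix (Fin n ⊕ Fin n) Unit ℂ) : U * momentum φ V * U' = momentum ψ (U * V) := by
  simp only [momentum, Matrix.mul_smul, Matrix.smul_mul, conjTranspose_mul, Matrix.mul_assoc, h]

theorem momentum_cayley (V : Matrix (Fin n ⊕ Fin n) Unit ℂ) :
    (cayley n)ᴴ * momentum (phiD n) V * cayley n = momentum (phiA n) ((cayley n)ᴴ * V) := by
  refine momentum_conj ?_ V
  rw [← cayley_phiD, conjTranspose_conjTranspose, ← Matrix.mul_assoc, ← Matrix.mul_assoc,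
    cayley_mul_conjTranspose, one_mul]

theorem momentum_smul {φ : Mat2 n} {c : ℂ} (hc : star c * c = 1)
    (V : Matrix (Fin n ⊕ Fin n) Unit ℂ) : momentum φ (c • V) = momentum φ V := by
  rw [momentum, conjTranspose_smul, Matrix.smul_mul, Matrix.mul_smul, smul_smul, mul_comm c, hc,
    one_smul, momentum]

/-- A vector is determined up to a phase by its momentum. -/
theorem exists_phase {φ : Mat2 n} (hφ : φ * φ = 1) {V W : Matrix (Fin n ⊕ Fin n) Unit ℂ}
    (hV : V ≠ 0) (h : momentum φ V = momentum φ W) :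
    ∃ c : ℂ, star c * c = 1 ∧ W = c • V := by
  have h1 : V * Vᴴ = W * Wᴴ := by
    have := congrArg (fun M => Complex.I • (M * φ)) h
    simpa [momentum, Matrix.mul_assoc, hφ, smul_smul] using this
  have hVV : (Vᴴ * V) () () ≠ 0 := fun h0 => hV <| by
    have : Vᴴ * V = 0 := by rw [unit_matrix_eq (Vᴴ * V), h0, zero_smul]
    exact conjTranspose_mul_self_eq_zero.1 this
  -- Applying `V V⁺ = W W⁺` to `V` shows that `V` is a multiple of `W`. Comparing the two outer
  -- products then forces the factor to have modulus one.
  have h2 : V * (Vᴴ * V) = W * (Wᴴ * V) := by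
    rw [← Matrix.mul_assoc, h1, Matrix.mul_assoc]
  rw [unit_matrix_eq (Vᴴ * V), unit_matrix_eq (Wᴴ * V), Matrix.mul_smul, Matrix.mul_smul,
    Matrix.mul_one, Matrix.mul_one] at h2
  set a := (Vᴴ * V) () () with ha
  set b := (Wᴴ * V) () () with hb
  have hV' : V = (b / a) • W := by
    rw [div_eq_inv_mul, mul_smul, ← h2, smul_smul, inv_mul_cancel₀ hVV, one_smul]
  set c := b / a with hc
  have hcc : c * star c = 1 := by
    have hWW : W * Wᴴ ≠ 0 := by
      rw [← h1]
      exact fun h0 => hV (self_mul_conjTranspose_eq_zero.1 h0)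
    have h3 : (c * star c) • (W * Wᴴ) = (1 : ℂ) • (W * Wᴴ) := by
      rw [one_smul]
      conv_rhs => rw [← h1, hV', conjTranspose_smul, Matrix.smul_mul, Matrix.mul_smul, smul_smul]
    exact smul_left_injective ℂ hWW h3
  refine ⟨star c, by rw [star_star, hcc], ?_⟩
  rw [hV', smul_smul, mul_comm, hcc, one_smul]

/-! ### Pseudo-unitary groups -/

theorem pseudoUnitary_inv {φ g : Mat2 n} (hφ : φ * φ = 1) (hg : g ∈ pseudoUnitary φ) :
    g⁻¹ = φ * gᴴ * φ := by
  refine inv_eq_left_inv ?_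
  rw [Matrix.mul_assoc, Matrix.mul_assoc, ← Matrix.mul_assoc gᴴ, show gᴴ * φ * g = φ from hg, hφ]

theorem pseudoUnitary_isUnit {φ g : Mat2 n} (hφ : φ * φ = 1) (hg : g ∈ pseudoUnitary φ) :
    IsUnit g.det := by
  refine isUnit_det_of_left_inverse (B := φ * gᴴ * φ) ?_
  rw [Matrix.mul_assoc, Matrix.mul_assoc, ← Matrix.mul_assoc gᴴ, show gᴴ * φ * g = φ from hg, hφ]

theorem momentum_adjoint {φ g : Mat2 n} (hφ : φ * φ = 1) (hg : g ∈ pseudoUnitary φ)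
    (V : Matrix (Fin n ⊕ Fin n) Unit ℂ) : g * momentum φ V * g⁻¹ = momentum φ (g * V) := by
  refine momentum_conj ?_ V
  rw [pseudoUnitary_inv hφ hg, Matrix.mul_assoc φ, ← Matrix.mul_assoc φ φ, hφ, one_mul]

theorem pseudoUnitary_mul {φ g h : Mat2 n} (hg : g ∈ pseudoUnitary φ) (hh : h ∈ pseudoUnitary φ) :
    g * h ∈ pseudoUnitary φ := by
  change (g * h)ᴴ * φ * (g * h) = φ
  rw [conjTranspose_mul, Matrix.mul_assoc hᴴ, Matrix.mul_assoc hᴴ, ← Matrix.mul_assoc (gᴴ * φ),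
    show gᴴ * φ * g = φ from hg, ← Matrix.mul_assoc]
  exact hh

theorem pseudoUnitary_inv_mem {φ g : Mat2 n} (hφ : φ * φ = 1)
    (hg : g ∈ pseudoUnitary φ) : g⁻¹ ∈ pseudoUnitary φ := by
  have hu := pseudoUnitary_isUnit hφ hg
  change (g⁻¹)ᴴ * φ * g⁻¹ = φ
  conv_lhs => rw [← show gᴴ * φ * g = φ from hg]
  rw [← Matrix.mul_assoc, ← Matrix.mul_assoc, ← conjTranspose_mul, mul_nonsing_inv g hu,
    conjTranspose_one, one_mul, Matrix.mul_assoc, mul_nonsing_inv g hu, mul_one]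

theorem null_mul {φ g : Mat2 n} (hg : g ∈ pseudoUnitary φ) {V : Matrix (Fin n ⊕ Fin n) Unit ℂ}
    (hV : Vᴴ * φ * V = 0) : (g * V)ᴴ * φ * (g * V) = 0 := by
  rw [conjTranspose_mul, Matrix.mul_assoc Vᴴ, Matrix.mul_assoc Vᴴ, ← Matrix.mul_assoc (gᴴ * φ),
    show gᴴ * φ * g = φ from hg, ← Matrix.mul_assoc, hV]

/-! ### Householder reflections -/

/-- Expanding the product leaves a multiple of `U` whose coefficient cancels by `hUU`. The parameter
`κ` is allowed to be complex because the inner product of the two vectors to be exchanged is. -/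
theorem householder_unitary {κ : ℂ} (hκ : κ ≠ 0) {U : Mat n} (hU : Uᴴ = U)
    (hUU : U * U = (κ + star κ) • U) : (-1 + κ⁻¹ • U)ᴴ * (-1 + κ⁻¹ • U) = 1 := by
  have hκ' : star κ ≠ 0 := star_ne_zero.2 hκ
  have key : (star κ)⁻¹ * (κ⁻¹ * (κ + star κ)) - (star κ)⁻¹ - κ⁻¹ = 0 := by
    field_simp; ring
  have h1 : (-1 + κ⁻¹ • U)ᴴ = -1 + (star κ)⁻¹ • U := by simp [hU]
  have h2 : (-1 + (star κ)⁻¹ • U) * (-1 + κ⁻¹ • U) =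
      1 + ((star κ)⁻¹ * (κ⁻¹ * (κ + star κ)) - (star κ)⁻¹ - κ⁻¹) • U := by
    simp only [add_mul, mul_add, Matrix.neg_mul, Matrix.mul_neg, one_mul, mul_one, neg_neg,
      smul_mul_smul_comm, hUU]
    module
  rw [h1, h2, key, zero_smul, add_zero]

/-- With `κ = (a + b)⁺ a`, the rank one term sends `a` to `a + b`, and `-1` removes `a`. -/
theorem householder_mulVec {a b : Fin n → ℂ}
    (hκ : star a ⬝ᵥ a + star b ⬝ᵥ a ≠ 0) :
    (-1 + (star a ⬝ᵥ a + star b ⬝ᵥ a)⁻¹ • vecMulVec (a + b) (star (a + b))) *ᵥ a = b := by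
  rw [add_mulVec, neg_mulVec, one_mulVec, smul_mulVec, vecMulVec_mulVec, star_add, add_dotProduct]
  ext i
  simp
  field_simp
  ring

/-- The square of `w w⁺` is `|w|² w w⁺`, and equality of the lengths of `a` and `b` turns `|a + b|²`
into `κ + κ̄`. -/
theorem vecMulVec_sq {a b : Fin n → ℂ} (hab : star a ⬝ᵥ a = star b ⬝ᵥ b) :
    vecMulVec (a + b) (star (a + b)) * vecMulVec (a + b) (star (a + b)) =
      ((star a ⬝ᵥ a + star b ⬝ᵥ a) + star (star a ⬝ᵥ a + star b ⬝ᵥ a)) •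
        vecMulVec (a + b) (star (a + b)) := by
  have h : star (a + b) ⬝ᵥ (a + b) = (star a ⬝ᵥ a + star b ⬝ᵥ a) +
      star (star a ⬝ᵥ a + star b ⬝ᵥ a) := by
    rw [star_add (star a ⬝ᵥ a), ← star_dotProduct, ← star_dotProduct, star_add, add_dotProduct,
      dotProduct_add, dotProduct_add, ← hab]
    ring
  rw [vecMulVec_mul_vecMulVec, h, vecMulVec_smul]

theorem exists_unitary {a b : Fin n → ℂ} (ha : a ≠ 0) (hab : star a ⬝ᵥ a = star b ⬝ᵥ b) :
    ∃ R : Mat n, Rᴴ * R = 1 ∧ R *ᵥ a = b := by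
  have key : ∀ c : Fin n → ℂ, star c ⬝ᵥ c = star b ⬝ᵥ b → star c ⬝ᵥ c + star b ⬝ᵥ c ≠ 0 →
      ∃ R : Mat n, Rᴴ * R = 1 ∧ R *ᵥ c = b := fun c hc hκ =>
    ⟨_, householder_unitary hκ (by simp [conjTranspose_vecMulVec]) (vecMulVec_sq hc),
      householder_mulVec hκ⟩
  by_cases hκ : star a ⬝ᵥ a + star b ⬝ᵥ a = 0
  · have haa : star a ⬝ᵥ a ≠ 0 := fun h => ha (dotProduct_star_self_eq_zero.1 h)
    -- If `κ` vanishes, then `b⁺ a = -a⁺ a`, so the coefficient for `-a` is `2 a⁺ a ≠ 0`; the sign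
    -- is put back into `-R`.
    obtain ⟨R, hR, hRa⟩ := key (-a) (by simpa using hab) (by
      intro h
      simp only [star_neg, neg_dotProduct, dotProduct_neg, neg_neg] at h
      exact haa (by linear_combination (1 / 2) * hκ + (1 / 2) * h))
    exact ⟨-R, by simpa using hR, by rw [neg_mulVec, ← mulVec_neg, hRa]⟩
  · exact key a hab hκ

/-! ### The orbits -/

/-- The first basis vector. -/
noncomputable def basisVec (hn : 1 ≤ n) : Fin n → ℂ := Pi.single ⟨0, hn⟩ 1

theorem star_basisVec (hn : 1 ≤ n) : star (basisVec hn) = basisVec hn := by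
  rw [basisVec, ← Pi.single_star, star_one]

theorem basisVec_dotProduct (hn : 1 ≤ n) : star (basisVec hn) ⬝ᵥ basisVec hn = 1 := by
  rw [star_basisVec, basisVec]
  simp

theorem basisVec_ne_zero (hn : 1 ≤ n) : basisVec hn ≠ 0 := fun h => by
  have := basisVec_dotProduct hn
  simp [h] at this

theorem sigmaKL_eq (hn : 1 ≤ n) :
    sigmaKL n 1 0 = vecMulVec (basisVec hn) (star (basisVec hn)) := by
  rw [star_basisVec, basisVec]
  ext i j
  by_cases hi : (i : ℕ) = 0
  · have : i = ⟨0, hn⟩ := Fin.ext hi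
    subst this
    by_cases hj : j = ⟨0, hn⟩
    · subst hj; simp [sigmaKL, vecMulVec_apply]
    · simp [sigmaKL, vecMulVec_apply, hj, Ne.symm hj]
  · have hi' : i ≠ ⟨0, hn⟩ := fun h => hi (congrArg Fin.val h)
    by_cases hij : i = j
    · subst hij; simp [sigmaKL, vecMulVec_apply, hi, hi']
    · simp [sigmaKL, vecMulVec_apply, hij, hi']

/-- Reduces everything about `orbitO` to the null twistors `(Zξ, ξ)`. -/
theorem J0_rankOne (Z : Mat n) (ξ : Fin n → ℂ) :
    J0 (Z, Complex.I • vecMulVec ξ (star ξ)) = JPM (Z *ᵥ ξ, ξ) := by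
  have h : star ξ ᵥ* Zᴴ = star (Z *ᵥ ξ) := (star_mulVec _ _).symm
  simp only [J0, JPM, fromBlocks_smul, Matrix.mul_smul, Matrix.smul_mul, mul_vecMulVec,
    vecMulVec_mul, h, conjTranspose_smul, conjTranspose_vecMulVec, star_star, smul_neg]
  simp

theorem J0t_rankOne {Y : Mat n} (hY : Yᴴ = Y) (ζ : Fin n → ℂ) :
    J0t (Y, vecMulVec ζ (star ζ)) = JPMt (Y *ᵥ ζ, ζ) := by
  have h : star ζ ᵥ* Y = star (Y *ᵥ ζ) := by rw [star_mulVec, hY]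
  simp only [J0t, JPMt, mul_vecMulVec, vecMulVec_mul, h]

theorem unitary_smul {A : Mat n} (hA : Aᴴ * A = 1) (v : Fin n → ℂ) :
    star (A *ᵥ v) ⬝ᵥ (A *ᵥ v) = star v ⬝ᵥ v := by
  rw [star_mulVec, ← dotProduct_mulVec, mulVec_mulVec, hA, one_mulVec]

/-- These are the hyperbolic cosine and sine of `log r`. -/
theorem exists_hyperbolic {r : ℝ} (hr : 0 < r) : ∃ c s : ℝ, c + s = r ∧ c * c - s * s = 1 :=
  ⟨(r + r⁻¹) / 2, (r - r⁻¹) / 2, by ring, by field_simp; ring⟩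

/-- The matrix is a hyperbolic rotation in each plane spanned by corresponding basis vectors,
followed by the block diagonal unitary `diag (A, D)`. -/
theorem hyperbolic_mem {A D : Mat n} (hA : Aᴴ * A = 1) (hD : Dᴴ * D = 1) {c s : ℝ}
    (hcs : c * c - s * s = 1) :
    fromBlocks ((c : ℂ) • A) ((s : ℂ) • A) ((s : ℂ) • D) ((c : ℂ) • D) ∈ pseudoUnitary (phiD n) := by
  have h : (c : ℂ) * c - s * s = 1 := by exact_mod_cast hcs
  change _ * _ * _ = _
  rw [phiD, fromBlocks_conjTranspose, fromBlocks_multiply, fromBlocks_multiply]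
  simp only [conjTranspose_smul, Complex.star_def, Complex.conj_ofReal, Matrix.smul_mul,
    Matrix.mul_smul, mul_one, mul_zero, add_zero, zero_add, hA, hD, Matrix.mul_neg, Matrix.neg_mul,
    smul_smul]
  congr 1
  · match_scalars; linear_combination h
  · module
  · module
  · match_scalars; linear_combination -h

/-- A null vector is the sum of two components of the same length. -/
theorem nullT_components {v : Twistor n} (hv : v ∈ nullT n) :
    v.2 ≠ 0 ∧ star v.1 ⬝ᵥ v.1 = star v.2 ⬝ᵥ v.2 := by
  have h := sub_eq_zero.1 hv.2
  refine ⟨fun h0 => hv.1 (Prod.ext ?_ h0), h⟩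
  rw [h0, dotProduct_zero] at h
  exact dotProduct_star_self_eq_zero.1 h

theorem exists_norm {ξ : Fin n → ℂ} (hξ : ξ ≠ 0) : ∃ r : ℝ, 0 < r ∧ star ξ ⬝ᵥ ξ = (r : ℂ) * r := by
  have h : 0 < star ξ ⬝ᵥ ξ := dotProduct_star_self_pos_iff.2 hξ
  obtain ⟨h1, h2⟩ := Complex.pos_iff.1 h
  refine ⟨Real.sqrt (star ξ ⬝ᵥ ξ).re, Real.sqrt_pos.2 h1, ?_⟩
  rw [← Complex.ofReal_mul, Real.mul_self_sqrt h1.le]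
  exact Complex.ext rfl h2.symm

theorem exists_unitary_basisVec (hn : 1 ≤ n) {r : ℝ} (hr : 0 < r) {ξ : Fin n → ℂ}
    (hξ : star ξ ⬝ᵥ ξ = (r : ℂ) * r) : ∃ D : Mat n, Dᴴ * D = 1 ∧ ((r : ℂ) • D) *ᵥ basisVec hn = ξ := by
  have hr' : (r : ℂ) ≠ 0 := by exact_mod_cast hr.ne'
  obtain ⟨D, hD, hDξ⟩ := exists_unitary (a := basisVec hn) (b := (r : ℂ)⁻¹ • ξ)
    (basisVec_ne_zero hn) (by
      rw [basisVec_dotProduct, star_smul, smul_dotProduct, dotProduct_smul, hξ]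
      simp
      field_simp)
  exact ⟨D, hD, by rw [smul_mulVec, hDξ, smul_smul, mul_inv_cancel₀ hr', one_smul]⟩

theorem basisVec_mem_nullT (hn : 1 ≤ n) : (basisVec hn, basisVec hn) ∈ nullT n :=
  ⟨fun h => basisVec_ne_zero hn (congrArg Prod.fst h), sub_self _⟩

/-- Transitivity on nonzero null vectors: the hyperbolic rotation stretches `(e, e)` by `c + s = r`,
the common length of the two components, and `A`, `D` turn them into the required directions. -/
theorem exists_pseudoUnitary_phiD (hn : 1 ≤ n) {v : Twistor n} (hv : v ∈ nullT n) :
    ∃ g ∈ pseudoUnitary (phiD n), g * col (basisVec hn, basisVec hn) = col v := by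
  obtain ⟨h2, h1⟩ := nullT_components hv
  obtain ⟨r, hr, hrv⟩ := exists_norm h2
  obtain ⟨A, hA, hA1⟩ := exists_unitary_basisVec hn hr (h1.trans hrv)
  obtain ⟨D, hD, hD1⟩ := exists_unitary_basisVec hn hr hrv
  obtain ⟨c, s, hr', hcs⟩ := exists_hyperbolic hr
  have hr'' : (c : ℂ) + s = r := by exact_mod_cast hr'
  refine ⟨_, hyperbolic_mem hA hD hcs, ?_⟩
  rw [col, fromBlocks_mul_fromRows, ← replicateCol_mulVec, ← replicateCol_mulVec,
    ← replicateCol_mulVec, ← replicateCol_mulVec, ← replicateCol_add, ← replicateCol_add,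
    ← add_mulVec, ← add_mulVec, ← add_smul, ← add_smul, add_comm (s : ℂ), hr'']
  change fromRows (replicateCol Unit (((r : ℂ) • A) *ᵥ basisVec hn))
    (replicateCol Unit (((r : ℂ) • D) *ᵥ basisVec hn)) = _
  rw [hA1, hD1, col]

/-- The adjoint action on momenta is induced by the linear action on vectors, which preserves the
nonzero null vectors and is transitive on them. -/
theorem mem_orbitN_iff (hn : 1 ≤ n) {M : Mat2 n} :
    M ∈ orbitN n 1 0 ↔ ∃ v ∈ nullT n, JPM v = M := by
  have h0 : J0 (1, Complex.I • sigmaKL n 1 0) =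
      momentum (phiD n) (col (basisVec hn, basisVec hn)) := by
    rw [sigmaKL_eq hn, J0_rankOne, one_mulVec, JPM_eq]
  constructor
  · rintro ⟨g, hg, rfl⟩
    obtain ⟨v, hv⟩ := exists_col (g * col (basisVec hn, basisVec hn))
    have hb := mem_nullT.1 (basisVec_mem_nullT hn)
    refine ⟨v, mem_nullT.2 ⟨fun hv0 => hb.1 ?_, ?_⟩, ?_⟩
    · rw [← col_eq_zero] at hv0 ⊢
      rw [hv0] at hv
      rw [← Matrix.one_mul (col _), ← nonsing_inv_mul g (pseudoUnitary_isUnit phiD_mul_phiD hg),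
        Matrix.mul_assoc, ← hv, Matrix.mul_zero]
    · rw [hv]
      exact null_mul hg hb.2
    · rw [h0, momentum_adjoint phiD_mul_phiD hg, JPM_eq, hv]
  · rintro ⟨v, hv, rfl⟩
    obtain ⟨g, hg, hgv⟩ := exists_pseudoUnitary_phiD hn hv
    exact ⟨g, hg, by rw [h0, momentum_adjoint phiD_mul_phiD hg, hgv, JPM_eq]⟩

theorem cayley_mem_nullT {v w : Twistor n} (h : col v = cayley n * col w) :
    v ∈ nullT n ↔ w ∈ nullTt n := by
  rw [mem_nullT, mem_nullTt, ne_eq, ne_eq, ← col_eq_zero (w := v), ← col_eq_zero (w := w), h]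
  refine and_congr (not_congr ⟨fun h0 => ?_, fun h0 => by rw [h0, Matrix.mul_zero]⟩) ?_
  · rw [← Matrix.one_mul (col w), ← cayley_conjTranspose_mul, Matrix.mul_assoc, h0, Matrix.mul_zero]
  · rw [conjTranspose_mul, ← cayley_phiD]
    simp only [Matrix.mul_assoc]

theorem exists_pseudoUnitary_phiA {w w' : Twistor n} (hn : 1 ≤ n) (hw : w ∈ nullTt n)
    (hw' : w' ∈ nullTt n) : ∃ g ∈ pseudoUnitary (phiA n), g * col w = col w' := by
  obtain ⟨v, hv⟩ := exists_col (cayley n * col w)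
  obtain ⟨v', hv'⟩ := exists_col (cayley n * col w')
  obtain ⟨g, hg, hgv⟩ := exists_pseudoUnitary_phiD hn ((cayley_mem_nullT hv).2 hw)
  obtain ⟨g', hg', hgv'⟩ := exists_pseudoUnitary_phiD hn ((cayley_mem_nullT hv').2 hw')
  have hm := pseudoUnitary_mul hg' (pseudoUnitary_inv_mem phiD_mul_phiD hg)
  refine ⟨(cayley n)ᴴ * (g' * g⁻¹) * cayley n, ?_, ?_⟩
  · change _ * _ * _ = _
    rw [← cayley_phiA] at hm
    have hm' : (g' * g⁻¹)ᴴ * (cayley n * phiA n * (cayley n)ᴴ) * (g' * g⁻¹) =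
      cayley n * phiA n * (cayley n)ᴴ := hm
    have := congrArg (fun M => (cayley n)ᴴ * M * cayley n) hm'
    simp only [conjTranspose_mul, conjTranspose_conjTranspose, Matrix.mul_assoc,
      cayley_conjTranspose_mul, mul_one] at this ⊢
    rw [this, ← Matrix.mul_assoc, cayley_conjTranspose_mul, one_mul]
  · rw [Matrix.mul_assoc, Matrix.mul_assoc, ← hv, ← hgv, Matrix.mul_assoc,
      ← Matrix.mul_assoc g⁻¹, nonsing_inv_mul g (pseudoUnitary_isUnit phiD_mul_phiD hg),
      Matrix.one_mul, hgv', hv', ← Matrix.mul_assoc, cayley_conjTranspose_mul, Matrix.one_mul]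

theorem mem_orbitNt_iff (hn : 1 ≤ n) {M : Mat2 n} :
    M ∈ orbitNt n 1 0 ↔ ∃ v ∈ nullTt n, JPMt v = M := by
  have h0 : J0t (0, sigmaKL n 1 0) = momentum (phiA n) (col (0, basisVec hn)) := by
    rw [sigmaKL_eq hn, J0t_rankOne (by simp), zero_mulVec, JPMt_eq]
  have hb' : (0, basisVec hn) ∈ nullTt n :=
    ⟨fun h => basisVec_ne_zero hn (congrArg Prod.snd h), by simp⟩
  have hb := mem_nullTt.1 hb'
  constructor
  · rintro ⟨g, hg, rfl⟩
    obtain ⟨v, hv⟩ := exists_col (g * col (0, basisVec hn))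
    refine ⟨v, mem_nullTt.2 ⟨fun hv0 => hb.1 ?_, ?_⟩, ?_⟩
    · rw [← col_eq_zero] at hv0 ⊢
      rw [hv0] at hv
      rw [← Matrix.one_mul (col _), ← nonsing_inv_mul g (pseudoUnitary_isUnit phiA_mul_phiA hg),
        Matrix.mul_assoc, ← hv, Matrix.mul_zero]
    · rw [hv]
      exact null_mul hg hb.2
    · rw [h0, momentum_adjoint phiA_mul_phiA hg, JPMt_eq, hv]
  · rintro ⟨v, hv, rfl⟩
    obtain ⟨g, hg, hgv⟩ := exists_pseudoUnitary_phiA hn hb' hv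
    exact ⟨g, hg, by rw [h0, momentum_adjoint phiA_mul_phiA hg, hgv, JPMt_eq]⟩

/-- The description makes no reference to the group, so membership of the explicit sections and
curves below can be checked directly. -/
theorem mem_orbitO_iff (hn : 1 ≤ n) {q : Mat n × Mat n} :
    q ∈ orbitO n 1 0 ↔ q.1ᴴ * q.1 = 1 ∧ ∃ ξ : Fin n → ℂ, ξ ≠ 0 ∧
      q.2 = Complex.I • vecMulVec ξ (star ξ) := by
  constructor
  · rintro ⟨g, hg, rfl⟩
    set P := g.toBlocks₁₁ + g.toBlocks₁₂ with hP
    set Q := g.toBlocks₂₁ + g.toBlocks₂₂ with hQ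
    -- The columns of `K` span a null subspace, hence so do those of `g K = (P; Q)`, which is the
    -- relation `P⁺ P = Q⁺ Q`.
    let K : Matrix (Fin n ⊕ Fin n) (Fin n) ℂ := fromRows 1 1
    have hgK : g * K = fromRows P Q := by
      conv_lhs => rw [← fromBlocks_toBlocks g]
      simp only [K, fromBlocks_mul_fromRows, mul_one, hP, hQ]
    have hPQ : Pᴴ * P = Qᴴ * Q := by
      have h : (g * K)ᴴ * phiD n * (g * K) = Kᴴ * phiD n * K := by
        rw [conjTranspose_mul, Matrix.mul_assoc Kᴴ, Matrix.mul_assoc Kᴴ, ← Matrix.mul_assoc (gᴴ * _),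
          show gᴴ * phiD n * g = phiD n from hg, ← Matrix.mul_assoc]
      rw [hgK, phiD, conjTranspose_fromRows_eq_fromCols_conjTranspose,
        conjTranspose_fromRows_eq_fromCols_conjTranspose, fromCols_mul_fromBlocks,
        fromCols_mul_fromBlocks, fromCols_mul_fromRows, fromCols_mul_fromRows] at h
      simp only [mul_one, mul_zero, add_zero, zero_add, conjTranspose_one, Matrix.mul_neg,
        Matrix.neg_mul, add_neg_cancel] at h
      rwa [← sub_eq_add_neg, sub_eq_zero] at h
    -- By `P⁺ P = Q⁺ Q` the kernel of `Q` lies in that of `P`, and `g K` is injective; thus the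
    -- denominator `Q` of the action is invertible.
    have hQx : ∀ x : Fin n → ℂ, Q *ᵥ x = 0 → x = 0 := by
      intro x hx
      have hPx : P *ᵥ x = 0 := by
        have : star (P *ᵥ x) ⬝ᵥ (P *ᵥ x) = 0 := by
          rw [star_mulVec, ← dotProduct_mulVec, mulVec_mulVec, hPQ, ← mulVec_mulVec, hx,
            mulVec_zero, dotProduct_zero]
        exact dotProduct_star_self_eq_zero.1 this
      have h1 : (g * K) *ᵥ x = 0 := by
        rw [hgK, fromRows_mulVec, hx, hPx]
        ext i; rcases i with i | i <;> rfl
      have h2 : K *ᵥ x = 0 := by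
        have : g⁻¹ *ᵥ ((g * K) *ᵥ x) = K *ᵥ x := by
          rw [mulVec_mulVec, ← Matrix.mul_assoc,
            nonsing_inv_mul g (pseudoUnitary_isUnit phiD_mul_phiD hg), Matrix.one_mul]
        rw [← this, h1, mulVec_zero]
      ext i
      have := congrFun h2 (Sum.inl i)
      simpa [K, fromRows_mulVec] using this
    have hQu : IsUnit Q.det := by
      rw [isUnit_iff_ne_zero]
      intro h
      obtain ⟨x, hx, hx'⟩ := exists_mulVec_eq_zero_iff.2 h
      exact hx (hQx x hx')
    have h1 : lambdaAct g (1, Complex.I • sigmaKL n 1 0) =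
        (P * Q⁻¹, Q * (Complex.I • sigmaKL n 1 0) * Qᴴ) := by
      simp only [lambdaAct, mul_one, hP, hQ]
    rw [h1]
    refine ⟨?_, Q *ᵥ basisVec hn, fun h => basisVec_ne_zero hn (hQx _ h), ?_⟩
    · change (P * Q⁻¹)ᴴ * (P * Q⁻¹) = 1
      rw [conjTranspose_mul, Matrix.mul_assoc, ← Matrix.mul_assoc Pᴴ, hPQ, Matrix.mul_assoc Qᴴ,
        mul_nonsing_inv Q hQu, Matrix.mul_one, ← conjTranspose_mul, mul_nonsing_inv Q hQu,
        conjTranspose_one]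
    · change Q * (Complex.I • sigmaKL n 1 0) * Qᴴ = _
      rw [sigmaKL_eq hn, Matrix.mul_smul, Matrix.smul_mul, mul_vecMulVec, vecMulVec_mul,
        star_mulVec]
  · rintro ⟨hZ, ξ, hξ, hρ⟩
    obtain ⟨r, hr, hrv⟩ := exists_norm hξ
    obtain ⟨D, hD, hD1⟩ := exists_unitary_basisVec hn hr hrv
    obtain ⟨c, s, hr', hcs⟩ := exists_hyperbolic hr
    have hr'' : (c : ℂ) + s = r := by exact_mod_cast hr'
    have hr0 : (r : ℂ) ≠ 0 := by exact_mod_cast hr.ne'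
    have hA : (q.1 * D)ᴴ * (q.1 * D) = 1 := by
      rw [conjTranspose_mul, Matrix.mul_assoc, ← Matrix.mul_assoc _ q.1, hZ, Matrix.one_mul, hD]
    refine ⟨_, hyperbolic_mem hA hD hcs, ?_⟩
    simp only [lambdaAct, toBlocks_fromBlocks₁₁, toBlocks_fromBlocks₁₂, toBlocks_fromBlocks₂₁,
      toBlocks_fromBlocks₂₂, Matrix.mul_one, ← add_smul, add_comm (s : ℂ), hr'', sigmaKL_eq hn]
    have hinv : ((r : ℂ) • D)⁻¹ = (r : ℂ)⁻¹ • Dᴴ := inv_eq_left_inv (by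
      rw [Matrix.smul_mul, Matrix.mul_smul, smul_smul, inv_mul_cancel₀ hr0, one_smul, hD])
    refine Prod.ext ?_ ?_
    · rw [hinv, Matrix.smul_mul, Matrix.mul_smul, smul_smul, mul_inv_cancel₀ hr0, one_smul,
        Matrix.mul_assoc, mul_eq_one_comm.1 hD, Matrix.mul_one]
    · rw [hρ]
      change _ = ((r : ℂ) • D) * (Complex.I • vecMulVec (basisVec hn) (star (basisVec hn))) *
        ((r : ℂ) • D)ᴴ
      rw [Matrix.mul_smul, Matrix.smul_mul, mul_vecMulVec, vecMulVec_mul, ← star_mulVec, hD1]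

/-! ### The symplectic potential -/

/-- The one-form `-Re (Tr (M dM φ) / Tr (M φ))`, a primitive of the Kirillov form on the orbit
of rank one. -/
noncomputable def theta (φ M : Mat2 n) : Mat2 n →ₗ[ℝ] ℝ where
  toFun a := -(trace (M * a * φ) / trace (M * φ)).re
  map_add' a b := by
    rw [Matrix.mul_add, Matrix.add_mul, trace_add, add_div, Complex.add_re, neg_add]
  map_smul' r a := by
    rw [Matrix.mul_smul, Matrix.smul_mul, trace_smul, smul_div_assoc, Complex.smul_re]
    simp

theorem theta_apply (φ M a : Mat2 n) :
    theta φ M a = -(trace (M * a * φ) / trace (M * φ)).re := rfl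

theorem contDiffAt_theta {φ M : Mat2 n} (h : trace (M * φ) ≠ 0) (a : Mat2 n) :
    ContDiffAt ℝ ∞ (fun M => theta φ M a) M := by
  have h1 : ContDiffAt ℝ ∞ (fun M : Mat2 n => trace (M * φ)) M := by fun_prop
  have h2 : ContDiffAt ℝ ∞ (fun M : Mat2 n => trace (M * a * φ)) M := by fun_prop
  have h3 := contDiffAt_re (h2.mul (h1.inv h))
  simp only [theta_apply, div_eq_mul_inv]
  exact h3.neg

/-- In `M dM` with `M = c ρ d`, the terms containing `dρ` and the derivative of `d` vanish because
`d c = 0`. The remaining term `c ρ (d dc) ρ d` is `Tr (ρ d dc) M` since `ρ` has rank one, and the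
quotient by `Tr (M φ)` removes the trace of `M φ`. -/
theorem theta_factor {D κ : Type*} [NormedAddCommGroup D] [NormedSpace ℝ D] [Fintype κ]
    {φ : Mat2 n} {c : D → Matrix (Fin n ⊕ Fin n) κ ℂ} {ρ : D → Matrix κ κ ℂ}
    {d : D → Matrix κ (Fin n ⊕ Fin n) ℂ} {M : D → Mat2 n} {x : D}
    (hM : ∀ y, M y = c y * ρ y * d y) (hc : DifferentiableAt ℝ c x)
    (hρ : DifferentiableAt ℝ ρ x) (hd : DifferentiableAt ℝ d x) (hdc : d x * c x = 0)
    (hρA : ∀ A, ρ x * A * ρ x = trace (ρ x * A) • ρ x)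
    (htr : trace (M x * φ) ≠ 0) (v : D) :
    theta φ (M x) (fderiv ℝ M x v) =
      -(trace (ρ x * (d x * fderiv ℝ c x v))).re := by
  obtain rfl : M = fun y => c y * ρ y * d y := funext hM
  have h0 : ∀ B : Matrix κ (Fin n ⊕ Fin n) ℂ, d x * (c x * B) = 0 := fun B => by
    rw [← Matrix.mul_assoc, hdc, Matrix.zero_mul]
  have h1 : c x * ρ x * d x * fderiv ℝ (fun y => c y * ρ y * d y) x v =
      c x * (ρ x * (d x * fderiv ℝ c x v) * ρ x) * d x := by
    rw [fderiv_matMul (differentiableAt_matMul hc hρ) hd, fderiv_matMul hc hρ]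
    simp only [Matrix.add_mul, Matrix.mul_add, Matrix.mul_assoc, h0, Matrix.mul_zero, add_zero]
  simp only at htr
  rw [theta_apply, h1, hρA, Matrix.mul_smul, Matrix.smul_mul, Matrix.smul_mul, trace_smul,
    smul_eq_mul, mul_div_cancel_right₀ _ htr]

theorem vecMulVec_mul_mul_vecMulVec (a b : Fin n → ℂ) (A : Mat n) :
    vecMulVec a b * A * vecMulVec a b = trace (vecMulVec a b * A) • vecMulVec a b := by
  rw [vecMulVec_mul, trace_vecMulVec, vecMulVec_mul_vecMulVec, vecMulVec_smul, dotProduct_comm]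

theorem trace_momentum {φ : Mat2 n} (hφ : φ * φ = 1) (V : Matrix (Fin n ⊕ Fin n) Unit ℂ) :
    trace (momentum φ V * φ) = -Complex.I * (Vᴴ * V) () () := by
  rw [momentum, Matrix.smul_mul, Matrix.mul_assoc, hφ, Matrix.mul_one, trace_smul, trace_mul_comm,
    trace_unit_matrix, smul_eq_mul]

theorem conjTranspose_mul_self_apply_ne_zero {V : Matrix (Fin n ⊕ Fin n) Unit ℂ} (hV : V ≠ 0) :
    (Vᴴ * V) () () ≠ 0 := fun h0 => hV <|
  conjTranspose_mul_self_eq_zero.1 (by rw [unit_matrix_eq (Vᴴ * V), h0, zero_smul])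

/-- The trace is `-i V⁺ V`; it is the denominator of the potential, which is therefore smooth along
the orbit. -/
theorem trace_orbitNt_ne_zero (hn : 1 ≤ n) {M : Mat2 n} (hM : M ∈ orbitNt n 1 0) :
    trace (M * phiA n) ≠ 0 := by
  obtain ⟨w, hw, rfl⟩ := (mem_orbitNt_iff hn).1 hM
  rw [JPMt_eq, trace_momentum phiA_mul_phiA]
  exact mul_ne_zero (neg_ne_zero.2 Complex.I_ne_zero)
    (conjTranspose_mul_self_apply_ne_zero (col_eq_zero.not.2 hw.1))

/-- The Kirillov form of `𝒩̃₁₀`. -/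
noncomputable def kirillovForm (hn : 1 ≤ n) : DForm 2 (orbitNt n 1 0) :=
  DForm.exact _ (theta (phiA n)) fun M => contDiffAt_theta (trace_orbitNt_ne_zero hn M.2)

/-! ### The momentum maps -/

/-- `w ↦ U w` as a continuous linear map. -/
noncomputable def mulColCLM (U : Mat2 n) : Twistor n →L[ℝ] Matrix (Fin n ⊕ Fin n) Unit ℂ :=
  LinearMap.toContinuousLinearMap
    { toFun := fun w => U * col w
      map_add' := fun v w => by
        rw [← Matrix.mul_add]; congr 1; ext i j; rcases i with i | i <;> rfl
      map_smul' := fun r w => by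
        rw [RingHom.id_apply, ← Matrix.mul_smul]; congr 1; ext i j; rcases i with i | i <;> rfl }

theorem contDiff_mulCol (U : Mat2 n) : ContDiff ℝ ∞ fun w : Twistor n => U * col w :=
  (mulColCLM U).contDiff

theorem contDiff_momentum (φ U : Mat2 n) :
    ContDiff ℝ ∞ fun w : Twistor n => momentum φ (U * col w) := by
  have := contDiff_mulCol U
  unfold momentum
  fun_prop

/-- The factorization is `V · 1 · (-i V⁺ φ)`, and its outer factors annihilate each other because
`V` is null. -/
theorem theta_momentum {φ U : Mat2 n} {m : ℕ} {p : E m → Twistor n} (hp : ContDiff ℝ ∞ p)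
    {M : E m → Mat2 n} (hM : ∀ y, M y = momentum φ (U * col (p y))) (x v : E m)
    (h0 : (U * col (p x))ᴴ * φ * (U * col (p x)) = 0)
    (htr : trace (M x * φ) ≠ 0) :
    theta φ (M x) (fderiv ℝ M x v) =
      (Complex.I * ((U * col (p x))ᴴ * φ * (U * col (fderiv ℝ p x v))) () ()).re := by
  have hp' := hp.differentiable (by simp) x
  have hc : HasFDerivAt (fun y => U * col (p y)) ((mulColCLM U).comp (fderiv ℝ p x)) x :=
    (mulColCLM U).hasFDerivAt.comp x hp'.hasFDerivAt
  have hd : DifferentiableAt ℝ (fun y => -Complex.I • ((U * col (p y))ᴴ * φ)) x := by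
    have h1 : ContDiff ℝ ∞ fun y => U * col (p y) := (contDiff_mulCol U).comp hp
    have : ContDiff ℝ ∞ (fun y => -Complex.I • ((U * col (p y))ᴴ * φ)) := by fun_prop
    exact this.differentiable (by simp) x
  have heq : ∀ V : Matrix (Fin n ⊕ Fin n) Unit ℂ,
      momentum φ V = V * (1 : Matrix Unit Unit ℂ) * (-Complex.I • (Vᴴ * φ)) := fun V => by
    rw [momentum, Matrix.mul_one, Matrix.mul_smul, Matrix.mul_assoc]
  rw [theta_factor (fun y => (hM y).trans (heq _)) hc.differentiableAt (differentiableAt_const (1 : Matrix Unit Unit ℂ)) hd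
    (by rw [Matrix.smul_mul, h0, smul_zero])
    (fun A => by
      rw [Matrix.one_mul, Matrix.mul_one, trace_unit_matrix]; exact unit_matrix_eq A)
    htr, hc.fderiv, Matrix.one_mul, trace_unit_matrix, Matrix.smul_mul, Matrix.smul_apply,
    ← Complex.neg_re, smul_eq_mul, neg_mul, neg_neg]
  rfl

/-- The momentum map `𝒯̃⁰₊₋ → 𝒩̃₁₀`. -/
noncomputable def toNtOfTt (hn : 1 ≤ n) (w : nullTt n) : orbitNt n 1 0 :=
  ⟨JPMt w.1, (mem_orbitNt_iff hn).2 ⟨w.1, w.2, rfl⟩⟩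

/-- The momentum map `𝒯⁰₊₋ → 𝒩̃₁₀`. -/
noncomputable def toNtOfT (hn : 1 ≤ n) (v : nullT n) : orbitNt n 1 0 :=
  ⟨(cayley n)ᴴ * JPM v.1 * cayley n, by
    obtain ⟨w, hw⟩ := exists_col ((cayley n)ᴴ * col v.1)
    have hv : col v.1 = cayley n * col w := by
      rw [hw, ← Matrix.mul_assoc, cayley_mul_conjTranspose, Matrix.one_mul]
    refine (mem_orbitNt_iff hn).2 ⟨w, (cayley_mem_nullT hv).1 v.2, ?_⟩
    rw [JPM_eq, momentum_cayley, ← hw, JPMt_eq]⟩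

theorem dSmooth_toNtOfTt (hn : 1 ≤ n) : DSmooth (toNtOfTt hn) := by
  refine dSmooth_subset (F := fun w => momentum (phiA n) ((1 : Mat2 n) * col w))
    (fun _ => (contDiff_momentum _ _).contDiffAt) fun w => ?_
  rw [Matrix.one_mul, ← JPMt_eq]
  rfl

theorem dSmooth_toNtOfT (hn : 1 ≤ n) : DSmooth (toNtOfT hn) := by
  refine dSmooth_subset (F := fun w => momentum (phiA n) ((cayley n)ᴴ * col w))
    (fun _ => (contDiff_momentum _ _).contDiffAt) fun w => ?_
  rw [← momentum_cayley, ← JPM_eq]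
  rfl

theorem kirillovForm_pullback_Tt (hn : 1 ≤ n) :
    (kirillovForm hn).pullback (dSmooth_toNtOfTt hn) = (sysTt n).form := by
  refine DForm.exact_pullback (contDiff_gammaPMt n) _ _ fun {m} p hp x v => ?_
  have h : ∀ y, (toNtOfTt hn (p y) : Mat2 n) = momentum (phiA n) ((1 : Mat2 n) * col (p y).1) := fun y => by
    rw [Matrix.one_mul, ← JPMt_eq]; rfl
  have htr := trace_orbitNt_ne_zero hn (toNtOfTt hn (p x)).2
  refine (theta_momentum (p := fun y => (p y).1) hp h x v ?_ htr).trans ?_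
  · rw [Matrix.one_mul]
    exact (mem_nullTt.1 (p x).2).2
  · rw [Matrix.one_mul, Matrix.one_mul, col_phiA_col, ← mul_assoc, Complex.I_mul_I]
    simp [gammaPMt]

theorem kirillovForm_pullback_T (hn : 1 ≤ n) :
    (kirillovForm hn).pullback (dSmooth_toNtOfT hn) = (sysT n).form := by
  have hc : ∀ V W : Matrix (Fin n ⊕ Fin n) Unit ℂ,
      ((cayley n)ᴴ * V)ᴴ * phiA n * ((cayley n)ᴴ * W) = Vᴴ * phiD n * W := fun V W => by
    rw [← cayley_phiA]
    simp only [conjTranspose_mul, conjTranspose_conjTranspose, Matrix.mul_assoc]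
  refine DForm.exact_pullback (contDiff_gammaPM n) _ _ fun {m} p hp x v => ?_
  have h : ∀ y, (toNtOfT hn (p y) : Mat2 n) = momentum (phiA n) ((cayley n)ᴴ * col (p y).1) :=
    fun y => by rw [← momentum_cayley, ← JPM_eq]; rfl
  have htr := trace_orbitNt_ne_zero hn (toNtOfT hn (p x)).2
  refine (theta_momentum (p := fun y => (p y).1) hp h x v ?_ htr).trans ?_
  · rw [hc]
    exact (mem_nullT.1 (p x).2).2
  · rw [hc, col_phiD_col]
    rfl

/-- The momentum map `𝒪₁₀ → 𝒩̃₁₀`. -/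
noncomputable def toNtOfO (hn : 1 ≤ n) (q : orbitO n 1 0) : orbitNt n 1 0 :=
  ⟨(cayley n)ᴴ * J0 q.1 * cayley n, by
    obtain ⟨hZ, ξ, hξ, hρ⟩ := (mem_orbitO_iff hn).1 q.2
    have h : J0 q.1 = JPM (q.1.1 *ᵥ ξ, ξ) := by rw [← J0_rankOne, ← hρ]
    rw [h]
    refine (toNtOfT hn ⟨(q.1.1 *ᵥ ξ, ξ), ?_, ?_⟩).2
    · exact fun h0 => hξ (congrArg Prod.snd h0)
    · rw [unitary_smul hZ, sub_self]⟩

/-- In rank one all columns are multiples of one vector `u`. Hermitian symmetry makes the matrix `c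
u u⁺`, positivity gives `c ≥ 0`, and `ζ = √c u`. -/
theorem exists_of_mem_orbitOt {q : Mat n × Mat n} (hq : q ∈ orbitOt n) :
    q.1ᴴ = q.1 ∧ ∃ ζ : Fin n → ℂ, ζ ≠ 0 ∧ q.2 = vecMulVec ζ (star ζ) := by
  obtain ⟨h1, h2, h3⟩ := hq
  refine ⟨h1, ?_⟩
  obtain ⟨⟨u, hu⟩, hu0, hspan⟩ := finrank_eq_one_iff'.1 (h3 : Module.finrank ℂ _ = 1)
  have hu0' : u ≠ 0 := fun h => hu0 (Subtype.ext h)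
  have hb : ∀ j, ∃ b : ℂ, ∀ i, q.2 i j = b * u i := fun j => by
    obtain ⟨b, hb⟩ := hspan ⟨q.2 *ᵥ Pi.single j 1, ⟨_, rfl⟩⟩
    refine ⟨b, fun i => ?_⟩
    have h := congrFun (congrArg Subtype.val hb) i
    simp only [mulVec_single_one] at h
    exact h.symm
  choose b hb using hb
  obtain ⟨k, hk⟩ := Function.ne_iff.1 hu0'
  have hk' : u k ≠ 0 := hk
  have hlam : q.2 = (star (b k) / u k) • vecMulVec u (star u) := by
    ext i j
    have h : star (q.2 j k) = q.2 k j := h2.1.apply k j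
    rw [hb, hb, star_mul'] at h
    rw [hb, Matrix.smul_apply, vecMulVec_apply, smul_eq_mul, Pi.star_apply,
      show b j = star (b k) * star (u j) / u k by rw [eq_div_iff hk', h]]
    ring
  obtain ⟨r, hr, hur⟩ := exists_norm hu0'
  have hr' : (r : ℂ) ≠ 0 := Complex.ofReal_ne_zero.2 hr.ne'
  obtain ⟨c, hc⟩ : ∃ c, c = star (b k) / u k := ⟨_, rfl⟩
  rw [← hc] at hlam
  have hpos : 0 ≤ c := by
    have h : 0 ≤ star u ⬝ᵥ q.2 *ᵥ u := h2.dotProduct_mulVec_nonneg u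
    rw [hlam, smul_mulVec, vecMulVec_mulVec, hur, dotProduct_smul, op_smul_eq_smul,
      dotProduct_smul, hur, smul_eq_mul, smul_eq_mul] at h
    -- Positivity at `u` itself reads `0 ≤ c |u|⁴`, and the positive factor `|u|⁴` is divided out.
    have h4 : c = c * (r * r * (r * r)) * ((r⁻¹ ^ 4 : ℝ) : ℂ) := by
      push_cast
      field_simp
    rw [h4]
    refine mul_nonneg h ?_
    exact_mod_cast (by positivity : (0 : ℝ) ≤ r⁻¹ ^ 4)
  obtain ⟨s, hs, hsc⟩ : ∃ s : ℝ, 0 ≤ s ∧ (s : ℂ) = c :=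
    ⟨c.re, (Complex.le_def.1 hpos).1, Complex.ext rfl (by simpa using (Complex.le_def.1 hpos).2)⟩
  have hX : q.2 = vecMulVec (((Real.sqrt s : ℝ) : ℂ) • u) (star (((Real.sqrt s : ℝ) : ℂ) • u)) := by
    rw [star_smul, smul_vecMulVec, vecMulVec_smul, smul_smul, hlam, ← hsc]
    congr 1
    rw [show star ((Real.sqrt s : ℝ) : ℂ) = ((Real.sqrt s : ℝ) : ℂ) from Complex.conj_ofReal _,
      ← Complex.ofReal_mul, Real.mul_self_sqrt hs]
  refine ⟨_, fun h0 => ?_, hX⟩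
  rw [h0, zero_vecMulVec] at hX
  rw [hX, rank_zero] at h3
  exact zero_ne_one h3

theorem mem_orbitOt {Y : Mat n} (hY : Yᴴ = Y) {ζ : Fin n → ℂ} (hζ : ζ ≠ 0) :
    (Y, vecMulVec ζ (star ζ)) ∈ orbitOt n := by
  refine ⟨hY, posSemidef_vecMulVec_self_star ζ, le_antisymm (rank_vecMulVec_le _ _) ?_⟩
  refine Nat.one_le_iff_ne_zero.2 fun h => hζ ?_
  have h1 : (vecMulVec ζ (star ζ)).mulVecLin = 0 :=
    LinearMap.range_eq_bot.1 (Submodule.finrank_eq_zero.1 h)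
  have h0 : vecMulVec ζ (star ζ) = 0 := by
    rw [← mulVecLin_zero] at h1
    exact Matrix.ext_of_mulVec_single fun i => DFunLike.congr_fun h1 _
  simpa using h0

/-- The momentum map `𝒪̃₁₀ → 𝒩̃₁₀`. -/
noncomputable def toNtOfOt (hn : 1 ≤ n) (q : orbitOt n) : orbitNt n 1 0 :=
  ⟨J0t q.1, by
    obtain ⟨hY, ζ, hζ, hX⟩ := exists_of_mem_orbitOt q.2
    have h : J0t q.1 = JPMt (q.1.1 *ᵥ ζ, ζ) := by rw [← J0t_rankOne hY, ← hX]
    rw [h]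
    refine (toNtOfTt hn ⟨(q.1.1 *ᵥ ζ, ζ), fun h0 => hζ (congrArg Prod.snd h0), ?_⟩).2
    rw [star_mulVec, hY, dotProduct_mulVec, sub_self, mul_zero]⟩

theorem contDiff_J0 : ContDiff ℝ ∞ (J0 (n := n)) := by
  unfold J0
  rw [contDiff_iff_contDiffAt]
  intro x
  fun_prop

theorem contDiff_J0t : ContDiff ℝ ∞ (J0t (n := n)) := by
  unfold J0t
  rw [contDiff_iff_contDiffAt]
  intro x
  fun_prop

theorem dSmooth_toNtOfO (hn : 1 ≤ n) : DSmooth (toNtOfO hn) := by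
  have := contDiff_J0 (n := n)
  refine dSmooth_subset (F := fun q => (cayley n)ᴴ * J0 q * cayley n)
    (fun _ => ?_) fun w => rfl
  fun_prop

theorem dSmooth_toNtOfOt (hn : 1 ≤ n) : DSmooth (toNtOfOt hn) :=
  dSmooth_subset (fun _ => contDiff_J0t.contDiffAt) fun _ => rfl

/-- `Z ↦ (Z; 0)` as a continuous linear map. -/
noncomputable def fromRowsCLM (n : ℕ) : Mat n × Mat n →L[ℝ] Matrix (Fin n ⊕ Fin n) (Fin n) ℂ :=
  LinearMap.toContinuousLinearMap
    { toFun := fun q => fromRows q.1 (0 : Mat n)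
      map_add' := fun v w => by ext i j; rcases i with i | i <;> simp
      map_smul' := fun r w => by ext i j; rcases i with i | i <;> simp }

theorem fromRowsCLM_apply (q : Mat n × Mat n) : fromRowsCLM n q = fromRows q.1 (0 : Mat n) := rfl

theorem hasFDerivAt_fromRows {m : ℕ} {p : E m → Mat n × Mat n} {p' : E m →L[ℝ] Mat n × Mat n}
    {x : E m} (hp : HasFDerivAt p p' x) :
    HasFDerivAt (fun y => fromRows (p y).1 (1 : Mat n)) ((fromRowsCLM n).comp p') x := by
  have h : (fun y => fromRows (p y).1 (1 : Mat n)) =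
      fun y => fromRowsCLM n (p y) + fromRows (0 : Mat n) (1 : Mat n) := by
    funext y; ext i j; rcases i with i | i <;> simp [fromRowsCLM_apply]
  rw [h]
  exact ((fromRowsCLM n).hasFDerivAt.comp x hp).add_const _

/-- Left multiplication by a matrix as a continuous linear map. -/
noncomputable def mulLeftCLM (U : Mat2 n) (κ : Type*) [Fintype κ] :
    Matrix (Fin n ⊕ Fin n) κ ℂ →L[ℝ] Matrix (Fin n ⊕ Fin n) κ ℂ :=
  LinearMap.toContinuousLinearMap
    { toFun := fun V => U * V
      map_add' := fun v w => Matrix.mul_add _ _ _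
      map_smul' := fun r w => by rw [RingHom.id_apply, Matrix.mul_smul] }

theorem contDiff_fromCols {D : Type*} [NormedAddCommGroup D] [NormedSpace ℝ D] {f g : D → Mat n}
    (hf : ContDiff ℝ ∞ f) (hg : ContDiff ℝ ∞ g) : ContDiff ℝ ∞ fun x => fromCols (f x) (g x) := by
  refine contDiff_matrix_iff.2 fun i j => ?_
  rcases j with j | j
  · exact contDiff_matrix_iff.1 hf i j
  · exact contDiff_matrix_iff.1 hg i j

/-- Up to the Cayley matrix, `J0` factors as `(Z; 1) ρ (-Z⁺, 1)`. The outer factors annihilate each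
other because `Z` is unitary, and what remains of the potential is `Tr (ρ Z⁺ dZ)`. -/
theorem kirillovForm_pullback_O (hn : 1 ≤ n) :
    (kirillovForm hn).pullback (dSmooth_toNtOfO hn) = (sysO n).form := by
  refine DForm.exact_pullback (contDiff_gamma0 n) _ _ fun {m} p hp x v => ?_
  have hp' : ContDiff ℝ ∞ fun y => (p y).1 := hp
  have hc : HasFDerivAt
      (fun y => ((cayley n)ᴴ * fromRows (p y).1.1 (1 : Mat n) : Matrix (Fin n ⊕ Fin n) (Fin n) ℂ))
      ((mulLeftCLM (cayley n)ᴴ (Fin n)).comp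
        ((fromRowsCLM n).comp (fderiv ℝ (fun y => (p y).1) x))) x :=
    (mulLeftCLM (cayley n)ᴴ (Fin n)).hasFDerivAt.comp x
      (hasFDerivAt_fromRows (hp'.differentiable (by simp) x).hasFDerivAt)
  have hd : DifferentiableAt ℝ (fun y => (fromCols (-(p y).1.1ᴴ) (1 : Mat n) * cayley n :
      Matrix (Fin n) (Fin n ⊕ Fin n) ℂ)) x := by
    have h1 := contDiff_fromCols (contDiff_conjTranspose hp'.fst).neg
      (contDiff_const (c := (1 : Mat n)))
    exact (contDiff_matMul h1 contDiff_const).differentiable (by simp) x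
  have hρ : DifferentiableAt ℝ (fun y => (p y).1.2) x := hp'.snd.differentiable (by simp) x
  have hJ : ∀ y, (toNtOfO hn (p y) : Mat2 n) =
      ((cayley n)ᴴ * fromRows (p y).1.1 (1 : Mat n) : Matrix (Fin n ⊕ Fin n) (Fin n) ℂ) *
        (p y).1.2 * (fromCols (-(p y).1.1ᴴ) (1 : Mat n) * cayley n :
          Matrix (Fin n) (Fin n ⊕ Fin n) ℂ) := by
    intro y
    obtain ⟨hZ, ξ, hξ, hρ⟩ := (mem_orbitO_iff hn).1 (p y).2
    have hρ' : (p y).1.2ᴴ = -(p y).1.2 := by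
      rw [hρ, conjTranspose_smul, conjTranspose_vecMulVec, star_star]; simp
    change (cayley n)ᴴ * J0 (p y).1 * cayley n = _
    have : J0 (p y).1 = fromRows (p y).1.1 1 * (p y).1.2 * fromCols (-(p y).1.1ᴴ) 1 := by
      rw [fromRows_mul, fromRows_mul_fromCols, J0, conjTranspose_mul, hρ']
      simp
    rw [this]
    simp only [Matrix.mul_assoc]
  have htr := trace_orbitNt_ne_zero hn (toNtOfO hn (p x)).2
  obtain ⟨hZ, ξ, hξ, hρξ⟩ := (mem_orbitO_iff hn).1 (p x).2
  have hC : ∀ (A : Matrix (Fin n) (Fin n ⊕ Fin n) ℂ) (B : Matrix (Fin n ⊕ Fin n) (Fin n) ℂ),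
      A * cayley n * ((cayley n)ᴴ * B) = A * B := fun A B => by
    rw [Matrix.mul_assoc, ← Matrix.mul_assoc (cayley n), cayley_mul_conjTranspose, Matrix.one_mul]
  refine (theta_factor hJ hc.differentiableAt hρ hd ?_ ?_ htr v).trans ?_
  · rw [hC, fromCols_mul_fromRows, Matrix.neg_mul, hZ]
    simp
  · intro A
    rw [hρξ, ← smul_vecMulVec]
    exact vecMulVec_mul_mul_vecMulVec _ _ _
  · rw [hc.fderiv]
    change _ = (trace ((p x).1.2 * (p x).1.1ᴴ * (fderiv ℝ (fun y => (p y).1) x v).1)).re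
    have h1 : (fromCols (-(p x).1.1ᴴ) (1 : Mat n) * cayley n *
        ((cayley n)ᴴ * fromRows (fderiv ℝ (fun y => (p y).1) x v).1 (0 : Mat n)) : Mat n) =
        -((p x).1.1ᴴ * (fderiv ℝ (fun y => (p y).1) x v).1) := by
      rw [hC, fromCols_mul_fromRows]
      simp
    change -(trace ((p x).1.2 * (fromCols (-(p x).1.1ᴴ) (1 : Mat n) * cayley n *
        ((cayley n)ᴴ * fromRows (fderiv ℝ (fun y => (p y).1) x v).1 (0 : Mat n)) : Mat n))).re = _
    rw [h1, Matrix.mul_neg, trace_neg, Complex.neg_re, neg_neg, Matrix.mul_assoc]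

/-- Here the factorization is `(Y; 1) X (1, -Y)`. -/
theorem kirillovForm_pullback_Ot (hn : 1 ≤ n) :
    (kirillovForm hn).pullback (dSmooth_toNtOfOt hn) = (sysOt n).form := by
  refine DForm.exact_pullback (contDiff_gamma0t n) _ _ fun {m} p hp x v => ?_
  have hp' : ContDiff ℝ ∞ fun y => (p y).1 := hp
  have hc := hasFDerivAt_fromRows (hp'.differentiable (by simp) x).hasFDerivAt
  have hd : DifferentiableAt ℝ (fun y => fromCols (1 : Mat n) (-(p y).1.1)) x :=
    (contDiff_fromCols contDiff_const hp'.fst.neg).differentiable (by simp) x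
  have hρ : DifferentiableAt ℝ (fun y => (p y).1.2) x := hp'.snd.differentiable (by simp) x
  have hJ : ∀ y, (toNtOfOt hn (p y) : Mat2 n) =
      fromRows (p y).1.1 (1 : Mat n) * (p y).1.2 * fromCols (1 : Mat n) (-(p y).1.1) := by
    intro y
    rw [fromRows_mul, fromRows_mul_fromCols]
    change J0t (p y).1 = _
    simp [J0t]
  have htr := trace_orbitNt_ne_zero hn (toNtOfOt hn (p x)).2
  obtain ⟨-, ζ, hζ, hX⟩ := exists_of_mem_orbitOt (p x).2
  refine (theta_factor hJ hc.differentiableAt hρ hd ?_ ?_ htr v).trans ?_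
  · rw [fromCols_mul_fromRows]
    simp
  · intro A
    rw [hX]
    exact vecMulVec_mul_mul_vecMulVec _ _ _
  · rw [hc.fderiv]
    change _ = -(trace ((p x).1.2 * (fderiv ℝ (fun y => (p y).1) x v).1)).re
    have h1 : (fromCols (1 : Mat n) (-(p x).1.1) *
        fromRows (fderiv ℝ (fun y => (p y).1) x v).1 (0 : Mat n) : Mat n) =
        (fderiv ℝ (fun y => (p y).1) x v).1 := by
      rw [fromCols_mul_fromRows]
      simp
    change -(trace ((p x).1.2 * (fromCols (1 : Mat n) (-(p x).1.1) *
        fromRows (fderiv ℝ (fun y => (p y).1) x v).1 (0 : Mat n) : Mat n))).re = _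
    rw [h1]

/-! ### Charts of the orbit -/

/-- The map `(u, z) ↦ (Im u_j, Im z_j)`. -/
noncomputable def imCoord (j : Fin n) : Twistor n →ₗ[ℝ] ℝ × ℝ where
  toFun w := ((w.1 j).im, (w.2 j).im)
  map_add' v w := by simp
  map_smul' r w := by simp

/-- The coordinate space consists of the twistors with both `j`-th components real: the phase and
the null constraint remove two of the `4n` real dimensions. -/
theorem exists_coordinates (hn : 1 ≤ n) (j : Fin n) :
    ∃ (ι : E (2 * (2 * n - 1)) →L[ℝ] Twistor n) (π : Twistor n →L[ℝ] E (2 * (2 * n - 1))),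
      (∀ e, (ι e).1 j = (((ι e).1 j).re : ℂ) ∧ (ι e).2 j = (((ι e).2 j).re : ℂ)) ∧
      (∀ e, π (ι e) = e) ∧ ∀ w : Twistor n, (w.1 j).im = 0 → (w.2 j).im = 0 → ι (π w) = w := by
  have hsurj : Function.Surjective (imCoord j) := fun a =>
    ⟨(fun _ => ⟨0, a.1⟩, fun _ => ⟨0, a.2⟩), rfl⟩
  have hdim : Module.finrank ℝ (LinearMap.ker (imCoord j)) = 2 * (2 * n - 1) := by
    have h := LinearMap.finrank_range_add_finrank_ker (imCoord j)
    rw [LinearMap.range_eq_top.2 hsurj, finrank_top] at h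
    rw [show Module.finrank ℝ (ℝ × ℝ) = 2 by simp, show Module.finrank ℝ (Twistor n) = 4 * n by
      rw [Module.finrank_prod, Module.finrank_pi_fintype]
      simp [Complex.finrank_real_complex]; ring] at h
    omega
  let L : E (2 * (2 * n - 1)) ≃L[ℝ] LinearMap.ker (imCoord j) :=
    ContinuousLinearEquiv.ofFinrankEq (by rw [hdim, finrank_euclideanSpace_fin])
  obtain ⟨g, hg⟩ := (LinearMap.ker (imCoord j)).subtype.exists_leftInverse_of_injective
    (Submodule.ker_subtype _)
  have hg' : ∀ w : LinearMap.ker (imCoord j), g (w : Twistor n) = w := fun w => DFunLike.congr_fun hg w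
  refine ⟨(LinearMap.ker (imCoord j)).subtypeL.comp (L : _ →L[ℝ] _),
    (L.symm : _ →L[ℝ] _).comp (LinearMap.toContinuousLinearMap g), fun e => ?_, fun e => ?_,
    fun w h1 h2 => ?_⟩
  · have h : imCoord j (L e) = 0 := (L e).2
    exact ⟨Complex.ext rfl (congrArg Prod.fst h), Complex.ext rfl (congrArg Prod.snd h)⟩
  · change L.symm (g (L e)) = e
    rw [hg', L.symm_apply_apply]
  · change (L (L.symm (g w)) : Twistor n) = w
    rw [L.apply_symm_apply]
    exact congrArg Subtype.val (hg' ⟨w, LinearMap.mem_ker.2 (Prod.ext h1 h2)⟩)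

/-- The null twistor with coordinates `w = (u, z)` near a point with `ζ_j ≠ 0`: the phase is
normalized by `ζ_j > 0` and `Im υ_j` is determined by the constraint. -/
noncomputable def chartLift (j : Fin n) (w : Twistor n) : Twistor n :=
  -- The exponential makes every real `z_j` admissible, so the chart is defined on the whole
  -- coordinate space. There `z_j` and `u_j` are real and do not contribute to `Im (z⁺ u)`. A shift
  -- of `Im υ_j` by `t` changes `Im (ζ⁺ υ)` by `exp (z_j) t`, which fixes `t`.
  w + (Real.exp (w.2 j).re - (w.2 j).re) • ((0, Pi.single j 1) : Twistor n) +
    (-(Real.exp (-(w.2 j).re) * (star w.2 ⬝ᵥ w.1).im)) •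
      ((Pi.single j Complex.I, 0) : Twistor n)

theorem contDiff_chartLift (j : Fin n) : ContDiff ℝ ∞ (chartLift j) := by
  have h1 : ContDiff ℝ ∞ fun w : Twistor n => (w.2 j).re :=
    contDiff_re (contDiff_pi.1 contDiff_snd j)
  have h2 : ContDiff ℝ ∞ fun w : Twistor n => (star w.2 ⬝ᵥ w.1).im :=
    Complex.imCLM.contDiff.comp (contDiff_star_dotProduct contDiff_snd contDiff_fst)
  unfold chartLift
  fun_prop

/-- The inverse of `chartLift` on normalized null twistors. -/
noncomputable def chartCoord (j : Fin n) (w : Twistor n) : Twistor n :=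
  w + (Real.log (w.2 j).re - (w.2 j).re) • ((0, Pi.single j 1) : Twistor n) +
    (-(w.1 j).im) • ((Pi.single j Complex.I, 0) : Twistor n)

theorem contDiffAt_chartCoord {j : Fin n} {w : Twistor n} (hw : (w.2 j).re ≠ 0) :
    ContDiffAt ℝ ∞ (chartCoord j) w := by
  have h3 : ContDiffAt ℝ ∞ (fun w : Twistor n => (w.2 j).re) w :=
    (contDiff_re (contDiff_pi.1 contDiff_snd j)).contDiffAt
  have h4 : ContDiff ℝ ∞ fun w : Twistor n => (w.1 j).im :=
    Complex.imCLM.contDiff.comp (contDiff_pi.1 contDiff_fst j)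
  exact (contDiffAt_id.add (((h3.log hw).sub h3).smul contDiffAt_const)).add
    (h4.contDiffAt.neg.smul contDiffAt_const)

theorem chartLift_snd_apply (j : Fin n) (w : Twistor n) (hw : w.2 j = ((w.2 j).re : ℂ)) :
    (chartLift j w).2 j = (Real.exp (w.2 j).re : ℂ) := by
  simp only [chartLift, Prod.snd_add, Prod.smul_snd, Pi.add_apply, Pi.smul_apply,
    Pi.single_eq_same, Pi.zero_apply, smul_zero, add_zero]
  nth_rewrite 1 [hw]
  simp

theorem mem_nullTt_iff_im {v : Twistor n} :
    v ∈ nullTt n ↔ v ≠ 0 ∧ (star v.2 ⬝ᵥ v.1).im = 0 := by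
  refine and_congr_right fun _ => ?_
  have h : star v.1 ⬝ᵥ v.2 = star (star v.2 ⬝ᵥ v.1) := by
    rw [star_dotProduct]
  rw [h, mul_eq_zero, or_iff_right Complex.I_ne_zero, sub_eq_zero, eq_comm]
  exact Complex.conj_eq_iff_im

theorem im_dotProduct_shift (j : Fin n) (u z : Fin n → ℂ) (s t : ℝ) :
    (star (z + s • (Pi.single j 1 : Fin n → ℂ)) ⬝ᵥ
      (u + t • (Pi.single j Complex.I : Fin n → ℂ))).im =
      (star z ⬝ᵥ u).im + s * (u j).im + t * (z j).re + s * t := by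
  simp only [star_add, add_dotProduct, dotProduct_add, star_smul, smul_dotProduct,
    dotProduct_smul, Pi.star_single, dotProduct_single, single_dotProduct,
    Complex.add_im, Complex.smul_im]
  simp
  ring

theorem chartLift_mem (j : Fin n) {w : Twistor n} (h1 : w.1 j = ((w.1 j).re : ℂ))
    (h2 : w.2 j = ((w.2 j).re : ℂ)) : chartLift j w ∈ nullTt n := by
  refine mem_nullTt_iff_im.2 ⟨fun h0 => ?_, ?_⟩
  · have h := chartLift_snd_apply j w h2
    rw [h0] at h
    exact (Real.exp_pos (w.2 j).re).ne' (Complex.ofReal_eq_zero.1 h.symm)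
  · have him : (w.1 j).im = 0 := by rw [h1]; rfl
    have h := im_dotProduct_shift j w.1 w.2 (Real.exp (w.2 j).re - (w.2 j).re)
      (-(Real.exp (-(w.2 j).re) * (star w.2 ⬝ᵥ w.1).im))
    simp only [chartLift, Prod.fst_add, Prod.snd_add, Prod.smul_fst, Prod.smul_snd, smul_zero,
      add_zero]
    have he : Real.exp (w.2 j).re * Real.exp (-(w.2 j).re) = 1 := by
      rw [← Real.exp_add]; simp
    rw [h, him]
    linear_combination (-(star w.2 ⬝ᵥ w.1).im) * he

theorem chartLift_fst_im (j : Fin n) {w : Twistor n} (h1 : w.1 j = ((w.1 j).re : ℂ)) :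
    ((chartLift j w).1 j).im = -(Real.exp (-(w.2 j).re) * (star w.2 ⬝ᵥ w.1).im) := by
  simp only [chartLift, Prod.fst_add, Prod.smul_fst, Pi.add_apply, Pi.smul_apply,
    Pi.single_eq_same, smul_zero, add_zero]
  rw [h1]
  simp [-Complex.ofReal_exp]

theorem chartCoord_chartLift (j : Fin n) {w : Twistor n} (h1 : w.1 j = ((w.1 j).re : ℂ))
    (h2 : w.2 j = ((w.2 j).re : ℂ)) : chartCoord j (chartLift j w) = w := by
  unfold chartCoord
  rw [chartLift_fst_im j h1, chartLift_snd_apply j w h2, Complex.ofReal_re, Real.log_exp]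
  unfold chartLift
  module

theorem chartCoord_real (j : Fin n) {w : Twistor n} (h2 : w.2 j = ((w.2 j).re : ℂ)) :
    ((chartCoord j w).1 j).im = 0 ∧ (chartCoord j w).2 j = (Real.log (w.2 j).re : ℂ) := by
  constructor
  · simp [chartCoord]
  · simp only [chartCoord, Prod.snd_add, Prod.smul_snd, Pi.add_apply, Pi.smul_apply,
      Pi.single_eq_same, Pi.zero_apply, smul_zero, add_zero]
    nth_rewrite 1 [h2]
    simp

theorem chartLift_chartCoord (j : Fin n) {w : Twistor n} (hw : (star w.2 ⬝ᵥ w.1).im = 0)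
    (h2 : w.2 j = ((w.2 j).re : ℂ)) (hpos : 0 < (w.2 j).re) :
    chartLift j (chartCoord j w) = w := by
  obtain ⟨-, h4⟩ := chartCoord_real j h2
  unfold chartLift
  rw [h4, Complex.ofReal_re, Real.exp_neg, Real.exp_log hpos]
  have h := im_dotProduct_shift j w.1 w.2 (Real.log (w.2 j).re - (w.2 j).re) (-(w.1 j).im)
  have h5 : (star (chartCoord j w).2 ⬝ᵥ (chartCoord j w).1).im = -(w.2 j).re * (w.1 j).im := by
    simp only [chartCoord, Prod.fst_add, Prod.snd_add, Prod.smul_fst, Prod.smul_snd, smul_zero,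
      add_zero]
    rw [h, hw]
    ring
  rw [h5, show -((w.2 j).re⁻¹ * (-(w.2 j).re * (w.1 j).im)) = (w.1 j).im by
    field_simp]
  unfold chartCoord
  module

/-- The normalized null twistor over a point of the orbit. -/
noncomputable def normalLift (j : Fin n) (M : Mat2 n) : Twistor n :=
  -- If `M` is the momentum of `w = (υ, ζ)`, the column with index `inl j` is `w` times the
  -- conjugate of `ζ_j`, and the entry under the root is `|ζ_j|²`.
  (Real.sqrt (M (Sum.inr j) (Sum.inl j)).re)⁻¹ •
    ((fun i => M (Sum.inl i) (Sum.inl j), fun i => M (Sum.inr i) (Sum.inl j)) : Twistor n)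

theorem contDiffAt_normalLift (j : Fin n) {M : Mat2 n}
    (hM : 0 < (M (Sum.inr j) (Sum.inl j)).re) : ContDiffAt ℝ ∞ (normalLift j) M := by
  have h0 : ∀ i k, ContDiff ℝ ∞ fun M : Mat2 n => M i k := fun i k =>
    contDiff_matrix_iff.1 contDiff_id i k
  have h1 : ContDiffAt ℝ ∞ (fun M : Mat2 n => (M (Sum.inr j) (Sum.inl j)).re) M :=
    (contDiff_re (h0 _ _)).contDiffAt
  have h2 : ContDiff ℝ ∞ (fun M : Mat2 n =>
      ((fun i => M (Sum.inl i) (Sum.inl j), fun i => M (Sum.inr i) (Sum.inl j)) : Twistor n)) :=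
    (contDiff_pi.2 fun i => h0 _ _).prodMk (contDiff_pi.2 fun i => h0 _ _)
  exact ((h1.sqrt hM.ne').inv (Real.sqrt_ne_zero'.2 hM)).smul h2.contDiffAt

theorem JPMt_apply_inr_inl (w : Twistor n) (i k : Fin n) :
    JPMt w (Sum.inr i) (Sum.inl k) = w.2 i * star (w.2 k) := rfl

theorem JPMt_re_pos {j : Fin n} {w : Twistor n} (hj : w.2 j ≠ 0) :
    0 < (JPMt w (Sum.inr j) (Sum.inl j)).re := by
  rw [JPMt_apply_inr_inl]
  change 0 < (w.2 j * (starRingEnd ℂ) (w.2 j)).re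
  rw [Complex.mul_conj, Complex.ofReal_re]
  exact Complex.normSq_pos.2 hj

theorem normalLift_JPMt {j : Fin n} {w : Twistor n} :
    normalLift j (JPMt w) = (((‖w.2 j‖⁻¹ : ℝ) : ℂ) * star (w.2 j)) • w := by
  have h : Real.sqrt (JPMt w (Sum.inr j) (Sum.inl j)).re = ‖w.2 j‖ := by
    rw [JPMt_apply_inr_inl]
    change Real.sqrt (w.2 j * (starRingEnd ℂ) (w.2 j)).re = _
    rw [Complex.mul_conj, Complex.ofReal_re]
    rfl
  unfold normalLift
  rw [h]
  ext i
  · change (‖w.2 j‖⁻¹ : ℝ) • (w.1 i * star (w.2 j)) = _ * w.1 i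
    rw [Complex.real_smul]
    ring
  · change (‖w.2 j‖⁻¹ : ℝ) • (w.2 i * star (w.2 j)) = _ * w.2 i
    rw [Complex.real_smul]
    ring

theorem normalLift_JPMt_of_pos {j : Fin n} {w : Twistor n} {r : ℝ} (hr : 0 < r)
    (hw : w.2 j = (r : ℂ)) : normalLift j (JPMt w) = w := by
  have hr' : (r : ℂ) ≠ 0 := Complex.ofReal_ne_zero.2 hr.ne'
  rw [normalLift_JPMt, hw]
  have h : (((‖(r : ℂ)‖⁻¹ : ℝ) : ℂ) * star (r : ℂ)) = 1 := by
    rw [Complex.norm_real, Real.norm_of_nonneg hr.le, show star (r : ℂ) = r from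
      Complex.conj_ofReal r]
    push_cast
    exact inv_mul_cancel₀ hr'
  rw [h, one_smul]

theorem JPMt_phase {c : ℂ} (hc : star c * c = 1) (w : Twistor n) : JPMt (c • w) = JPMt w := by
  rw [JPMt_eq, JPMt_eq, col_smul, momentum_smul hc]

theorem dotProduct_phase {c : ℂ} (hc : star c * c = 1) (w : Twistor n) :
    star (c • w).2 ⬝ᵥ (c • w).1 = star w.2 ⬝ᵥ w.1 := by
  rw [Prod.smul_snd, Prod.smul_fst, star_smul, smul_dotProduct, dotProduct_smul, smul_smul, hc,
    one_smul]

/-- The image is open because it is where the matrix entry `|ζ_j|²` does not vanish. The inverse `π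
∘ chartCoord j ∘ normalLift j` is built from matrix entries and hence smooth. The data `f` and `ι`
are exposed for the computation of the form in the chart. -/
theorem exists_chart_ne_zero (hn : 1 ≤ n) (j : Fin n) :
    ∃ (f : E (2 * (2 * n - 1)) → nullTt n) (ι : E (2 * (2 * n - 1)) →L[ℝ] Twistor n),
      (∀ e, (f e : Twistor n) = chartLift j (ι e)) ∧ Function.Injective ι ∧
      (∀ w : Twistor n, (w.1 j).im = 0 → (w.2 j).im = 0 → ∃ e, ι e = w) ∧
      (∀ e, (ι e).1 j = (((ι e).1 j).re : ℂ) ∧ (ι e).2 j = (((ι e).2 j).re : ℂ)) ∧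
      IsChart (toNtOfTt hn ∘ f) ∧
      ∀ w : nullTt n, w.1.2 j ≠ 0 → toNtOfTt hn w ∈ range (toNtOfTt hn ∘ f) := by
  obtain ⟨ι, π, hreal, hπι, hιπ⟩ := exists_coordinates hn j
  let f : E (2 * (2 * n - 1)) → nullTt n := fun e =>
    ⟨chartLift j (ι e), chartLift_mem j (hreal e).1 (hreal e).2⟩
  have hf : IsPlot f := isPlot_subset_iff.2 ((contDiff_chartLift j).comp ι.contDiff)
  have hfj : ∀ e, ((f e : Twistor n).2 j) = (Real.exp ((ι e).2 j).re : ℂ) := fun e =>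
    chartLift_snd_apply j _ (hreal e).2
  have hinv : ∀ e, π (chartCoord j (normalLift j (JPMt (f e : Twistor n)))) = e := fun e => by
    rw [normalLift_JPMt_of_pos (Real.exp_pos _) (hfj e)]
    change π (chartCoord j (chartLift j (ι e))) = e
    rw [chartCoord_chartLift j (hreal e).1 (hreal e).2, hπι]
  have hfne : ∀ e, (f e : Twistor n).2 j ≠ 0 := fun e => by
    rw [hfj]; exact Complex.ofReal_ne_zero.2 (Real.exp_pos _).ne'
  have hrange : ∀ w : nullTt n, w.1.2 j ≠ 0 → toNtOfTt hn w ∈ range (toNtOfTt hn ∘ f) := by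
    intro w hw
    -- This is the phase that makes `ζ_j` positive.
    obtain ⟨c, hc⟩ : ∃ c : ℂ, c = ((‖w.1.2 j‖⁻¹ : ℝ) : ℂ) * star (w.1.2 j) := ⟨_, rfl⟩
    have hN : (‖w.1.2 j‖ : ℂ) ≠ 0 := Complex.ofReal_ne_zero.2 (norm_ne_zero_iff.2 hw)
    have hsq : star (w.1.2 j) * w.1.2 j = (‖w.1.2 j‖ : ℂ) * ‖w.1.2 j‖ := by
      rw [← sq]; exact Complex.conj_mul' _
    have hcj : (c • w.1).2 j = ((‖w.1.2 j‖ : ℝ) : ℂ) := by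
      change c * w.1.2 j = _
      rw [hc, mul_assoc, hsq]
      push_cast
      field_simp
    have hcc : star c * c = 1 := by
      have h : star c = ((‖w.1.2 j‖⁻¹ : ℝ) : ℂ) * w.1.2 j := by
        rw [hc, star_mul', star_star]
        exact congrArg (· * _) (Complex.conj_ofReal _)
      rw [h, hc, show ((‖w.1.2 j‖⁻¹ : ℝ) : ℂ) * w.1.2 j * (((‖w.1.2 j‖⁻¹ : ℝ) : ℂ) * star (w.1.2 j))
        = ((‖w.1.2 j‖⁻¹ : ℝ) : ℂ) * ((‖w.1.2 j‖⁻¹ : ℝ) : ℂ) * (star (w.1.2 j) * w.1.2 j) by ring, hsq]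
      push_cast
      field_simp
    have hre : ((c • w.1).2 j).re = ‖w.1.2 j‖ := by rw [hcj, Complex.ofReal_re]
    have hre' : (c • w.1).2 j = (((c • w.1).2 j).re : ℂ) := by rw [hre, hcj]
    obtain ⟨h3, h4⟩ := chartCoord_real j hre'
    refine ⟨π (chartCoord j (c • w.1)), Subtype.ext ?_⟩
    change JPMt (chartLift j (ι (π (chartCoord j (c • w.1))))) = JPMt w.1
    rw [hιπ _ h3 (by rw [h4, Complex.ofReal_im]), chartLift_chartCoord j ?_ hre' ?_,
      JPMt_phase hcc]
    · rw [dotProduct_phase hcc]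
      exact (mem_nullTt_iff_im.1 w.2).2
    · rw [hre]
      exact norm_pos_iff.2 hw
  refine ⟨f, ι, fun _ => rfl, Function.LeftInverse.injective hπι,
    fun w h1 h2 => ⟨π w, hιπ w h1 h2⟩, hreal, ⟨?_, ?_, ?_, ?_⟩, hrange⟩
  · exact dSmooth_toNtOfTt hn _ f hf
  · intro e e' h
    have h' : JPMt (f e : Twistor n) = JPMt (f e' : Twistor n) := congrArg Subtype.val h
    exact (hinv e).symm.trans (by rw [h']; exact hinv e')
  · refine isOpen_iff_preimages_plots.2 fun m p hp => ?_
    refine isOpen_iff_mem_nhds.2 ?_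
    rintro x ⟨e, he⟩
    have hp' : Continuous fun x => (p x : Mat2 n) (Sum.inr j) (Sum.inl j) :=
      (contDiff_matrix_iff.1 (isPlot_subset_iff.1 hp) _ _).continuous
    have hx : (p x : Mat2 n) (Sum.inr j) (Sum.inl j) ≠ 0 := by
      rw [← he]
      exact mul_ne_zero (hfne e) (star_ne_zero.2 (hfne e))
    filter_upwards [hp'.continuousAt.eventually_ne hx] with y hy
    obtain ⟨w, hw, hwM⟩ := (mem_orbitNt_iff hn).1 (p y).2
    rw [← hwM, JPMt_apply_inr_inl] at hy
    have h := hrange ⟨w, hw⟩ (left_ne_zero_of_mul hy)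
    rwa [show toNtOfTt hn ⟨w, hw⟩ = p y from Subtype.ext hwM] at h
  · intro m g hg
    have hg' : ContDiff ℝ ∞ fun x => JPMt (f (g x) : Twistor n) := isPlot_subset_iff.1 hg
    have h : g = fun x => π (chartCoord j (normalLift j (JPMt (f (g x) : Twistor n)))) :=
      funext fun x => (hinv (g x)).symm
    rw [h]
    refine π.contDiff.comp (contDiff_iff_contDiffAt.2 fun x => ?_)
    have h1 : ContDiffAt ℝ ∞ (fun x => normalLift j (JPMt (f (g x) : Twistor n))) x :=
      ContDiffAt.comp (g := normalLift j) x (contDiffAt_normalLift j (JPMt_re_pos (hfne (g x))))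
        hg'.contDiffAt
    refine ContDiffAt.comp (g := chartCoord j) x (contDiffAt_chartCoord ?_) h1
    rw [normalLift_JPMt_of_pos (Real.exp_pos _) (hfj _), hfj, Complex.ofReal_re]
    exact (Real.exp_pos _).ne'

/-! ### The symplectic manifold `𝒩̃₁₀` -/

/-- The one-form is real bilinear in the base point and the tangent vector, so its exterior
derivative has constant coefficients. -/
theorem sysTt_form_pull {m : ℕ} (f : E m → nullTt n) (hf : IsPlot f) (x v w : E m) :
    (sysTt n).form.pull f hf x ![v, w] =
      gammaPMt (fderiv ℝ (fun y => (f y : Twistor n)) x v)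
        (fderiv ℝ (fun y => (f y : Twistor n)) x w) -
      gammaPMt (fderiv ℝ (fun y => (f y : Twistor n)) x w)
        (fderiv ℝ (fun y => (f y : Twistor n)) x v) := by
  have hlin : ∀ y a b : Twistor n, fderiv ℝ (fun v => gammaPMt v b) y a = gammaPMt a b := by
    intro y a b
    let T : Twistor n →ₗ[ℝ] ℝ :=
      { toFun := fun v => gammaPMt v b
        map_add' := fun v w => by
          simp only [gammaPMt, LinearMap.coe_mk, AddHom.coe_mk, Prod.fst_add, Prod.snd_add,
            star_add, add_dotProduct, ← Complex.add_re]
          congr 1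
          ring
        map_smul' := fun r v => by
          simp [gammaPMt, star_smul, smul_dotProduct]
          ring }
    change fderiv ℝ (LinearMap.toContinuousLinearMap T) y a = _
    rw [ContinuousLinearMap.fderiv]
    rfl
  change (dOneForm gammaPMt (f x : Twistor n)).compContinuousLinearMap _ ![v, w] = _
  rw [ContinuousAlternatingMap.compContinuousLinearMap_apply, matrix_two_comp,
    dOneForm_apply (contDiff_gammaPMt n), hlin, hlin]

/-- The coefficient `s` may stay unspecified: its direction `i e_j` in `υ` pairs only with the
imaginary part of the `j`-th component of `ζ`, which is zero for the coordinate vectors used. -/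
theorem fderiv_chartLift (j : Fin n) (w a : Twistor n) :
    ∃ s : ℝ, fderiv ℝ (chartLift j) w a = a +
      ((Real.exp (w.2 j).re - 1) * (a.2 j).re) • ((0, Pi.single j 1) : Twistor n) +
      s • ((Pi.single j Complex.I, 0) : Twistor n) := by
  let X : Twistor n →L[ℝ] ℝ := Complex.reCLM.comp
    ((ContinuousLinearMap.proj (R := ℝ) (φ := fun _ : Fin n => ℂ) j).comp
      (ContinuousLinearMap.snd ℝ _ _))
  have hX : HasFDerivAt (fun w : Twistor n => (w.2 j).re) X w := X.hasFDerivAt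
  have h2 : ContDiff ℝ ∞ fun w : Twistor n =>
      (-(Real.exp (-(w.2 j).re) * (star w.2 ⬝ᵥ w.1).im)) := by
    have h3 : ContDiff ℝ ∞ fun w : Twistor n => (w.2 j).re :=
      contDiff_re (contDiff_pi.1 contDiff_snd j)
    have h4 : ContDiff ℝ ∞ fun w : Twistor n => (star w.2 ⬝ᵥ w.1).im :=
      Complex.imCLM.contDiff.comp (contDiff_star_dotProduct contDiff_snd contDiff_fst)
    fun_prop
  have h := ((hasFDerivAt_id (𝕜 := ℝ) w).add ((hX.exp.sub hX).smul_const
    ((0, Pi.single j 1) : Twistor n))).add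
      (((h2.differentiable (by simp) w).hasFDerivAt).smul_const
        ((Pi.single j Complex.I, 0) : Twistor n))
  refine ⟨fderiv ℝ (fun w : Twistor n => -(Real.exp (-(w.2 j).re) * (star w.2 ⬝ᵥ w.1).im)) w a,
    (DFunLike.congr_fun (HasFDerivAt.fderiv (f := chartLift j) h) a).trans ?_⟩
  change a + (Real.exp (w.2 j).re * (a.2 j).re - (a.2 j).re) • ((0, Pi.single j 1) : Twistor n) +
    fderiv ℝ (fun w : Twistor n => -(Real.exp (-(w.2 j).re) * (star w.2 ⬝ᵥ w.1).im)) w a •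
      ((Pi.single j Complex.I, 0) : Twistor n) = _
  rw [sub_mul, one_mul]

theorem gammaPMt_shift (j : Fin n) (a b : Twistor n) (α β s t : ℝ) :
    gammaPMt (a + α • ((0, Pi.single j 1) : Twistor n) + s • ((Pi.single j Complex.I, 0) : Twistor n))
      (b + β • ((0, Pi.single j 1) : Twistor n) + t • ((Pi.single j Complex.I, 0) : Twistor n)) =
      gammaPMt a b + β * (a.1 j).re - α * (b.1 j).re + s * (b.2 j).im - t * (a.2 j).im := by
  have h : ∀ v w : Twistor n, gammaPMt v w = (star v.1 ⬝ᵥ w.2 - star v.2 ⬝ᵥ w.1).re :=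
    fun _ _ => rfl
  simp only [h, Prod.fst_add, Prod.snd_add, Prod.smul_fst, Prod.smul_snd, smul_zero, add_zero,
    star_add, add_dotProduct, dotProduct_add, star_smul, smul_dotProduct,
    dotProduct_smul, Pi.star_single, dotProduct_single, single_dotProduct]
  simp
  ring

theorem re_star_dotProduct_self (u : Fin n → ℂ) :
    (star u ⬝ᵥ u).re = ∑ k, Complex.normSq (u k) := by
  simp only [dotProduct, Complex.re_sum]
  refine Finset.sum_congr rfl fun k _ => ?_
  change ((starRingEnd ℂ) (u k) * u k).re = _
  rw [mul_comm, Complex.mul_conj, Complex.ofReal_re]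

theorem eq_zero_of_re_star_dotProduct {u : Fin n → ℂ} (h : (star u ⬝ᵥ u).re = 0) : u = 0 := by
  rw [re_star_dotProduct_self, Finset.sum_eq_zero_iff_of_nonneg fun k _ => Complex.normSq_nonneg _]
    at h
  exact funext fun k => Complex.normSq_eq_zero.1 (h k (Finset.mem_univ _))

theorem sq_re_le (u : Fin n → ℂ) (j : Fin n) : (u j).re * (u j).re ≤ (star u ⬝ᵥ u).re := by
  rw [re_star_dotProduct_self]
  refine le_trans ?_ (Finset.single_le_sum (f := fun k => Complex.normSq (u k))
    (fun k _ => Complex.normSq_nonneg _) (Finset.mem_univ j))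
  rw [Complex.normSq_apply]
  nlinarith [mul_self_nonneg (u j).im]

/-- Paired with the rotated vector, the form gives twice a sum of squares of the components of `a`,
in which the two `j`-th components carry the weight `exp (z_j) > 0` and all others the weight one.
Such a sum vanishes only for `a = 0`. -/
theorem eq_zero_of_chartLift {j : Fin n} {w a : Twistor n} (h1 : (a.1 j).im = 0)
    (h2 : (a.2 j).im = 0)
    (h : gammaPMt (fderiv ℝ (chartLift j) w a) (fderiv ℝ (chartLift j) w (-a.2, a.1)) -
      gammaPMt (fderiv ℝ (chartLift j) w (-a.2, a.1)) (fderiv ℝ (chartLift j) w a) = 0) :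
    a = 0 := by
  obtain ⟨s, hs⟩ := fderiv_chartLift j w a
  obtain ⟨t, ht⟩ := fderiv_chartLift j w (-a.2, a.1)
  rw [hs, ht, gammaPMt_shift, gammaPMt_shift] at h
  have e1 : gammaPMt a (-a.2, a.1) = (star a.1 ⬝ᵥ a.1).re + (star a.2 ⬝ᵥ a.2).re := by
    change (star a.1 ⬝ᵥ a.1 - star a.2 ⬝ᵥ (-a.2)).re = _
    rw [dotProduct_neg, sub_neg_eq_add, Complex.add_re]
  have e2 : gammaPMt (-a.2, a.1) a = -((star a.1 ⬝ᵥ a.1).re + (star a.2 ⬝ᵥ a.2).re) := by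
    change (star (-a.2) ⬝ᵥ a.2 - star a.1 ⬝ᵥ a.1).re = _
    rw [star_neg, neg_dotProduct, Complex.sub_re, Complex.neg_re]
    ring
  rw [e1, e2] at h
  simp only [Pi.neg_apply, Complex.neg_re, h1, h2] at h
  have h3 := sq_re_le a.1 j
  have h4 := sq_re_le a.2 j
  have he := Real.exp_pos (w.2 j).re
  have h5 : (star a.1 ⬝ᵥ a.1).re + (star a.2 ⬝ᵥ a.2).re +
      (Real.exp (w.2 j).re - 1) * ((a.1 j).re * (a.1 j).re + (a.2 j).re * (a.2 j).re) = 0 := by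
    linarith
  have h6 : Real.exp (w.2 j).re * ((a.1 j).re * (a.1 j).re + (a.2 j).re * (a.2 j).re) ≤ 0 := by
    linarith
  have h7 : (a.1 j).re * (a.1 j).re + (a.2 j).re * (a.2 j).re ≤ 0 :=
    nonpos_of_mul_nonpos_right h6 he
  have h8 : (a.1 j).re * (a.1 j).re + (a.2 j).re * (a.2 j).re = 0 :=
    le_antisymm h7 (add_nonneg (mul_self_nonneg _) (mul_self_nonneg _))
  rw [h8, mul_zero, add_zero] at h5
  have h9 : 0 ≤ (star a.1 ⬝ᵥ a.1).re := (mul_self_nonneg _).trans h3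
  have h10 : 0 ≤ (star a.2 ⬝ᵥ a.2).re := (mul_self_nonneg _).trans h4
  exact Prod.ext (eq_zero_of_re_star_dotProduct (by linarith))
    (eq_zero_of_re_star_dotProduct (by linarith))

/-- The involution of the orbit induced by `(υ, ζ) ↦ (ζ, -υ)`. -/
noncomputable def swapNt (hn : 1 ≤ n) (M : orbitNt n 1 0) : orbitNt n 1 0 :=
  ⟨phiA n * M * phiA n, by
    obtain ⟨w, hw, hM⟩ := (mem_orbitNt_iff hn).1 M.2
    -- Multiplication of `w = (υ, ζ)` by `φ_a` gives `-i (ζ, -υ)`, and the momentum does not see the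
    -- phase `-i`.
    refine (mem_orbitNt_iff hn).2 ⟨(w.2, -w.1), ?_, ?_⟩
    · refine mem_nullTt_iff_im.2 ⟨fun h => hw.1 (Prod.ext (neg_eq_zero.1 (congrArg Prod.snd h))
        (congrArg Prod.fst h)), ?_⟩
      have h := (mem_nullTt_iff_im.1 hw).2
      change (star (-w.1) ⬝ᵥ w.2).im = 0
      rw [star_neg, neg_dotProduct, star_dotProduct, Complex.neg_im]
      simpa using h
    · rw [← hM]
      simp only [JPMt, phiA, Matrix.smul_mul, Matrix.mul_smul, fromBlocks_multiply, smul_smul,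
        Complex.I_mul_I]
      simp [fromBlocks_neg, vecMulVec_neg, neg_vecMulVec]⟩

theorem swapNt_swapNt (hn : 1 ≤ n) (M : orbitNt n 1 0) : swapNt hn (swapNt hn M) = M := by
  refine Subtype.ext ?_
  change phiA n * (phiA n * M * phiA n) * phiA n = M
  rw [Matrix.mul_assoc, Matrix.mul_assoc, phiA_mul_phiA, Matrix.mul_one, ← Matrix.mul_assoc,
    phiA_mul_phiA, Matrix.one_mul]

theorem contDiff_mul_mul (A B : Mat2 n) : ContDiff ℝ ∞ fun M : Mat2 n => A * M * B := by
  fun_prop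

theorem dSmooth_swapNt (hn : 1 ≤ n) : DSmooth (swapNt hn) :=
  dSmooth_subset (fun _ => (contDiff_mul_mul _ _).contDiffAt) fun _ => rfl

theorem isOpenEmb_swapNt (hn : 1 ≤ n) : IsOpenEmb (swapNt hn) :=
  .of_inverse (dSmooth_swapNt hn) (dSmooth_swapNt hn) (swapNt_swapNt hn) (swapNt_swapNt hn)

theorem fderiv_mul_mul (A B : Mat2 n) {m : ℕ} {p : E m → Mat2 n} (hp : ContDiff ℝ ∞ p)
    (x v : E m) : fderiv ℝ (fun y => A * p y * B) x v = A * fderiv ℝ p x v * B := by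
  have hp' := hp.differentiable (by simp) x
  rw [fderiv_matMul (differentiableAt_matMul (differentiableAt_const A) hp')
    (differentiableAt_const B), fderiv_matMul (differentiableAt_const A) hp', fderiv_fun_const,
    fderiv_fun_const]
  simp

/-- Since `φ_a² = 1`, conjugation by `φ_a` leaves both traces in the potential unchanged. This
carries nondegeneracy over to the charts at points with `ζ = 0`. -/
theorem kirillovForm_swap (hn : 1 ≤ n) :
    (kirillovForm hn).pullback (dSmooth_swapNt hn) = kirillovForm hn := by
  refine DForm.exact_pullback_exact _ _ _ fun {m} p hp x v => ?_
  have hp' : ContDiff ℝ ∞ fun y => (p y : Mat2 n) := hp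
  change theta (phiA n) (phiA n * p x * phiA n)
    (fderiv ℝ (fun y => phiA n * (p y : Mat2 n) * phiA n) x v) = _
  rw [fderiv_mul_mul _ _ hp', theta_apply, theta_apply]
  have h : ∀ A : Mat2 n, phiA n * (phiA n * A) = A := fun A => by
    rw [← Matrix.mul_assoc, phiA_mul_phiA, Matrix.one_mul]
  congr 3
  · simp only [Matrix.mul_assoc, h, phiA_mul_phiA, Matrix.mul_one]
    rw [trace_mul_comm, Matrix.mul_assoc]
    rfl
  · simp only [Matrix.mul_assoc, phiA_mul_phiA, Matrix.mul_one]
    rw [trace_mul_comm]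

theorem continuous_coe_dTopology {V : Type*} [NormedAddCommGroup V] [NormedSpace ℝ V] (X : Set V) :
    @Continuous X V DiffeologicalSpace.dTopology _ Subtype.val := by
  refine (@continuous_def _ _ (_) (_) _).2 fun U hU => isOpen_iff_preimages_plots.2
    fun m p hp => ?_
  exact hU.preimage (isPlot_subset_iff.1 hp).continuous

/-- The charts with `ζ_j ≠ 0` miss only the points with `ζ = 0`; there some `υ_j ≠ 0`, and the
involution exchanges the two components. -/
theorem exists_charts_orbitNt (hn : 1 ≤ n) :
    ∃ φ : Fin n ⊕ Fin n → E (2 * (2 * n - 1)) → orbitNt n 1 0,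
      (∀ i, ∃ h : IsChart (φ i), ∀ y v,
        (∀ w, (kirillovForm hn).pull (φ i) h.smooth y ![v, w] = 0) → v = 0) ∧
      ∀ M, ∃ i, M ∈ range (φ i) := by
  choose f ι hf hι hιs hreal hchart hrange using fun j => exists_chart_ne_zero hn j
  have hnd : ∀ j y v, (∀ w, (kirillovForm hn).pull (toNtOfTt hn ∘ f j) (hchart j).smooth y ![v, w] = 0) →
      v = 0 := by
    intro j y v hv
    have him : ∀ e, (((ι j e).1 j).im = 0) ∧ (((ι j e).2 j).im = 0) := fun e =>
      ⟨by rw [(hreal j e).1]; rfl, by rw [(hreal j e).2]; rfl⟩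
    -- The test vector is the rotation `(u, z) ↦ (-z, u)` of `v`, which preserves the reality
    -- conditions on the `j`-th components.
    obtain ⟨w, hw⟩ := hιs j (-(ι j v).2, (ι j v).1) (by simp [(him v).2]) (him v).1
    have hfp : IsPlot (f j) := isPlot_subset_iff.2 (by
      simp only [hf]
      exact (contDiff_chartLift j).comp (ι j).contDiff)
    have h1 := congrArg (fun α : DForm 2 (nullTt n) => α.pull (f j) hfp y ![v, w])
      (kirillovForm_pullback_Tt hn)
    have h2 : (sysTt n).form.pull (f j) hfp y ![v, w] = 0 := h1.symm.trans (hv w)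
    rw [sysTt_form_pull] at h2
    have hd : ∀ u, fderiv ℝ (fun y => (f j y : Twistor n)) y u =
        fderiv ℝ (chartLift j) (ι j y) (ι j u) := fun u => by
      rw [show (fun y => (f j y : Twistor n)) = chartLift j ∘ ι j from funext (hf j),
        fderiv_comp _ ((contDiff_chartLift j).differentiable (by simp) _)
          (ι j).differentiableAt, ContinuousLinearMap.fderiv]
      rfl
    rw [hd, hd, hw] at h2
    refine hι j ?_
    rw [map_zero]
    exact eq_zero_of_chartLift (him v).1 (him v).2 h2
  refine ⟨Sum.elim (fun j => toNtOfTt hn ∘ f j) (fun j => swapNt hn ∘ toNtOfTt hn ∘ f j), ?_, ?_⟩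
  · rintro (j | j)
    · exact ⟨hchart j, hnd j⟩
    · refine ⟨((isOpenEmb_swapNt hn).comp (hchart j).isOpenEmb).isChart, fun y v hv => ?_⟩
      refine hnd j y v fun w => ?_
      have h1 := congrArg (fun α : DForm 2 (orbitNt n 1 0) =>
        α.pull (toNtOfTt hn ∘ f j) (hchart j).smooth y ![v, w]) (kirillovForm_swap hn)
      exact h1.symm.trans (hv w)
  · intro M
    obtain ⟨w, hw, hM⟩ := (mem_orbitNt_iff hn).1 M.2
    have hM' : toNtOfTt hn ⟨w, hw⟩ = M := Subtype.ext hM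
    by_cases h : w.2 = 0
    · have h1 : w.1 ≠ 0 := fun h1 => hw.1 (Prod.ext h1 h)
      obtain ⟨j, hj⟩ := Function.ne_iff.1 h1
      obtain ⟨w', hw', hM₂⟩ := (mem_orbitNt_iff hn).1 (swapNt hn M).2
      have hj' : w'.2 j ≠ 0 := fun h0 => by
        have h2 : (swapNt hn M : Mat2 n) (Sum.inr j) (Sum.inl j) = w.1 j * star (w.1 j) := by
          change (phiA n * (M : Mat2 n) * phiA n) (Sum.inr j) (Sum.inl j) = _
          rw [← hM]
          simp only [JPMt, phiA, Matrix.smul_mul, Matrix.mul_smul, fromBlocks_multiply, smul_smul,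
            Complex.I_mul_I]
          simp [vecMulVec_apply]
        rw [← hM₂, JPMt_apply_inr_inl, h0, zero_mul] at h2
        exact mul_ne_zero hj (star_ne_zero.2 hj) h2.symm
      obtain ⟨e, he⟩ := hrange j ⟨w', hw'⟩ hj'
      refine ⟨Sum.inr j, e, ?_⟩
      change swapNt hn ((toNtOfTt hn ∘ f j) e) = M
      rw [he, show toNtOfTt hn ⟨w', hw'⟩ = swapNt hn M from Subtype.ext hM₂, swapNt_swapNt]
    · obtain ⟨j, hj⟩ := Function.ne_iff.1 h
      exact ⟨Sum.inl j, hM' ▸ hrange j ⟨w, hw⟩ hj⟩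

/-- The orbit `𝒩̃₁₀` with its Kirillov form and the Hamiltonian `L_𝔛̃₊₋`. -/
noncomputable def sysNt (hn : 1 ≤ n) : HamiltonianSystem (orbitNt n 1 0) (2 * n - 1) where
  form := kirillovForm hn
  ham M := linearHam (xPMt n) M
  ham_smooth := dSmooth_restrict (f := linearHam (xPMt n)) (by unfold linearHam; fun_prop)
  manifold := by
    obtain ⟨φ, hφ, hc⟩ := exists_charts_orbitNt hn
    refine ⟨?_, secondCountable_of_charts (fun i => (hφ i).1) hc, fun M => ?_⟩
    -- Hausdorffness is inherited from the matrix space, into which the inclusion is continuous for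
    -- the diffeological topology.
    · exact @T2Space.of_injective_continuous _ _ (_) _ _ _ Subtype.val_injective
        (continuous_coe_dTopology (orbitNt n 1 0))
    · obtain ⟨i, hi⟩ := hc M
      exact ⟨φ i, (hφ i).1, hi⟩
  closed := DForm.exact_isClosed _ _
  nondegenerate := DForm.isNondegenerate_of_exists fun M => by
    obtain ⟨φ, hφ, hc⟩ := exists_charts_orbitNt hn
    obtain ⟨i, hi⟩ := hc M
    obtain ⟨h1, h2⟩ := hφ i
    exact ⟨φ i, h1, hi, h2⟩

/-! ### Sections and fibres of the momentum map of null twistors -/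

/-! ### Smoothness of matrix-vector products and of block extraction -/

section Calculus

variable {D : Type*} [NormedAddCommGroup D] [NormedSpace ℝ D]

@[fun_prop]
theorem contDiff_mulVec {A : D → Mat n} {v : D → Fin n → ℂ} (hA : ContDiff ℝ ∞ A)
    (hv : ContDiff ℝ ∞ v) : ContDiff ℝ ∞ fun x => A x *ᵥ v x := by
  refine contDiff_pi.2 fun i => ?_
  simp only [mulVec, dotProduct]
  exact ContDiff.sum fun k _ => (contDiff_matrix_iff.1 hA i k).mul (contDiff_pi.1 hv k)

@[fun_prop]
theorem contDiff_toBlocks₁₁ {M : D → Mat2 n} (hM : ContDiff ℝ ∞ M) :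
    ContDiff ℝ ∞ fun x => (M x).toBlocks₁₁ :=
  contDiff_matrix_iff.2 fun _ _ => contDiff_matrix_iff.1 hM _ _

@[fun_prop]
theorem contDiff_toBlocks₁₂ {M : D → Mat2 n} (hM : ContDiff ℝ ∞ M) :
    ContDiff ℝ ∞ fun x => (M x).toBlocks₁₂ :=
  contDiff_matrix_iff.2 fun _ _ => contDiff_matrix_iff.1 hM _ _

@[fun_prop]
theorem contDiff_toBlocks₂₁ {M : D → Mat2 n} (hM : ContDiff ℝ ∞ M) :
    ContDiff ℝ ∞ fun x => (M x).toBlocks₂₁ :=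
  contDiff_matrix_iff.2 fun _ _ => contDiff_matrix_iff.1 hM _ _

@[fun_prop]
theorem contDiff_toBlocks₂₂ {M : D → Mat2 n} (hM : ContDiff ℝ ∞ M) :
    ContDiff ℝ ∞ fun x => (M x).toBlocks₂₂ :=
  contDiff_matrix_iff.2 fun _ _ => contDiff_matrix_iff.1 hM _ _

end Calculus

/-- The hermitian inner product `v⁺ w`. -/
noncomputable def inner₂ (v w : Twistor n) : ℂ := star v.1 ⬝ᵥ w.1 + star v.2 ⬝ᵥ w.2

/-- The action on `w` of the matrix `v v⁺`, where `M` is the momentum of `v`. -/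
noncomputable def outerAct (M : Mat2 n) (w : Twistor n) : Twistor n :=
  (-(M.toBlocks₁₂ *ᵥ w.1) + M.toBlocks₁₁ *ᵥ w.2, -(M.toBlocks₂₂ *ᵥ w.1) + M.toBlocks₂₁ *ᵥ w.2)

theorem outerAct_JPMt (v w : Twistor n) : outerAct (JPMt v) w = inner₂ v w • v := by
  simp only [outerAct, JPMt, toBlocks_fromBlocks₁₁, toBlocks_fromBlocks₁₂,
    toBlocks_fromBlocks₂₁, toBlocks_fromBlocks₂₂, neg_mulVec, vecMulVec_mulVec, neg_neg,
    op_smul_eq_smul, inner₂, ← add_smul]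
  rfl

theorem inner₂_smul (v w : Twistor n) (c : ℂ) : inner₂ v (c • w) = c * inner₂ v w := by
  simp only [inner₂, Prod.smul_fst, Prod.smul_snd, dotProduct_smul, smul_eq_mul, mul_add]

theorem star_inner₂ (v w : Twistor n) : star (inner₂ v w) = inner₂ w v := by
  rw [inner₂, star_add, ← star_dotProduct, ← star_dotProduct]
  rfl

theorem inner₂_self_pos {w : Twistor n} (hw : w ≠ 0) :
    ∃ r : ℝ, 0 < r ∧ inner₂ w w = (r : ℂ) := by
  have hre : 0 < (inner₂ w w).re := by
    have h1 : ∀ u : Fin n → ℂ, 0 ≤ (star u ⬝ᵥ u).re := fun u => by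
      rw [re_star_dotProduct_self]
      exact Finset.sum_nonneg fun k _ => Complex.normSq_nonneg _
    rw [inner₂, Complex.add_re]
    by_contra h
    have h2 := h1 w.1
    have h3 := h1 w.2
    exact hw (Prod.ext (eq_zero_of_re_star_dotProduct (by linarith))
      (eq_zero_of_re_star_dotProduct (by linarith)))
  exact ⟨_, hre, (Complex.conj_eq_iff_re.1 (star_inner₂ w w)).symm⟩

theorem inner₂_outerAct (v w : Twistor n) :
    inner₂ w (outerAct (JPMt v) w) = ((‖inner₂ v w‖ * ‖inner₂ v w‖ : ℝ) : ℂ) := by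
  rw [outerAct_JPMt, inner₂_smul, ← star_inner₂ v w]
  push_cast
  rw [← sq]
  exact Complex.mul_conj' _

theorem contDiff_inner₂_outerAct :
    ContDiff ℝ ∞ fun z : Twistor n × Mat2 n => (inner₂ z.1 (outerAct z.2 z.1)).re := by
  have h : ContDiff ℝ ∞ fun z : Twistor n × Mat2 n => outerAct z.2 z.1 := by
    unfold outerAct
    fun_prop
  exact contDiff_re ((contDiff_star_dotProduct contDiff_fst.fst h.fst).add
    (contDiff_star_dotProduct contDiff_fst.snd h.snd))

theorem phase_mem_nullTt {w : Twistor n} (hw : w ∈ nullTt n) {c : ℂ} (hc : star c * c = 1) :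
    c • w ∈ nullTt n := by
  have hc0 : c ≠ 0 := fun h => by simp [h] at hc
  refine mem_nullTt_iff_im.2 ⟨smul_ne_zero hc0 hw.1, ?_⟩
  rw [dotProduct_phase hc]
  exact (mem_nullTt_iff_im.1 hw).2

/-- The section projects the reference vector `w` to the line of `v`: `v v⁺ w` divided by `|v⁺ w|`
is `v` times a phase, and it depends on `v` only through `v v⁺`, hence only on the momentum. For `v
= w` the result is `w`. The domain is where `v⁺ w ≠ 0`. -/
theorem hasLocalSplitting_Tt (hn : 1 ≤ n) : HasLocalSplitting (toNtOfTt hn) := by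
  intro x₀
  refine ⟨{z | 0 < (inner₂ z.1 (outerAct z.2 z.1)).re},
    fun z => (Real.sqrt (inner₂ z.1 (outerAct z.2 z.1)).re)⁻¹ • outerAct z.2 z.1,
    isOpen_lt continuous_const contDiff_inner₂_outerAct.continuous, ?_, fun z hz => ?_, ?_, ?_⟩
  · obtain ⟨r, hr, hx⟩ := inner₂_self_pos x₀.2.1
    change 0 < (inner₂ x₀.1 (outerAct (JPMt x₀.1) x₀.1)).re
    rw [inner₂_outerAct, Complex.ofReal_re, hx]
    have : (r : ℂ) ≠ 0 := Complex.ofReal_ne_zero.2 hr.ne'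
    positivity
  · have h : ContDiff ℝ ∞ fun z : Twistor n × Mat2 n => outerAct z.2 z.1 := by
      unfold outerAct
      fun_prop
    exact ((((contDiff_inner₂_outerAct.contDiffAt (x := z)).sqrt (ne_of_gt hz)).inv
      (Real.sqrt_ne_zero'.2 hz)).smul h.contDiffAt).contDiffWithinAt
  · intro x y hxy
    obtain ⟨v, hv, hvy⟩ := (mem_orbitNt_iff hn).1 y.2
    have hpos : 0 < (inner₂ x.1 (outerAct (y : Mat2 n) x.1)).re := hxy
    simp only [← hvy, inner₂_outerAct, Complex.ofReal_re] at hpos ⊢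
    have hne : inner₂ v x.1 ≠ 0 := fun h => by simp [h] at hpos
    have hN : (‖inner₂ v x.1‖ : ℂ) ≠ 0 := Complex.ofReal_ne_zero.2 (norm_ne_zero_iff.2 hne)
    have hc : star (((‖inner₂ v x.1‖⁻¹ : ℝ) : ℂ) * inner₂ v x.1) *
        (((‖inner₂ v x.1‖⁻¹ : ℝ) : ℂ) * inner₂ v x.1) = 1 := by
      have h1 : star (inner₂ v x.1) * inner₂ v x.1 = (‖inner₂ v x.1‖ : ℂ) ^ 2 :=
        Complex.conj_mul' _
      have h2 : star ((‖inner₂ v x.1‖⁻¹ : ℝ) : ℂ) = ((‖inner₂ v x.1‖⁻¹ : ℝ) : ℂ) :=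
        Complex.conj_ofReal _
      rw [star_mul', h2]
      push_cast
      field_simp
      exact h1
    have hS : (Real.sqrt (‖inner₂ v x.1‖ * ‖inner₂ v x.1‖))⁻¹ • outerAct (JPMt v) x.1 =
        (((‖inner₂ v x.1‖⁻¹ : ℝ) : ℂ) * inner₂ v x.1) • v := by
      rw [Real.sqrt_mul_self (norm_nonneg _), outerAct_JPMt, ← smul_smul, Complex.coe_smul]
    simp only [hS]
    refine ⟨phase_mem_nullTt hv hc, Subtype.ext ?_⟩
    exact (JPMt_phase hc v).trans hvy
  · intro x hx
    change (Real.sqrt (inner₂ x.1 (outerAct (JPMt x.1) x.1)).re)⁻¹ • outerAct (JPMt x.1) x.1 = x.1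
    obtain ⟨r, hr, hxr⟩ := inner₂_self_pos x.2.1
    rw [inner₂_outerAct, Complex.ofReal_re, Real.sqrt_mul_self (norm_nonneg _), outerAct_JPMt, hxr,
      Complex.norm_real, Real.norm_of_nonneg hr.le, Complex.coe_smul, smul_smul,
      inv_mul_cancel₀ hr.ne', one_smul]

/-- Any two points in a fibre of `J` are joined by a smooth curve in this fibre. -/
def HasConnectedFibres {V W : Type*} [NormedAddCommGroup V] [NormedSpace ℝ V]
    [NormedAddCommGroup W] [NormedSpace ℝ W] {X : Set V} {Y : Set W} (J : X → Y) : Prop :=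
  ∀ x x', J x = J x' → ∃ c : ℝ → X, DSmooth c ∧ (∀ t, J (c t) = J x) ∧ c 0 = x ∧ c 1 = x'

theorem HasConnectedFibres.comp_equiv {V V' W : Type*} [NormedAddCommGroup V] [NormedSpace ℝ V]
    [NormedAddCommGroup W] [NormedSpace ℝ W] [NormedAddCommGroup V'] [NormedSpace ℝ V']
    {X : Set V} {Y : Set W} {X' : Set V'} {J : X → Y} (hJ : HasConnectedFibres J)
    (e : V' ≃L[ℝ] V) {F : X' → X} (hF : ∀ x, (F x : V) = e x)
    (hmem : ∀ v : V', e v ∈ X → v ∈ X') : HasConnectedFibres (J ∘ F) := by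
  intro x x' h
  obtain ⟨c, hc, hcJ, h0, h1⟩ := hJ (F x) (F x') h
  have hm : ∀ t, e.symm (c t) ∈ X' := fun t => hmem _ (by simp)
  have hFc : ∀ t, F ⟨e.symm (c t), hm t⟩ = c t := fun t => Subtype.ext (by simp [hF])
  refine ⟨fun t => ⟨e.symm (c t), hm t⟩,
    dSmooth_curve (e.symm.contDiff.comp (DSmooth.contDiff_curve hc)),
    fun t => by simp [hFc, hcJ], Subtype.ext ?_, Subtype.ext ?_⟩
  · simp [h0, hF]
  · simp [h1, hF]

/-- By `exists_phase` two points of a fibre differ by a phase, which is joined to `1` through its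
argument. -/
theorem hasConnectedFibres_Tt (hn : 1 ≤ n) : HasConnectedFibres (toNtOfTt hn) := by
  intro w w' h
  have h' : JPMt w.1 = JPMt w'.1 := congrArg Subtype.val h
  rw [JPMt_eq, JPMt_eq] at h'
  obtain ⟨c, hc, hw⟩ := exists_phase phiA_mul_phiA (col_eq_zero.not.2 w.2.1) h'
  rw [← col_smul] at hw
  have hw' := col_injective hw
  have hnorm : ‖c‖ = 1 := by
    have h1 : (‖c‖ : ℂ) ^ 2 = 1 := (Complex.conj_mul' c).symm.trans hc
    have h2 : ‖c‖ ^ 2 = 1 := by exact_mod_cast h1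
    nlinarith [norm_nonneg c]
  have hexp : ∀ t : ℝ, star (Complex.exp (t * (c.arg * Complex.I))) *
      Complex.exp (t * (c.arg * Complex.I)) = 1 := fun t => by
    change (starRingEnd ℂ) _ * _ = 1
    rw [← Complex.exp_conj, ← Complex.exp_add]
    simp
  refine ⟨fun t => ⟨Complex.exp (t * (c.arg * Complex.I)) • w.1, phase_mem_nullTt w.2 (hexp t)⟩,
    dSmooth_curve ?_, fun t => Subtype.ext (JPMt_phase (hexp t) _), Subtype.ext ?_, Subtype.ext ?_⟩
  · have h1 : ContDiff ℝ ∞ fun t : ℝ => Complex.exp (t * (c.arg * Complex.I)) :=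
      (Complex.ofRealCLM.contDiff.mul contDiff_const).cexp
    exact h1.smul contDiff_const
  · simp
  · have h1 := Complex.norm_mul_exp_arg_mul_I c
    rw [hnorm, Complex.ofReal_one, one_mul] at h1
    simp [h1, hw']

/-- The twistor with a given column. -/
def uncol (V : Matrix (Fin n ⊕ Fin n) Unit ℂ) : Twistor n :=
  (fun i => V (Sum.inl i) (), fun i => V (Sum.inr i) ())

theorem col_uncol (V : Matrix (Fin n ⊕ Fin n) Unit ℂ) : col (uncol V) = V := by
  ext i j; rcases i with i | i <;> rfl

theorem uncol_col (w : Twistor n) : uncol (col w) = w := rfl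

/-- The inverse Cayley transform of twistors. -/
noncomputable def cayleyEquiv (n : ℕ) : Twistor n ≃L[ℝ] Twistor n :=
  LinearEquiv.toContinuousLinearEquiv
    { toFun := fun v => uncol ((cayley n)ᴴ * col v)
      invFun := fun w => uncol (cayley n * col w)
      map_add' := fun v w => congrArg uncol ((mulColCLM (cayley n)ᴴ).map_add v w)
      map_smul' := fun r w => congrArg uncol ((mulColCLM (cayley n)ᴴ).map_smul r w)
      left_inv := fun v => by
        change uncol (cayley n * col (uncol ((cayley n)ᴴ * col v))) = v
        rw [col_uncol, ← Matrix.mul_assoc, cayley_mul_conjTranspose, Matrix.one_mul, uncol_col]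
      right_inv := fun v => by
        change uncol ((cayley n)ᴴ * col (uncol (cayley n * col v))) = v
        rw [col_uncol, ← Matrix.mul_assoc, cayley_conjTranspose_mul, Matrix.one_mul, uncol_col] }

theorem col_cayleyEquiv (v : Twistor n) : col (cayleyEquiv n v) = (cayley n)ᴴ * col v :=
  col_uncol _

theorem cayleyEquiv_mem {v : Twistor n} : cayleyEquiv n v ∈ nullTt n ↔ v ∈ nullT n := by
  refine (cayley_mem_nullT ?_).symm
  rw [col_cayleyEquiv, ← Matrix.mul_assoc, cayley_mul_conjTranspose, Matrix.one_mul]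

theorem JPMt_cayleyEquiv (v : Twistor n) :
    JPMt (cayleyEquiv n v) = (cayley n)ᴴ * JPM v * cayley n := by
  rw [JPMt_eq, col_cayleyEquiv, ← momentum_cayley, JPM_eq]

/-- The inverse Cayley transform of null twistors. -/
noncomputable def cayleyNull (v : nullT n) : nullTt n :=
  ⟨cayleyEquiv n v.1, cayleyEquiv_mem.2 v.2⟩

theorem toNtOfT_eq (hn : 1 ≤ n) : toNtOfT hn = toNtOfTt hn ∘ cayleyNull :=
  funext fun v => Subtype.ext (JPMt_cayleyEquiv v.1).symm

theorem hasLocalSplitting_T (hn : 1 ≤ n) : HasLocalSplitting (toNtOfT hn) := by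
  rw [toNtOfT_eq]
  exact (hasLocalSplitting_Tt hn).comp_equiv (cayleyEquiv n) (fun _ => rfl)
    fun v hv => cayleyEquiv_mem.1 hv

theorem hasConnectedFibres_T (hn : 1 ≤ n) : HasConnectedFibres (toNtOfT hn) := by
  rw [toNtOfT_eq]
  exact (hasConnectedFibres_Tt hn).comp_equiv (cayleyEquiv n) (fun _ => rfl)
    fun v hv => cayleyEquiv_mem.1 hv

/-! ### Sections and fibres of the momentum map of `𝒪̃₁₀` -/

/-- The momentum determines `X = ζ ζ⁺` and the vector `Yζ`, so two admissible `Y` are joined by a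
segment. -/
theorem hasConnectedFibres_Ot (hn : 1 ≤ n) : HasConnectedFibres (toNtOfOt hn) := by
  rintro ⟨⟨Y, X⟩, hq⟩ ⟨⟨Y', X'⟩, hq'⟩ h
  obtain ⟨hY, ζ, hζ, hX⟩ := exists_of_mem_orbitOt hq
  obtain ⟨hY', -⟩ := exists_of_mem_orbitOt hq'
  have h' : J0t (Y, X) = J0t (Y', X') := congrArg Subtype.val h
  simp only [J0t, fromBlocks_inj] at h'
  obtain ⟨h1, -, rfl, -⟩ := h'
  simp only at hX hY hY'
  subst hX
  have h2 : Y *ᵥ ζ = Y' *ᵥ ζ := by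
    have h3 := congrArg (fun A : Mat n => A *ᵥ ζ) h1
    simp only [mul_vecMulVec, vecMulVec_mulVec, op_smul_eq_smul] at h3
    exact smul_right_injective _ (fun h0 => hζ (dotProduct_star_self_eq_zero.1 h0)) h3
  have hYt : ∀ t : ℝ, (Y + t • (Y' - Y))ᴴ = Y + t • (Y' - Y) := fun t => by
    rw [conjTranspose_add, conjTranspose_smul, conjTranspose_sub, hY, hY']
    simp
  refine ⟨fun t => ⟨(Y + t • (Y' - Y), vecMulVec ζ (star ζ)), mem_orbitOt (hYt t) hζ⟩,
    dSmooth_curve ?_, fun t => Subtype.ext ?_, Subtype.ext ?_, Subtype.ext ?_⟩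
  · exact (contDiff_const.add (contDiff_id.smul contDiff_const)).prodMk contDiff_const
  · change J0t (Y + t • (Y' - Y), vecMulVec ζ (star ζ)) = J0t (Y, vecMulVec ζ (star ζ))
    rw [J0t_rankOne (hYt t), J0t_rankOne hY, add_mulVec, smul_mulVec, sub_mulVec, h2, sub_self,
      smul_zero, add_zero]
  · simp
  · simp

theorem star_dotProduct_self_eq_re (u : Fin n → ℂ) : star u ⬝ᵥ u = ((star u ⬝ᵥ u).re : ℂ) :=
  (Complex.conj_eq_iff_re.1 (star_dotProduct u u).symm).symm

/-- A hermitian matrix whose product with `X` is `P`, for `X` of rank one and trace `s⁻¹`. -/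
noncomputable def hermBase (s : ℝ) (P X : Mat n) : Mat n :=
  s • (P + Pᴴ) - (s * s * (trace P).re) • X

/-- The modification of `Y` on the range of `X` so that its product with `X` becomes `P`. -/
noncomputable def hermLift (s : ℝ) (P X Y : Mat n) : Mat n :=
  hermBase s P X + (1 - s • X) * (Y - hermBase s P X) * (1 - s • X)

theorem hermBase_conjTranspose (s : ℝ) {P X : Mat n} (hX : Xᴴ = X) :
    (hermBase s P X)ᴴ = hermBase s P X := by
  simp only [hermBase, conjTranspose_add, conjTranspose_sub, conjTranspose_smul,
    conjTranspose_conjTranspose, hX, star_trivial, add_comm Pᴴ P]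

theorem hermLift_conjTranspose (s : ℝ) {P X Y : Mat n} (hX : Xᴴ = X) (hY : Yᴴ = Y) :
    (hermLift s P X Y)ᴴ = hermLift s P X Y := by
  simp only [hermLift, conjTranspose_add, conjTranspose_sub, conjTranspose_mul, conjTranspose_smul,
    conjTranspose_one, hX, hY, star_trivial, hermBase_conjTranspose s hX, Matrix.mul_assoc]

/-- A hermitian matrix sending `ζ` to `υ` requires `ζ⁺ υ` to be real, which is the null condition.
The symmetrized term `s (P + P⁺)` sends `ζ` to `υ` plus a multiple of `ζ`, and the multiple of `X`
removes the excess. -/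
theorem hermBase_mulVec {s r : ℝ} {υ ζ : Fin n → ℂ} (hr : star ζ ⬝ᵥ ζ = (r : ℂ)) (hs : s * r = 1)
    (him : (star ζ ⬝ᵥ υ).im = 0) :
    hermBase s (vecMulVec υ (star ζ)) (vecMulVec ζ (star ζ)) *ᵥ ζ = υ := by
  obtain ⟨a, ha⟩ : ∃ a : ℝ, star ζ ⬝ᵥ υ = (a : ℂ) := ⟨(star ζ ⬝ᵥ υ).re, Complex.ext rfl him⟩
  have ha' : star υ ⬝ᵥ ζ = (a : ℂ) := by
    rw [star_dotProduct, ha]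
    exact Complex.conj_ofReal a
  have htr : (trace (vecMulVec υ (star ζ))).re = a := by
    rw [trace_vecMulVec, dotProduct_comm, ha, Complex.ofReal_re]
  rw [hermBase, htr, sub_mulVec, smul_mulVec, smul_mulVec, add_mulVec, conjTranspose_vecMulVec,
    star_star, vecMulVec_mulVec, vecMulVec_mulVec, vecMulVec_mulVec, hr, ha']
  simp only [op_smul_eq_smul, Complex.coe_smul, smul_add, smul_smul, hs, one_smul]
  rw [show s * s * a * r = s * a * (s * r) by ring, hs, mul_one, add_sub_cancel_right]

theorem hermLift_mulVec {s r : ℝ} {υ ζ : Fin n → ℂ} (hr : star ζ ⬝ᵥ ζ = (r : ℂ)) (hs : s * r = 1)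
    (him : (star ζ ⬝ᵥ υ).im = 0) (Y : Mat n) :
    hermLift s (vecMulVec υ (star ζ)) (vecMulVec ζ (star ζ)) Y *ᵥ ζ = υ := by
  have h0 : (1 - s • vecMulVec ζ (star ζ)) *ᵥ ζ = 0 := by
    rw [sub_mulVec, one_mulVec, smul_mulVec, vecMulVec_mulVec, hr, op_smul_eq_smul,
      Complex.coe_smul, smul_smul, hs, one_smul, sub_self]
  rw [hermLift, add_mulVec, hermBase_mulVec hr hs him, ← mulVec_mulVec, h0, mulVec_zero, add_zero]

/-- When `Y` already sends `ζ` to the right vector, the difference from the base matrix is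
annihilated by `X` on both sides, so compressing it to the orthogonal complement of `ζ` changes
nothing. -/
theorem hermLift_self {s r : ℝ} {Y : Mat n} (hY : Yᴴ = Y) {ζ : Fin n → ℂ}
    (hr : star ζ ⬝ᵥ ζ = (r : ℂ)) (hs : s * r = 1) :
    hermLift s (vecMulVec (Y *ᵥ ζ) (star ζ)) (vecMulVec ζ (star ζ)) Y = Y := by
  have him : (star ζ ⬝ᵥ Y *ᵥ ζ).im = 0 := by
    refine Complex.conj_eq_iff_im.1 ?_
    change star (star ζ ⬝ᵥ Y *ᵥ ζ) = _
    rw [← star_dotProduct, star_mulVec, hY, dotProduct_mulVec]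
  have hX : (vecMulVec ζ (star ζ))ᴴ = vecMulVec ζ (star ζ) := by
    rw [conjTranspose_vecMulVec, star_star]
  have h1 := hermBase_mulVec hr hs him
  have h2 := hermBase_conjTranspose s (P := vecMulVec (Y *ᵥ ζ) (star ζ)) hX
  unfold hermLift
  obtain ⟨B, hB⟩ : ∃ B, B = hermBase s (vecMulVec (Y *ᵥ ζ) (star ζ)) (vecMulVec ζ (star ζ)) :=
    ⟨_, rfl⟩
  rw [← hB] at h1 h2 ⊢
  have h3 : (Y - B) * vecMulVec ζ (star ζ) = 0 := by
    rw [mul_vecMulVec, sub_mulVec, h1, sub_self, zero_vecMulVec]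
  have h4 : vecMulVec ζ (star ζ) * (Y - B) = 0 := by
    have := congrArg conjTranspose h3
    rwa [conjTranspose_mul, conjTranspose_sub, hX, hY, h2, conjTranspose_zero] at this
  rw [Matrix.sub_mul, Matrix.one_mul, Matrix.smul_mul, h4, smul_zero, sub_zero, Matrix.mul_sub,
    Matrix.mul_one, Matrix.mul_smul, h3, smul_zero, sub_zero, add_sub_cancel]

/-- The blocks of the target supply `P = υ ζ⁺` and `X = ζ ζ⁺`. The section keeps the part of `Y`
acting on the orthogonal complement of `ζ`, and is defined where `Tr X = |ζ|²` does not vanish. -/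
theorem hasLocalSplitting_Ot (hn : 1 ≤ n) : HasLocalSplitting (toNtOfOt hn) := by
  intro x₀
  have ht : ContDiff ℝ ∞ fun z : (Mat n × Mat n) × Mat2 n => (trace z.2.toBlocks₂₁).re := by fun_prop
  refine ⟨{z | (trace z.2.toBlocks₂₁).re ≠ 0}, fun z =>
    (hermLift (trace z.2.toBlocks₂₁).re⁻¹ z.2.toBlocks₁₁ z.2.toBlocks₂₁ z.1.1, z.2.toBlocks₂₁),
    isOpen_ne_fun ht.continuous continuous_const, ?_, fun z hz => ?_, ?_, ?_⟩
  · obtain ⟨-, ζ, hζ, hX⟩ := exists_of_mem_orbitOt x₀.2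
    change (trace x₀.1.2).re ≠ 0
    rw [hX, trace_vecMulVec, dotProduct_comm]
    exact fun h => hζ (eq_zero_of_re_star_dotProduct h)
  · have h1 : ContDiffAt ℝ ∞ (fun z : (Mat n × Mat n) × Mat2 n => (trace z.2.toBlocks₂₁).re⁻¹) z :=
      ht.contDiffAt.inv hz
    have h2 : ContDiffAt ℝ ∞ (fun z : (Mat n × Mat n) × Mat2 n => z.2.toBlocks₁₁) z :=
      ContDiff.contDiffAt (by fun_prop)
    have h3 : ContDiffAt ℝ ∞ (fun z : (Mat n × Mat n) × Mat2 n => z.2.toBlocks₂₁) z :=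
      ContDiff.contDiffAt (by fun_prop)
    have h4 : ContDiffAt ℝ ∞ (fun z : (Mat n × Mat n) × Mat2 n => z.1.1) z :=
      ContDiff.contDiffAt (by fun_prop)
    refine ContDiffAt.contDiffWithinAt (ContDiffAt.prodMk ?_ h3)
    have h5 : ContDiffAt ℝ ∞ (fun z : (Mat n × Mat n) × Mat2 n =>
        hermBase (trace z.2.toBlocks₂₁).re⁻¹ z.2.toBlocks₁₁ z.2.toBlocks₂₁) z :=
      (h1.smul (h2.add (contDiffAt_conjTranspose h2))).sub
        (((h1.mul h1).mul (contDiffAt_re (contDiffAt_trace h2))).smul h3)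
    have h6 := contDiffAt_const (c := (1 : Mat n)).sub (h1.smul h3)
    exact h5.add (contDiffAt_matMul (contDiffAt_matMul h6 (h4.sub h5)) h6)
  · intro x y hxy
    obtain ⟨v, hv, hvy⟩ := (mem_orbitNt_iff hn).1 y.2
    obtain ⟨hv0, him⟩ := mem_nullTt_iff_im.1 hv
    obtain ⟨hY, -⟩ := exists_of_mem_orbitOt x.2
    have h1 : (y : Mat2 n).toBlocks₁₁ = vecMulVec v.1 (star v.2) := by rw [← hvy]; rfl
    have h2 : (y : Mat2 n).toBlocks₂₁ = vecMulVec v.2 (star v.2) := by rw [← hvy]; rfl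
    have hr : star v.2 ⬝ᵥ v.2 = (((trace (y : Mat2 n).toBlocks₂₁).re : ℝ) : ℂ) := by
      rw [h2, trace_vecMulVec, dotProduct_comm v.2]
      exact star_dotProduct_self_eq_re _
    have hs : (trace (y : Mat2 n).toBlocks₂₁).re⁻¹ * (trace (y : Mat2 n).toBlocks₂₁).re = 1 :=
      inv_mul_cancel₀ hxy
    have hζ : v.2 ≠ 0 := fun h0 => by
      rw [h0, dotProduct_zero] at hr
      exact hxy (by exact_mod_cast hr.symm)
    have h3 : (hermLift (trace (y : Mat2 n).toBlocks₂₁).re⁻¹ (y : Mat2 n).toBlocks₁₁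
        (y : Mat2 n).toBlocks₂₁ x.1.1) *ᵥ v.2 = v.1 := by
      rw [h1]
      nth_rewrite 2 [h2]
      exact hermLift_mulVec hr hs him _
    have h4 : (hermLift (trace (y : Mat2 n).toBlocks₂₁).re⁻¹ (y : Mat2 n).toBlocks₁₁
        (y : Mat2 n).toBlocks₂₁ x.1.1)ᴴ = _ := hermLift_conjTranspose _ (by
          rw [h2, conjTranspose_vecMulVec, star_star]) hY
    refine ⟨?_, Subtype.ext ?_⟩
    · change (hermLift (trace (y : Mat2 n).toBlocks₂₁).re⁻¹ (y : Mat2 n).toBlocks₁₁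
        (y : Mat2 n).toBlocks₂₁ x.1.1, (y : Mat2 n).toBlocks₂₁) ∈ orbitOt n
      have h5 := mem_orbitOt h4 hζ
      rwa [← h2] at h5
    · change J0t (hermLift (trace (y : Mat2 n).toBlocks₂₁).re⁻¹ (y : Mat2 n).toBlocks₁₁
        (y : Mat2 n).toBlocks₂₁ x.1.1, (y : Mat2 n).toBlocks₂₁) = (y : Mat2 n)
      nth_rewrite 3 [h2]
      rw [J0t_rankOne h4, h3, ← hvy]
  · intro x hx
    obtain ⟨hY, ζ, hζ, hX⟩ := exists_of_mem_orbitOt x.2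
    have hM : (toNtOfOt hn x : Mat2 n) = J0t x.1 := rfl
    have h1 : (J0t x.1).toBlocks₁₁ = vecMulVec (x.1.1 *ᵥ ζ) (star ζ) := by
      rw [← mul_vecMulVec, ← hX]; rfl
    have h2 : (J0t x.1).toBlocks₂₁ = x.1.2 := rfl
    have hr : star ζ ⬝ᵥ ζ = (((trace x.1.2).re : ℝ) : ℂ) := by
      rw [hX, trace_vecMulVec, dotProduct_comm ζ]
      exact star_dotProduct_self_eq_re _
    refine Prod.ext ?_ rfl
    change hermLift (trace x.1.2).re⁻¹ (J0t x.1).toBlocks₁₁ x.1.2 x.1.1 = x.1.1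
    have h3 := hermLift_self hY hr (inv_mul_cancel₀ hx)
    rwa [← h1, ← hX] at h3

/-! ### Sections and fibres of the momentum map of `𝒪₁₀` -/

theorem exists_mem_nullT (hn : 1 ≤ n) (y : orbitNt n 1 0) :
    ∃ v ∈ nullT n, (cayley n)ᴴ * JPM v * cayley n = y ∧
      cayley n * (y : Mat2 n) * (cayley n)ᴴ = JPM v := by
  obtain ⟨w, hw, hy⟩ := (mem_orbitNt_iff hn).1 y.2
  have hv : cayleyEquiv n ((cayleyEquiv n).symm w) = w := (cayleyEquiv n).apply_symm_apply w
  have h := JPMt_cayleyEquiv ((cayleyEquiv n).symm w)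
  rw [hv, hy] at h
  refine ⟨(cayleyEquiv n).symm w, cayleyEquiv_mem.1 (by rwa [hv]), h.symm, ?_⟩
  rw [h, ← Matrix.mul_assoc, ← Matrix.mul_assoc, cayley_mul_conjTranspose, Matrix.one_mul,
    Matrix.mul_assoc, cayley_mul_conjTranspose, Matrix.mul_one]

/-! ### Correcting a unitary matrix by two reflections -/

section Householder

/-- `ξ ξ⁺`, where `M` is the momentum of `(η, ξ)`. -/
noncomputable def outer₂₂ (M : Mat2 n) : Mat n := -Complex.I • M.toBlocks₂₂

/-- `(Zξ + η) (Zξ + η)⁺`, where `M` is the momentum of `(η, ξ)`. -/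
noncomputable def outerSum (Z : Mat n) (M : Mat2 n) : Mat n :=
  Z * outer₂₂ M * Zᴴ + Z * (Complex.I • M.toBlocks₂₁) + (-Complex.I • M.toBlocks₁₂) * Zᴴ +
    Complex.I • M.toBlocks₁₁

/-- `ξ⁺ ξ + η⁺ Z ξ`, where `M` is the momentum of `(η, ξ)`. -/
noncomputable def outerCoeff (Z : Mat n) (M : Mat2 n) : ℂ :=
  trace (outer₂₂ M) + trace (Z * (Complex.I • M.toBlocks₂₁))

/-- A modification of the unitary matrix `Z` which maps `ξ` to `η`, where `M` is the momentum of
`(η, ξ)`. -/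
noncomputable def unitaryLift (Z : Mat n) (M : Mat2 n) : Mat n :=
  (-1 + (outerCoeff Z M)⁻¹ • outerSum Z M) *
    ((-1 + (trace (outer₂₂ M) / 2)⁻¹ • (Z * outer₂₂ M * Zᴴ)) * Z)

theorem outer₂₂_JPM (v : Twistor n) : outer₂₂ (JPM v) = vecMulVec v.2 (star v.2) := by
  simp [outer₂₂, JPM, fromBlocks_smul, smul_smul]

theorem mul_vecMulVec_mul (Z : Mat n) (a : Fin n → ℂ) :
    Z * vecMulVec a (star a) * Zᴴ = vecMulVec (Z *ᵥ a) (star (Z *ᵥ a)) := by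
  rw [mul_vecMulVec, vecMulVec_mul, star_mulVec]

theorem outerSum_JPM (Z : Mat n) (v : Twistor n) :
    outerSum Z (JPM v) = vecMulVec (Z *ᵥ v.2 + v.1) (star (Z *ᵥ v.2 + v.1)) := by
  rw [outerSum, outer₂₂_JPM, mul_vecMulVec_mul]
  simp only [JPM, fromBlocks_smul, toBlocks_fromBlocks₁₁, toBlocks_fromBlocks₁₂,
    toBlocks_fromBlocks₂₁, smul_smul, smul_neg, Complex.I_mul_I, neg_mul, neg_smul, one_smul,
    neg_neg, mul_vecMulVec, vecMulVec_mul, ← star_mulVec]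
  rw [star_add, add_vecMulVec, vecMulVec_add, vecMulVec_add]
  abel

theorem outerCoeff_JPM (Z : Mat n) (v : Twistor n) :
    outerCoeff Z (JPM v) = star v.2 ⬝ᵥ v.2 + star v.1 ⬝ᵥ Z *ᵥ v.2 := by
  rw [outerCoeff, outer₂₂_JPM, trace_vecMulVec, dotProduct_comm]
  simp only [JPM, fromBlocks_smul, toBlocks_fromBlocks₂₁, smul_smul, smul_neg, Complex.I_mul_I,
    neg_smul, one_smul, neg_neg, mul_vecMulVec, trace_vecMulVec]
  rw [dotProduct_comm (Z *ᵥ v.2)]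

theorem householder_self {a : Fin n → ℂ} (ha : star a ⬝ᵥ a ≠ 0) :
    (-1 + (star a ⬝ᵥ a / 2)⁻¹ • vecMulVec a (star a))ᴴ *
      (-1 + (star a ⬝ᵥ a / 2)⁻¹ • vecMulVec a (star a)) = 1 := by
  refine householder_unitary (div_ne_zero ha two_ne_zero) (by
    rw [conjTranspose_vecMulVec, star_star]) ?_
  have h : star (star a ⬝ᵥ a / 2) = star a ⬝ᵥ a / 2 := by
    rw [star_dotProduct_self_eq_re]
    refine Complex.conj_eq_iff_im.2 ?_
    rw [Complex.div_ofNat_im, Complex.ofReal_im, zero_div]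
  rw [h, vecMulVec_mul_vecMulVec, vecMulVec_smul, add_halves]

/-- With `a = Zξ`, the right-hand reflection fixes `a` and the left-hand one sends `a` to `η`, which
has the same length because the twistor is null. -/
theorem unitaryLift_unitary {Z : Mat n} (hZ : Zᴴ * Z = 1) {v : Twistor n} (hv : v ∈ nullT n)
    (h2 : outerCoeff Z (JPM v) ≠ 0) :
    (unitaryLift Z (JPM v))ᴴ * unitaryLift Z (JPM v) = 1 ∧
      unitaryLift Z (JPM v) *ᵥ v.2 = v.1 := by
  obtain ⟨h0, h1⟩ := nullT_components hv
  have ha : star (Z *ᵥ v.2) ⬝ᵥ (Z *ᵥ v.2) = star v.2 ⬝ᵥ v.2 := unitary_smul hZ _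
  have hr : star v.2 ⬝ᵥ v.2 ≠ 0 := fun h => h0 (dotProduct_star_self_eq_zero.1 h)
  have hd : trace (outer₂₂ (JPM v)) = star (Z *ᵥ v.2) ⬝ᵥ (Z *ᵥ v.2) := by
    rw [outer₂₂_JPM, trace_vecMulVec, dotProduct_comm, ha]
  have hκ : outerCoeff Z (JPM v) =
      star (Z *ᵥ v.2) ⬝ᵥ (Z *ᵥ v.2) + star v.1 ⬝ᵥ (Z *ᵥ v.2) := by
    rw [outerCoeff_JPM, ha]
  have hH := householder_self (a := Z *ᵥ v.2) (by rwa [ha])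
  have hG := householder_unitary h2 (U := outerSum Z (JPM v))
    (by rw [outerSum_JPM, conjTranspose_vecMulVec, star_star])
    (by rw [outerSum_JPM, hκ]; exact vecMulVec_sq (ha.trans h1.symm))
  have hG2 : (-1 + (outerCoeff Z (JPM v))⁻¹ • outerSum Z (JPM v)) *ᵥ (Z *ᵥ v.2) = v.1 := by
    rw [outerSum_JPM, hκ]
    exact householder_mulVec (by rwa [← hκ])
  have hH2 : (-1 + (star (Z *ᵥ v.2) ⬝ᵥ (Z *ᵥ v.2) / 2)⁻¹ •
      vecMulVec (Z *ᵥ v.2) (star (Z *ᵥ v.2))) *ᵥ (Z *ᵥ v.2) = Z *ᵥ v.2 := by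
    rw [add_mulVec, neg_mulVec, one_mulVec, smul_mulVec, vecMulVec_mulVec, op_smul_eq_smul,
      smul_smul, ha, inv_div, div_mul_cancel₀ _ hr, two_smul]
    abel
  unfold unitaryLift
  rw [hd, outer₂₂_JPM, mul_vecMulVec_mul]
  constructor
  · rw [conjTranspose_mul, conjTranspose_mul]
    calc _ = Zᴴ * ((-1 + (star (Z *ᵥ v.2) ⬝ᵥ (Z *ᵥ v.2) / 2)⁻¹ •
          vecMulVec (Z *ᵥ v.2) (star (Z *ᵥ v.2)))ᴴ *
          ((-1 + (outerCoeff Z (JPM v))⁻¹ • outerSum Z (JPM v))ᴴ *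
          (-1 + (outerCoeff Z (JPM v))⁻¹ • outerSum Z (JPM v))) *
          (-1 + (star (Z *ᵥ v.2) ⬝ᵥ (Z *ᵥ v.2) / 2)⁻¹ •
          vecMulVec (Z *ᵥ v.2) (star (Z *ᵥ v.2)))) * Z := by simp only [Matrix.mul_assoc]
      _ = 1 := by rw [hG, Matrix.mul_one, hH, Matrix.mul_one, hZ]
  · rw [← mulVec_mulVec, ← mulVec_mulVec, hH2, hG2]

/-- For `η = Zξ` the two reflections coincide, and a reflection is its own inverse. The extra
reflection is there for this reason: one alone would not return `Z`. -/
theorem unitaryLift_self {Z : Mat n} (hZ : Zᴴ * Z = 1) {ξ : Fin n → ℂ} (hξ : ξ ≠ 0) :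
    unitaryLift Z (JPM (Z *ᵥ ξ, ξ)) = Z := by
  have ha : star (Z *ᵥ ξ) ⬝ᵥ (Z *ᵥ ξ) = star ξ ⬝ᵥ ξ := unitary_smul hZ _
  have hr : star ξ ⬝ᵥ ξ ≠ 0 := fun h => hξ (dotProduct_star_self_eq_zero.1 h)
  have hH := householder_self (a := Z *ᵥ ξ) (by rwa [ha])
  have hsym : (-1 + (star (Z *ᵥ ξ) ⬝ᵥ (Z *ᵥ ξ) / 2)⁻¹ • vecMulVec (Z *ᵥ ξ) (star (Z *ᵥ ξ)))ᴴ =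
      -1 + (star (Z *ᵥ ξ) ⬝ᵥ (Z *ᵥ ξ) / 2)⁻¹ • vecMulVec (Z *ᵥ ξ) (star (Z *ᵥ ξ)) := by
    rw [conjTranspose_add, conjTranspose_smul, conjTranspose_vecMulVec, star_star,
      star_dotProduct_self_eq_re]
    simp
  rw [hsym] at hH
  have h4 : vecMulVec (Z *ᵥ ξ + Z *ᵥ ξ) (star (Z *ᵥ ξ + Z *ᵥ ξ)) =
      (4 : ℂ) • vecMulVec (Z *ᵥ ξ) (star (Z *ᵥ ξ)) := by
    rw [star_add, add_vecMulVec, vecMulVec_add]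
    module
  have h5 : (star ξ ⬝ᵥ ξ + star ξ ⬝ᵥ ξ)⁻¹ * 4 = (star ξ ⬝ᵥ ξ / 2)⁻¹ := by
    rw [← two_mul]
    field_simp
    norm_num
  rw [unitaryLift, outerSum_JPM, outerCoeff_JPM, outer₂₂_JPM, mul_vecMulVec_mul]
  simp only
  rw [h4, ha, smul_smul, h5, trace_vecMulVec, dotProduct_comm ξ, ← Matrix.mul_assoc, ← ha, hH,
    Matrix.one_mul]

theorem contDiff_outer₂₂ : ContDiff ℝ ∞ (outer₂₂ (n := n)) := by
  unfold outer₂₂; fun_prop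

theorem contDiff_outerSum : ContDiff ℝ ∞ fun z : Mat n × Mat2 n => outerSum z.1 z.2 := by
  have := contDiff_outer₂₂ (n := n)
  unfold outerSum; fun_prop

theorem contDiff_outerCoeff : ContDiff ℝ ∞ fun z : Mat n × Mat2 n => outerCoeff z.1 z.2 := by
  have := contDiff_outer₂₂ (n := n)
  unfold outerCoeff; fun_prop

theorem contDiffAt_unitaryLift {z : Mat n × Mat2 n} (h1 : outerCoeff z.1 z.2 ≠ 0)
    (h2 : trace (outer₂₂ z.2) ≠ 0) :
    ContDiffAt ℝ ∞ (fun z : Mat n × Mat2 n => unitaryLift z.1 z.2) z := by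
  have h3 : ContDiff ℝ ∞ fun z : Mat n × Mat2 n => outer₂₂ z.2 := contDiff_outer₂₂.comp contDiff_snd
  have h4 : ContDiffAt ℝ ∞ (fun z : Mat n × Mat2 n => (outerCoeff z.1 z.2)⁻¹) z :=
    contDiff_outerCoeff.contDiffAt.inv h1
  have h5 : ContDiffAt ℝ ∞ (fun z : Mat n × Mat2 n => (trace (outer₂₂ z.2) / 2)⁻¹) z := by
    have h6 : ContDiff ℝ ∞ fun z : Mat n × Mat2 n => trace (outer₂₂ z.2) / 2 :=
      (contDiff_trace h3).div_const 2
    exact h6.contDiffAt.inv (div_ne_zero h2 two_ne_zero)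
  have h6 : ContDiffAt ℝ ∞ (fun z : Mat n × Mat2 n => z.1 * outer₂₂ z.2 * z.1ᴴ) z :=
    ContDiff.contDiffAt (by fun_prop)
  have h7 : ContDiffAt ℝ ∞ (fun z : Mat n × Mat2 n =>
      -1 + (outerCoeff z.1 z.2)⁻¹ • outerSum z.1 z.2) z :=
    contDiffAt_const.add (h4.smul contDiff_outerSum.contDiffAt)
  have h8 : ContDiffAt ℝ ∞ (fun z : Mat n × Mat2 n =>
      -1 + (trace (outer₂₂ z.2) / 2)⁻¹ • (z.1 * outer₂₂ z.2 * z.1ᴴ)) z :=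
    contDiffAt_const.add (h5.smul h6)
  exact contDiffAt_matMul h7 (contDiffAt_matMul h8 contDiffAt_fst)

end Householder

/-- Conjugation by the Cayley matrix. -/
noncomputable def cayleyConj (M : Mat2 n) : Mat2 n := cayley n * M * (cayley n)ᴴ

theorem contDiff_cayleyConj : ContDiff ℝ ∞ (cayleyConj (n := n)) := contDiff_mul_mul _ _

theorem cayleyConj_cancel (M : Mat2 n) : cayleyConj ((cayley n)ᴴ * M * cayley n) = M := by
  rw [cayleyConj, ← Matrix.mul_assoc, ← Matrix.mul_assoc, cayley_mul_conjTranspose, Matrix.one_mul,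
    Matrix.mul_assoc, cayley_mul_conjTranspose, Matrix.mul_one]

theorem hasLocalSplitting_O (hn : 1 ≤ n) : HasLocalSplitting (toNtOfO hn) := by
  intro x₀
  have hK : ContDiff ℝ ∞ fun z : (Mat n × Mat n) × Mat2 n => (z.1.1, cayleyConj z.2) :=
    contDiff_fst.fst.prodMk (contDiff_cayleyConj.comp contDiff_snd)
  have h1 : ContDiff ℝ ∞ fun z : (Mat n × Mat n) × Mat2 n => outerCoeff z.1.1 (cayleyConj z.2) := by
    have h3 := contDiff_cayleyConj (n := n)
    have h4 := contDiff_outer₂₂ (n := n)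
    unfold outerCoeff
    fun_prop
  have h2 : ContDiff ℝ ∞ fun z : (Mat n × Mat n) × Mat2 n => trace (outer₂₂ (cayleyConj z.2)) :=
    contDiff_trace (ContDiff.comp (g := outer₂₂) contDiff_outer₂₂ hK.snd)
  have hJ : ∀ x : orbitO n 1 0, cayleyConj (toNtOfO hn x : Mat2 n) = J0 x.1 := fun x =>
    cayleyConj_cancel (J0 x.1)
  -- The two denominators in `unitaryLift`; at the base point they are `2 |ξ|²` and, up to the
  -- factor `1/2`, `|ξ|²`.
  refine ⟨{z | outerCoeff z.1.1 (cayleyConj z.2) ≠ 0 ∧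
      trace (outer₂₂ (cayleyConj z.2)) ≠ 0}, fun z =>
    (unitaryLift z.1.1 (cayleyConj z.2),
      (cayleyConj z.2).toBlocks₂₂),
    (isOpen_ne_fun h1.continuous continuous_const).inter
      (isOpen_ne_fun h2.continuous continuous_const), ?_, fun z hz => ?_, ?_, ?_⟩
  · obtain ⟨hZ, ξ, hξ, hρ⟩ := (mem_orbitO_iff hn).1 x₀.2
    have hr : star ξ ⬝ᵥ ξ ≠ 0 := fun h => hξ (dotProduct_star_self_eq_zero.1 h)
    have h3 : J0 x₀.1 = JPM (x₀.1.1 *ᵥ ξ, ξ) := by rw [← J0_rankOne, ← hρ]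
    simp only [mem_ofPred_eq, hJ]
    rw [h3, outerCoeff_JPM, unitary_smul hZ, outer₂₂_JPM, trace_vecMulVec, dotProduct_comm ξ,
      ← two_mul]
    exact ⟨mul_ne_zero two_ne_zero hr, hr⟩
  · have h3 := ContDiffAt.comp (g := fun z : Mat n × Mat2 n => unitaryLift z.1 z.2) z
      (contDiffAt_unitaryLift (z := (z.1.1, cayleyConj z.2)) hz.1 hz.2)
      hK.contDiffAt
    have h4 : ContDiffAt ℝ ∞ (fun z : (Mat n × Mat n) × Mat2 n =>
        (cayleyConj z.2).toBlocks₂₂) z :=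
      (contDiff_toBlocks₂₂ hK.snd).contDiffAt
    exact ContDiffAt.contDiffWithinAt (h3.prodMk h4)
  · intro x y hxy
    obtain ⟨v, hv, hvy, hyv⟩ := exists_mem_nullT hn y
    obtain ⟨hZ, -⟩ := (mem_orbitO_iff hn).1 x.2
    have hyv' : cayleyConj (y : Mat2 n) = JPM v := hyv
    simp only [mem_ofPred_eq, hyv'] at hxy ⊢
    obtain ⟨h3, h4⟩ := unitaryLift_unitary hZ hv hxy.1
    have h5 : (JPM v).toBlocks₂₂ = Complex.I • vecMulVec v.2 (star v.2) := by
      simp [JPM, fromBlocks_smul]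
    simp only [h5]
    refine ⟨(mem_orbitO_iff hn).2 ⟨h3, v.2, (nullT_components hv).1, rfl⟩, Subtype.ext ?_⟩
    change (cayley n)ᴴ * J0 (unitaryLift x.1.1 (JPM v), Complex.I • vecMulVec v.2 (star v.2)) *
      cayley n = _
    rw [J0_rankOne, h4, hvy]
  · intro x hx
    obtain ⟨hZ, ξ, hξ, hρ⟩ := (mem_orbitO_iff hn).1 x.2
    have h3 : J0 x.1 = JPM (x.1.1 *ᵥ ξ, ξ) := by rw [← J0_rankOne, ← hρ]
    simp only [hJ]
    refine Prod.ext ?_ rfl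
    change unitaryLift x.1.1 (J0 x.1) = x.1.1
    rw [h3, unitaryLift_self hZ hξ]

/-! ### Connecting unitary matrices -/

theorem contDiff_det {D : Type*} [NormedAddCommGroup D] [NormedSpace ℝ D] {A : D → Mat n}
    (hA : ContDiff ℝ ∞ A) : ContDiff ℝ ∞ fun x => (A x).det := by
  simp only [det_apply]
  exact ContDiff.sum fun σ _ => (contDiff_prod fun i _ => contDiff_matrix_iff.1 hA _ _).const_smul _

/-- By Cramer's rule the entries are polynomials in the entries of `A` divided by the determinant.
-/
theorem contDiff_matInv {D : Type*} [NormedAddCommGroup D] [NormedSpace ℝ D] {A : D → Mat n}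
    (hA : ContDiff ℝ ∞ A) (h : ∀ x, (A x).det ≠ 0) : ContDiff ℝ ∞ fun x => (A x)⁻¹ := by
  have h1 : ContDiff ℝ ∞ fun x => (A x).adjugate := by
    refine contDiff_matrix_iff.2 fun i j => ?_
    simp only [adjugate_apply]
    refine contDiff_det (contDiff_matrix_iff.2 fun k l => ?_)
    by_cases hk : k = j
    · simp only [hk, updateRow_self]
      exact contDiff_const
    · simp only [updateRow_ne hk]
      exact contDiff_matrix_iff.1 hA k l
  simp only [inv_def, Ring.inverse_eq_inv']
  exact ((contDiff_det hA).inv h).smul h1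

/-- The numbers `(k + i) / (k - i)` are distinct for distinct real `k`, so infinitely many of them
avoid the finitely many eigenvalues of `W`. -/
theorem exists_cayley_parameter (W : Mat n) : ∃ k : ℝ,
    ((k + Complex.I) • (1 : Mat n) - (k - Complex.I) • W).det ≠ 0 := by
  have hd : ∀ k : ℝ, (k - Complex.I : ℂ) ≠ 0 := fun k h => by
    have := congrArg Complex.im h
    simp at this
  have hinj : Function.Injective fun k : ℝ => (k + Complex.I) / (k - Complex.I : ℂ) := by
    intro k l h
    have h1 := (div_eq_div_iff (hd k) (hd l)).1 h
    have h2 : (2 * Complex.I) * ((l : ℂ) - k) = 0 := by linear_combination h1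
    rcases mul_eq_zero.1 h2 with h3 | h3
    · simp at h3
    · exact_mod_cast (sub_eq_zero.1 h3).symm
  obtain ⟨k, hk⟩ := Infinite.exists_notMem_finset
    (W.charpoly.roots.toFinset.preimage _ hinj.injOn)
  refine ⟨k, fun h0 => hk ?_⟩
  rw [Finset.mem_preimage, Multiset.mem_toFinset, Polynomial.mem_roots W.charpoly_monic.ne_zero,
    Polynomial.IsRoot, eval_charpoly]
  have h1 : (k + Complex.I) • (1 : Mat n) - (k - Complex.I) • W =
      (k - Complex.I) • (scalar (Fin n) ((k + Complex.I) / (k - Complex.I)) - W) := by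
    rw [smul_sub, scalar_apply, ← smul_one_eq_diagonal, smul_smul, mul_div_cancel₀ _ (hd k)]
  rw [h1, det_smul] at h0
  exact (mul_eq_zero.1 h0).resolve_left (pow_ne_zero _ (hd k))

/-- The matrix `K + i` times its adjoint is `K² + 1`, which is positive definite. -/
theorem det_add_I_ne_zero {K : Mat n} (hK : Kᴴ = K) : (K + Complex.I • 1).det ≠ 0 := by
  have h1 : (K + Complex.I • 1)ᴴ * (K + Complex.I • 1) = Kᴴ * K + 1 := by
    rw [conjTranspose_add, conjTranspose_smul, conjTranspose_one, hK]
    simp [Matrix.add_mul, Matrix.mul_add, smul_smul]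
  have h2 : (Kᴴ * K + 1).PosDef := PosDef.posSemidef_add (posSemidef_conjTranspose_mul_self K) .one
  intro h0
  have h3 := congrArg det h1
  rw [det_mul, h0, mul_zero] at h3
  exact h2.det_pos.ne h3

/-- The stabilizer of `ξ` in the unitary group is connected. The Cayley transform normalized by `k ↦
1` writes `W` as `(c/d) (K + i)⁻¹ (K - i)` with `K` hermitian, and `Wξ = ξ` becomes `Kξ = kξ`. This
condition is affine in `K`. -/
theorem exists_unitary_path {W : Mat n} (hW : Wᴴ * W = 1) {ξ : Fin n → ℂ} (hξ : W *ᵥ ξ = ξ) :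
    ∃ c : ℝ → Mat n, ContDiff ℝ ∞ c ∧ (∀ t, (c t)ᴴ * c t = 1) ∧ (∀ t, c t *ᵥ ξ = ξ) ∧
      c 0 = 1 ∧ c 1 = W := by
  obtain ⟨k, hk⟩ := exists_cayley_parameter W
  obtain ⟨c, hc⟩ : ∃ c : ℂ, c = k + Complex.I := ⟨_, rfl⟩
  obtain ⟨d, hd⟩ : ∃ d : ℂ, d = k - Complex.I := ⟨_, rfl⟩
  have hcd : star c = d := by rw [hc, hd]; simp [sub_eq_add_neg]
  have hdc : star d = c := by rw [← hcd, star_star]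
  have hd0 : d ≠ 0 := fun h => by
    have := congrArg Complex.im (hd.symm.trans h)
    simp at this
  have hc0 : c ≠ 0 := fun h => hd0 (by rw [← hcd, h, star_zero])
  rw [← hc, ← hd] at hk
  obtain ⟨N, hN⟩ : ∃ N : Mat n, N = c • 1 - d • W := ⟨_, rfl⟩
  rw [← hN] at hk
  have hNu : IsUnit N.det := isUnit_iff_ne_zero.2 hk
  obtain ⟨K, hKN⟩ : ∃ K : Mat n, K * N = Complex.I • (c • 1 + d • W) :=
    ⟨Complex.I • (c • 1 + d • W) * N⁻¹, by
      rw [Matrix.mul_assoc, nonsing_inv_mul _ hNu, Matrix.mul_one]⟩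
  have hKH : Kᴴ = K := by
    have h1 : Nᴴ * Kᴴ * N = Nᴴ * K * N := by
      rw [← conjTranspose_mul, Matrix.mul_assoc, hKN, hN]
      simp only [conjTranspose_smul, conjTranspose_add, conjTranspose_sub, conjTranspose_one,
        hcd, hdc, Matrix.smul_mul, Matrix.mul_smul, Matrix.add_mul, Matrix.sub_mul, Matrix.mul_add,
        Matrix.mul_sub, hW, Matrix.one_mul, Matrix.mul_one, Complex.star_def, Complex.conj_I]
      module
    have hNu' : IsUnit (Nᴴ).det := by rw [det_conjTranspose]; exact hNu.star
    have h2 := congrArg (fun A => (Nᴴ)⁻¹ * (A * N⁻¹)) h1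
    simpa [Matrix.mul_assoc, mul_nonsing_inv _ hNu, nonsing_inv_mul_cancel_left _ _ hNu'] using h2
  have hKξ : K *ᵥ ξ = (k : ℂ) • ξ := by
    have h1 := congrArg (fun A => A *ᵥ ξ) hKN
    simp only [← mulVec_mulVec, hN, sub_mulVec, add_mulVec, smul_mulVec, one_mulVec, hξ] at h1
    rw [← sub_smul, mulVec_smul, ← add_smul, smul_smul] at h1
    have h2 : c - d = 2 * Complex.I := by rw [hc, hd]; ring
    have h3 : Complex.I * (c + d) = 2 * Complex.I * k := by rw [hc, hd]; ring
    rw [h2, h3] at h1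
    exact smul_right_injective (Fin n → ℂ) (mul_ne_zero two_ne_zero Complex.I_ne_zero)
      (h1.trans (mul_smul _ _ _))
  -- The segment from `k · 1`, whose transform is the identity, to `K`, whose transform is `W`; all
  -- its points are hermitian and have `ξ` as an eigenvector with eigenvalue `k`.
  let P : ℝ → Mat n := fun t => t • K + ((1 - t) * k) • 1
  have hPH : ∀ t, (P t)ᴴ = P t := fun t => by
    simp [P, conjTranspose_add, conjTranspose_smul, hKH]
  have hPξ : ∀ t, P t *ᵥ ξ = (k : ℂ) • ξ := fun t => by
    simp only [P]
    rw [add_mulVec, smul_mulVec, smul_mulVec, one_mulVec, hKξ]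
    module
  have hu : ∀ t, IsUnit (P t + Complex.I • 1).det := fun t =>
    isUnit_iff_ne_zero.2 (det_add_I_ne_zero (hPH t))
  have hPs : ContDiff ℝ ∞ P :=
    (contDiff_id.smul contDiff_const).add
      (((contDiff_const.sub contDiff_id).mul contDiff_const).smul contDiff_const)
  have hB : ∀ t, (P t + Complex.I • 1)ᴴ = P t - Complex.I • 1 := fun t => by
    rw [conjTranspose_add, hPH, conjTranspose_smul, conjTranspose_one]
    simp [sub_eq_add_neg]
  have hA : ∀ t, (P t - Complex.I • 1)ᴴ = P t + Complex.I • 1 := fun t => by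
    rw [← hB, conjTranspose_conjTranspose]
  have hu' : ∀ t, IsUnit (P t - Complex.I • 1).det := fun t => by
    rw [← hB, det_conjTranspose]; exact (hu t).star
  have hcomm : ∀ t, (P t - Complex.I • 1) * (P t + Complex.I • 1) =
      (P t + Complex.I • 1) * (P t - Complex.I • 1) := fun t => by
    simp only [Matrix.add_mul, Matrix.sub_mul, Matrix.mul_add, Matrix.mul_sub, Matrix.smul_mul,
      Matrix.mul_smul, Matrix.one_mul, Matrix.mul_one]
    module
  refine ⟨fun t => (c / d) • ((P t + Complex.I • 1)⁻¹ * (P t - Complex.I • 1)), ?_, ?_, ?_, ?_, ?_⟩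
  · have h1 : ContDiff ℝ ∞ fun t => P t + Complex.I • (1 : Mat n) := hPs.add contDiff_const
    have h2 : ContDiff ℝ ∞ fun t => P t - Complex.I • (1 : Mat n) := hPs.sub contDiff_const
    exact (contDiff_const (c := c / d)).smul
      (contDiff_matMul (contDiff_matInv h1 fun t => (hu t).ne_zero) h2)
  · intro t
    refine mul_eq_one_comm.1 ?_
    have h1 : c / d * star (c / d) = 1 := by
      rw [star_div₀, hcd, hdc]; field_simp
    rw [conjTranspose_smul, smul_mul_smul_comm, h1, one_smul, conjTranspose_mul,
      conjTranspose_nonsing_inv, hB, hA]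
    calc _ = (P t + Complex.I • 1)⁻¹ * ((P t - Complex.I • 1) * (P t + Complex.I • 1)) *
          (P t - Complex.I • 1)⁻¹ := by simp only [Matrix.mul_assoc]
      _ = 1 := by
        rw [hcomm, nonsing_inv_mul_cancel_left _ _ (hu t), mul_nonsing_inv _ (hu' t)]
  · intro t
    have h1 : (P t + Complex.I • 1) *ᵥ ξ = c • ξ := by
      rw [add_mulVec, hPξ, smul_mulVec, one_mulVec, ← add_smul, ← hc]
    have h2 : (P t - Complex.I • 1) *ᵥ ξ = d • ξ := by
      rw [sub_mulVec, hPξ, smul_mulVec, one_mulVec, ← sub_smul, ← hd]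
    have h3 : (P t + Complex.I • 1)⁻¹ *ᵥ ξ = c⁻¹ • ξ := by
      have h4 := congrArg (fun u => (P t + Complex.I • 1)⁻¹ *ᵥ u) h1
      simp only [mulVec_mulVec, nonsing_inv_mul _ (hu t), one_mulVec, mulVec_smul] at h4
      conv_rhs => rw [h4]
      rw [smul_smul, inv_mul_cancel₀ hc0, one_smul]
    rw [smul_mulVec, ← mulVec_mulVec, h2, mulVec_smul, h3, smul_smul, smul_smul]
    rw [show c / d * d * c⁻¹ = 1 by field_simp, one_smul]
  · have h1 : P 0 + Complex.I • 1 = c • 1 := by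
      simp only [P]; rw [hc]; module
    have h2 : P 0 - Complex.I • 1 = d • 1 := by
      simp only [P]; rw [hd]; module
    have h3 : (c • (1 : Mat n))⁻¹ = c⁻¹ • 1 := inv_eq_left_inv (by
      rw [smul_mul_smul_comm, inv_mul_cancel₀ hc0, one_smul, Matrix.one_mul])
    simp only [h1, h2, h3]
    rw [smul_mul_smul_comm, smul_smul, Matrix.one_mul, show c / d * (c⁻¹ * d) = 1 by field_simp,
      one_smul]
  · have hP1 : P 1 = K := by simp [P]
    have h1 : c • (K - Complex.I • 1) = d • ((K + Complex.I • 1) * W) := by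
      rw [hN, Matrix.mul_sub, Matrix.mul_smul, Matrix.mul_smul, Matrix.mul_one] at hKN
      rw [smul_sub, Matrix.add_mul, smul_add, Matrix.smul_mul, Matrix.one_mul]
      have h2 : c • K = Complex.I • (c • 1 + d • W) + d • (K * W) := by rw [← hKN]; abel
      rw [h2]
      module
    have h2 := hu 1
    rw [hP1] at h2
    simp only [hP1]
    rw [div_eq_inv_mul, ← smul_smul, ← Matrix.mul_smul, h1, Matrix.mul_smul, smul_smul,
      inv_mul_cancel₀ hd0, one_smul, nonsing_inv_mul_cancel_left _ _ h2]

/-- Two points of a fibre have the same `ρ` and `Zξ = Z'ξ`, so `Z⁺ Z'` lies in the stabilizer of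
`ξ`; the curve is `Z` times a path there. -/
theorem hasConnectedFibres_O (hn : 1 ≤ n) : HasConnectedFibres (toNtOfO hn) := by
  rintro ⟨⟨Z, ρ⟩, hq⟩ ⟨⟨Z', ρ'⟩, hq'⟩ h
  obtain ⟨hZ, ξ, hξ, hρ⟩ := (mem_orbitO_iff hn).1 hq
  obtain ⟨hZ', -⟩ := (mem_orbitO_iff hn).1 hq'
  simp only at hZ hZ' hρ
  have h' : (cayley n)ᴴ * J0 (Z, ρ) * cayley n = (cayley n)ᴴ * J0 (Z', ρ') * cayley n :=
    congrArg Subtype.val h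
  have h'' : J0 (Z, ρ) = J0 (Z', ρ') := by
    have h1 := congrArg (fun A => cayley n * A * (cayley n)ᴴ) h'
    simpa only [← Matrix.mul_assoc, cayley_mul_conjTranspose, Matrix.one_mul,
      Matrix.mul_assoc _ (cayley n), Matrix.mul_one] using h1
  simp only [J0, fromBlocks_inj] at h''
  obtain ⟨-, h1, -, rfl⟩ := h''
  subst hρ
  have hZξ : Z *ᵥ ξ = Z' *ᵥ ξ := by
    have h3 := congrArg (fun A : Mat n => A *ᵥ ξ) h1
    simp only [Matrix.mul_smul, mul_vecMulVec, smul_mulVec, vecMulVec_mulVec,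
      op_smul_eq_smul] at h3
    exact smul_right_injective _ (fun h0 => hξ (dotProduct_star_self_eq_zero.1 h0))
      (smul_right_injective _ Complex.I_ne_zero h3)
  have hZZ : Z * Zᴴ = 1 := mul_eq_one_comm.1 hZ
  have hW : (Zᴴ * Z')ᴴ * (Zᴴ * Z') = 1 := by
    rw [conjTranspose_mul, conjTranspose_conjTranspose, Matrix.mul_assoc, ← Matrix.mul_assoc Z, hZZ,
      Matrix.one_mul, hZ']
  obtain ⟨c, hc, hcu, hcξ, h0, h1'⟩ := exists_unitary_path hW (ξ := ξ) (by
    rw [← mulVec_mulVec, ← hZξ, mulVec_mulVec, hZ, one_mulVec])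
  have hm : ∀ t, (Z * c t, Complex.I • vecMulVec ξ (star ξ)) ∈ orbitO n 1 0 := fun t =>
    (mem_orbitO_iff hn).2 ⟨by
      rw [conjTranspose_mul, Matrix.mul_assoc, ← Matrix.mul_assoc Zᴴ, hZ, Matrix.one_mul, hcu],
      ξ, hξ, rfl⟩
  refine ⟨fun t => ⟨_, hm t⟩, dSmooth_curve ((contDiff_matMul contDiff_const hc).prodMk
    contDiff_const), fun t => Subtype.ext ?_, Subtype.ext ?_, Subtype.ext ?_⟩
  · change (cayley n)ᴴ * J0 (Z * c t, Complex.I • vecMulVec ξ (star ξ)) * cayley n =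
      (cayley n)ᴴ * J0 (Z, Complex.I • vecMulVec ξ (star ξ)) * cayley n
    rw [J0_rankOne, J0_rankOne, ← mulVec_mulVec, hcξ]
  · simp [h0]
  · simp [h1', ← Matrix.mul_assoc, hZZ]

/-! ### The Kirillov forms -/

/-- The group acts infinitesimally transitively on null vectors. The matrix sought is `A = φ K` with
`K` antihermitian and `K V = φ a`. -/
theorem exists_lie {φ : Mat2 n} (hφ : φ * φ = 1) (hφ' : φᴴ = φ)
    {V a : Matrix (Fin n ⊕ Fin n) Unit ℂ} (hV : V ≠ 0) (h : aᴴ * φ * V + Vᴴ * φ * a = 0) :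
    ∃ A ∈ pseudoUnitaryLie φ, A * V = a := by
  obtain ⟨b, hb⟩ : ∃ b : Matrix (Fin n ⊕ Fin n) Unit ℂ, b = φ * a := ⟨_, rfl⟩
  obtain ⟨N, hN⟩ : ∃ N : ℂ, N = (Vᴴ * V) () () := ⟨_, rfl⟩
  obtain ⟨β, hβ⟩ : ∃ β : ℂ, β = (bᴴ * V) () () := ⟨_, rfl⟩
  have hN0 : N ≠ 0 := hN ▸ conjTranspose_mul_self_apply_ne_zero hV
  have hVV : Vᴴ * V = N • (1 : Matrix Unit Unit ℂ) := by rw [hN]; exact unit_matrix_eq _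
  have hbV : bᴴ * V = β • (1 : Matrix Unit Unit ℂ) := by rw [hβ]; exact unit_matrix_eq _
  have hNs : star N = N := by
    rw [hN]
    have := congrFun (congrFun (conjTranspose_mul Vᴴ V) ()) ()
    rwa [conjTranspose_conjTranspose, conjTranspose_apply] at this
  have hβs : star β = -β := by
    have h1 : star β = (Vᴴ * b) () () := by
      rw [hβ, ← conjTranspose_apply, conjTranspose_mul, conjTranspose_conjTranspose]
    have h2 : bᴴ * V + Vᴴ * b = 0 := by
      rw [hb, conjTranspose_mul, hφ', ← Matrix.mul_assoc]
      exact h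
    have h3 := congrFun (congrFun h2 ()) ()
    rw [h1, hβ]
    exact eq_neg_of_add_eq_zero_right h3
  -- The first term sends `V` to `b` minus `(β/N) V`, and the second restores this. The second is
  -- antihermitian because tangency makes `β = b⁺ V` imaginary.
  obtain ⟨K, hK⟩ : ∃ K : Mat2 n, K = N⁻¹ • (b * Vᴴ - V * bᴴ) + (β / (N * N)) • (V * Vᴴ) :=
    ⟨_, rfl⟩
  have hKs : Kᴴ = -K := by
    simp only [hK, conjTranspose_add, conjTranspose_smul, conjTranspose_sub, conjTranspose_mul,
      conjTranspose_conjTranspose, star_inv₀, star_div₀, star_mul', hNs, hβs]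
    module
  have hKV : K * V = b := by
    simp only [hK, Matrix.add_mul, Matrix.sub_mul, Matrix.smul_mul, Matrix.mul_assoc, hVV, hbV,
      Matrix.mul_smul, Matrix.mul_one, smul_sub, smul_smul]
    rw [inv_mul_cancel₀ hN0, one_smul, show β / (N * N) * N = N⁻¹ * β by field_simp]
    abel
  refine ⟨φ * K, ?_, ?_⟩
  · change (φ * K)ᴴ * φ + φ * (φ * K) = 0
    rw [conjTranspose_mul, hφ', hKs, Matrix.mul_assoc, hφ, ← Matrix.mul_assoc, hφ, Matrix.mul_one,
      Matrix.one_mul, neg_add_cancel]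
  · rw [Matrix.mul_assoc, hKV, hb, ← Matrix.mul_assoc, hφ, Matrix.one_mul]

theorem conjTranspose_mul_of_lie {φ A : Mat2 n} (hA : A ∈ pseudoUnitaryLie φ)
    (V : Matrix (Fin n ⊕ Fin n) Unit ℂ) : Vᴴ * φ * A = -((A * V)ᴴ * φ) := by
  have h : φ * A = -(Aᴴ * φ) := eq_neg_of_add_eq_zero_right hA
  rw [Matrix.mul_assoc, h, conjTranspose_mul, Matrix.mul_neg, Matrix.mul_assoc]

theorem lie_momentum {φ A : Mat2 n} (hA : A ∈ pseudoUnitaryLie φ)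
    (V : Matrix (Fin n ⊕ Fin n) Unit ℂ) :
    A * momentum φ V - momentum φ V * A =
      A * V * (-Complex.I • (Vᴴ * φ)) + V * (-Complex.I • ((A * V)ᴴ * φ)) := by
  have h : momentum φ V * A = -Complex.I • (V * (Vᴴ * φ * A)) := by
    simp only [momentum, Matrix.smul_mul, Matrix.mul_assoc]
  rw [h, conjTranspose_mul_of_lie hA, momentum]
  simp only [Matrix.mul_smul, Matrix.mul_neg, smul_neg, sub_neg_eq_add, Matrix.mul_assoc]

theorem trace_momentum_mul {φ A B : Mat2 n} (hA : A ∈ pseudoUnitaryLie φ)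
    (V : Matrix (Fin n ⊕ Fin n) Unit ℂ) :
    trace (momentum φ V * (A * B)) = Complex.I * ((A * V)ᴴ * φ * (B * V)) () () := by
  have h : momentum φ V * (A * B) = -Complex.I • (V * (Vᴴ * φ * A * B)) := by
    simp only [momentum, Matrix.smul_mul, Matrix.mul_assoc]
  rw [h, trace_smul, trace_mul_comm, conjTranspose_mul_of_lie hA, Matrix.mul_assoc, Matrix.neg_mul,
    trace_neg, trace_unit_matrix, smul_eq_mul, neg_mul_neg]

/-- `V ↦ -i V⁺ φ` as a continuous linear map over the reals. -/
noncomputable def coMomentumCLM (φ : Mat2 n) :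
    Matrix (Fin n ⊕ Fin n) Unit ℂ →L[ℝ] Matrix Unit (Fin n ⊕ Fin n) ℂ :=
  LinearMap.toContinuousLinearMap
    { toFun := fun V => -Complex.I • (Vᴴ * φ)
      map_add' := fun v w => by rw [conjTranspose_add, Matrix.add_mul, smul_add]
      map_smul' := fun r w => by
        rw [conjTranspose_smul, Matrix.smul_mul, star_trivial, smul_comm, RingHom.id_apply] }

theorem coMomentumCLM_apply (φ : Mat2 n) (V : Matrix (Fin n ⊕ Fin n) Unit ℂ) :
    coMomentumCLM φ V = -Complex.I • (Vᴴ * φ) := rfl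

theorem hasFDerivAt_col {m : ℕ} {q : E m → Twistor n} (hq : ContDiff ℝ ∞ q) (x : E m) :
    HasFDerivAt (fun y => col (q y)) ((mulColCLM 1).comp (fderiv ℝ q x)) x := by
  have h := (mulColCLM (1 : Mat2 n)).hasFDerivAt.comp x
    (hq.differentiable (by simp) x).hasFDerivAt
  have h1 : (fun y => col (q y)) = mulColCLM (1 : Mat2 n) ∘ q := by
    funext y
    exact (Matrix.one_mul _).symm
  rwa [h1]

theorem fderiv_JPMt {m : ℕ} {q : E m → Twistor n} (hq : ContDiff ℝ ∞ q) (x v : E m) :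
    fderiv ℝ (fun y => JPMt (q y)) x v =
      col (fderiv ℝ q x v) * (-Complex.I • ((col (q x))ᴴ * phiA n)) +
        col (q x) * (-Complex.I • ((col (fderiv ℝ q x v))ᴴ * phiA n)) := by
  have hc := hasFDerivAt_col hq x
  have hd := (coMomentumCLM (phiA n)).hasFDerivAt.comp x hc
  have h1 : (fun y => JPMt (q y)) = fun y => col (q y) * (coMomentumCLM (phiA n) ∘
      fun y => col (q y)) y := by
    funext y
    rw [JPMt_eq, momentum, Function.comp_apply, coMomentumCLM_apply, Matrix.mul_smul,
      Matrix.mul_assoc]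
  have h2 : fderiv ℝ (fun y => col (q y)) x v = col (fderiv ℝ q x v) :=
    (DFunLike.congr_fun hc.fderiv v).trans (Matrix.one_mul _)
  have h3 := (DFunLike.congr_fun hd.fderiv v).trans
    (congrArg (coMomentumCLM (phiA n)) (Matrix.one_mul (col (fderiv ℝ q x v))))
  rw [h1]
  refine (fderiv_matMul hc.differentiableAt hd.differentiableAt v).trans ?_
  exact congrArg₂ (· + ·) (congrArg (· * _) h2) (congrArg (col (q x) * ·) h3)

theorem null_tangent {m : ℕ} {q : E m → nullTt n} (hq : IsPlot q) (x v : E m) :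
    (col (fderiv ℝ (fun y => (q y : Twistor n)) x v))ᴴ * phiA n * col (q x : Twistor n) +
      (col (q x : Twistor n))ᴴ * phiA n *
        col (fderiv ℝ (fun y => (q y : Twistor n)) x v) = 0 := by
  have hq' : ContDiff ℝ ∞ fun y => (q y : Twistor n) := hq
  have hc := hasFDerivAt_col hq' x
  have hd := (coMomentumCLM (phiA n)).hasFDerivAt.comp x hc
  have h1 : (fun y => (coMomentumCLM (phiA n) ∘ fun y => col (q y : Twistor n)) y *
      col (q y : Twistor n)) = fun _ => 0 := by
    funext y
    rw [Function.comp_apply, coMomentumCLM_apply, Matrix.smul_mul, (mem_nullTt.1 (q y).2).2,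
      smul_zero]
  have h2 := fderiv_matMul hd.differentiableAt hc.differentiableAt v
  obtain ⟨a, ha⟩ : ∃ a, a = col (fderiv ℝ (fun y => (q y : Twistor n)) x v) := ⟨_, rfl⟩
  have h3 : fderiv ℝ (fun y => col (q y : Twistor n)) x v = a :=
    (DFunLike.congr_fun hc.fderiv v).trans ((Matrix.one_mul _).trans ha.symm)
  have h4 := (DFunLike.congr_fun hd.fderiv v).trans
    (congrArg (coMomentumCLM (phiA n)) ((Matrix.one_mul _).trans ha.symm))
  rw [h1, fderiv_fun_const] at h2
  replace h2 := h2.trans (congrArg₂ (· + ·) (congrArg (· * col (q x : Twistor n)) h4)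
    (congrArg ((coMomentumCLM (phiA n) ∘ fun y => col (q y : Twistor n)) x * ·) h3))
  simp only [Function.comp_apply, coMomentumCLM_apply, Matrix.smul_mul, ← smul_add] at h2
  rw [← ha]
  exact (smul_eq_zero.1 h2.symm).resolve_left (neg_ne_zero.2 Complex.I_ne_zero)

/-- A plot of the orbit is lifted locally to null vectors. Its two velocities are `A V` and `B V`,
and both `dγ̃` and `Tr (M [A, B])` become the antisymmetrization of `Re (i (A V)⁺ φ_a (B V))`. -/
theorem isKirillovForm_kirillovForm (hn : 1 ≤ n) :
    IsKirillovForm (phiA n) (kirillovForm hn) := by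
  intro m p hp x v w
  obtain ⟨w₀, hw₀, hx⟩ := (mem_orbitNt_iff hn).1 (p x).2
  obtain ⟨q, hq, hqp⟩ := (hasLocalSplitting_Tt hn).exists_lift hp (x := x) (x₀ := ⟨w₀, hw₀⟩)
    (Subtype.ext hx.symm)
  have hq' : ContDiff ℝ ∞ fun y => (q y : Twistor n) := hq
  have hder : fderiv ℝ (fun y => (p y : Mat2 n)) x =
      fderiv ℝ (fun y => JPMt (q y : Twistor n)) x := by
    refine Filter.EventuallyEq.fderiv_eq ?_
    filter_upwards [hqp] with y hy
    rw [← hy]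
    rfl
  have hpx : (p x : Mat2 n) = momentum (phiA n) (col (q x : Twistor n)) := by
    rw [← hqp.self_of_nhds, ← JPMt_eq]
    rfl
  have hV := col_eq_zero.not.2 (q x).2.1
  obtain ⟨A, hA, hAV⟩ := exists_lie phiA_mul_phiA phiA_conjTranspose hV (null_tangent hq x v)
  obtain ⟨B, hB, hBV⟩ := exists_lie phiA_mul_phiA phiA_conjTranspose hV (null_tangent hq x w)
  refine ⟨A, hA, B, hB, ?_, ?_, ?_⟩
  · rw [hder, fderiv_JPMt hq', hpx, lie_momentum hA, hAV]
  · rw [hder, fderiv_JPMt hq', hpx, lie_momentum hB, hBV]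
  · have h1 := DForm.pull_congr (kirillovForm hn) hp (dSmooth_toNtOfTt hn _ q hq) hqp.symm
    have h2 := congrArg (fun α : DForm 2 (nullTt n) => α.pull q hq x ![v, w])
      (kirillovForm_pullback_Tt hn)
    have hγ : ∀ a b : Twistor n,
        gammaPMt a b = (Complex.I * ((col a)ᴴ * phiA n * col b) () ()).re := fun a b => by
      rw [col_phiA_col, ← mul_assoc, Complex.I_mul_I]
      simp [gammaPMt]
    rw [h1]
    refine h2.trans ?_
    rw [sysTt_form_pull, hpx, Matrix.mul_sub, trace_sub, trace_momentum_mul hA,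
      trace_momentum_mul hB, hAV, hBV, Complex.sub_re, hγ, hγ]

/-- The diffeomorphism `M ↦ 𝒞⁺ M 𝒞` of `𝒩₁₀` onto `𝒩̃₁₀`. -/
noncomputable def toNtOfN (hn : 1 ≤ n) (M : orbitN n 1 0) : orbitNt n 1 0 :=
  ⟨(cayley n)ᴴ * M * cayley n, by
    obtain ⟨v, hv, hM⟩ := (mem_orbitN_iff hn).1 M.2
    rw [← hM]
    exact (toNtOfT hn ⟨v, hv⟩).2⟩

/-- The inverse diffeomorphism. -/
noncomputable def toNOfNt (hn : 1 ≤ n) (M : orbitNt n 1 0) : orbitN n 1 0 :=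
  ⟨cayleyConj M, by
    obtain ⟨v, hv, -, hM⟩ := exists_mem_nullT hn M
    exact (mem_orbitN_iff hn).2 ⟨v, hv, hM.symm⟩⟩

theorem toNOfNt_toNtOfN (hn : 1 ≤ n) (M : orbitN n 1 0) : toNOfNt hn (toNtOfN hn M) = M :=
  Subtype.ext (cayleyConj_cancel M.1)

theorem toNtOfN_toNOfNt (hn : 1 ≤ n) (M : orbitNt n 1 0) : toNtOfN hn (toNOfNt hn M) = M := by
  refine Subtype.ext ?_
  change (cayley n)ᴴ * (cayley n * M * (cayley n)ᴴ) * cayley n = M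
  rw [← Matrix.mul_assoc, ← Matrix.mul_assoc, cayley_conjTranspose_mul, Matrix.one_mul,
    Matrix.mul_assoc, cayley_conjTranspose_mul, Matrix.mul_one]

theorem isOpenEmb_toNtOfN (hn : 1 ≤ n) : IsOpenEmb (toNtOfN hn) :=
  .of_inverse (dSmooth_subset (fun _ => (contDiff_mul_mul _ _).contDiffAt) fun _ => rfl)
    (dSmooth_subset (F := cayleyConj) (fun _ => contDiff_cayleyConj.contDiffAt) fun _ => rfl)
    (toNOfNt_toNtOfN hn) (toNtOfN_toNOfNt hn)

/-- The orbit `𝒩₁₀` with its Kirillov form and the Hamiltonian `L_𝔛₊₋`. -/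
noncomputable def sysN (hn : 1 ≤ n) : HamiltonianSystem (orbitN n 1 0) (2 * n - 1) :=
  (sysNt hn).restrict (isOpenEmb_toNtOfN hn)

theorem isIsomorphism_toNtOfN (hn : 1 ≤ n) : IsIsomorphism (sysN hn) (sysNt hn) (toNtOfN hn) :=
  ⟨(sysNt hn).restrict_isExtension _, fun M => ⟨toNOfNt hn M, toNtOfN_toNOfNt hn M⟩⟩

theorem linearHam_cayley (M : Mat2 n) :
    linearHam (xPMt n) ((cayley n)ᴴ * M * cayley n) = linearHam (xPM n) M := by
  have h : xPMt n * ((cayley n)ᴴ * M * cayley n) = (cayley n)ᴴ * (xPM n * M * cayley n) := by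
    rw [xPMt]
    simp only [Matrix.mul_assoc]
    rw [← Matrix.mul_assoc (cayley n), cayley_mul_conjTranspose, Matrix.one_mul]
  rw [linearHam, h, trace_mul_comm, Matrix.mul_assoc, cayley_mul_conjTranspose, Matrix.mul_one,
    linearHam]

/-- Conjugation by the unitary Cayley matrix carries one Lie algebra into the other and preserves
commutators and traces. -/
theorem isKirillovForm_sysN (hn : 1 ≤ n) : IsKirillovForm (phiD n) (sysN hn).form := by
  intro m p hp x v w
  have hp' : ContDiff ℝ ∞ fun y => (p y : Mat2 n) := hp
  obtain ⟨A, hA, B, hB, h1, h2, h3⟩ := isKirillovForm_kirillovForm hn (toNtOfN hn ∘ p)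
    ((isOpenEmb_toNtOfN hn).smooth _ p hp) x v w
  have hc1 : ∀ A : Mat2 n, cayley n * ((cayley n)ᴴ * A) = A := fun A => by
    rw [← Matrix.mul_assoc, cayley_mul_conjTranspose, Matrix.one_mul]
  have hc2 : ∀ A : Mat2 n, (cayley n)ᴴ * (cayley n * A) = A := fun A => by
    rw [← Matrix.mul_assoc, cayley_conjTranspose_mul, Matrix.one_mul]
  have hlie : ∀ A ∈ pseudoUnitaryLie (phiA n), cayleyConj A ∈ pseudoUnitaryLie (phiD n) := by
    intro A hA
    change (cayleyConj A)ᴴ * phiD n + phiD n * cayleyConj A = 0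
    have h : cayleyConj (Aᴴ * phiA n + phiA n * A) = 0 := by
      rw [show Aᴴ * phiA n + phiA n * A = 0 from hA, cayleyConj, Matrix.mul_zero, Matrix.zero_mul]
    rw [← h, cayleyConj, cayleyConj, ← cayley_phiA]
    simp only [conjTranspose_mul, conjTranspose_conjTranspose, Matrix.mul_add, Matrix.add_mul,
      Matrix.mul_assoc, hc2]
  have hfd : ∀ u (A : Mat2 n), fderiv ℝ (fun y => ((toNtOfN hn ∘ p) y : Mat2 n)) x u =
      A * ((toNtOfN hn ∘ p) x : Mat2 n) - ((toNtOfN hn ∘ p) x : Mat2 n) * A →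
      fderiv ℝ (fun y => (p y : Mat2 n)) x u =
        cayleyConj A * p x - p x * cayleyConj A := by
    intro u A h
    change fderiv ℝ (fun y => (cayley n)ᴴ * (p y : Mat2 n) * cayley n) x u =
      A * ((cayley n)ᴴ * (p x : Mat2 n) * cayley n) -
        (cayley n)ᴴ * (p x : Mat2 n) * cayley n * A at h
    rw [fderiv_mul_mul _ _ hp'] at h
    have h' := congrArg cayleyConj h
    rw [cayleyConj_cancel] at h'
    rw [h', cayleyConj, cayleyConj]
    simp only [Matrix.mul_sub, Matrix.sub_mul, Matrix.mul_assoc, hc1, cayley_mul_conjTranspose,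
      Matrix.mul_one]
  refine ⟨_, hlie A hA, _, hlie B hB, hfd v A h1, hfd w B h2, h3.trans ?_⟩
  change (trace ((cayley n)ᴴ * (p x : Mat2 n) * cayley n * (A * B - B * A))).re = _
  rw [Matrix.mul_assoc, Matrix.mul_assoc, trace_mul_comm, cayleyConj, cayleyConj]
  simp only [Matrix.mul_sub, Matrix.sub_mul, Matrix.mul_assoc, hc2]

/-! ### The Hamiltonians -/

/-- `Tr (iφ · (-i) V V⁺ φ)` is `V⁺ V` because `φ² = 1`. -/
theorem linearHam_momentum {φ : Mat2 n} (hφ : φ * φ = 1) (w : Twistor n) :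
    linearHam (Complex.I • φ) (momentum φ (col w)) =
      (star w.1 ⬝ᵥ w.1 + star w.2 ⬝ᵥ w.2).re := by
  rw [linearHam, Matrix.smul_mul, trace_smul, trace_mul_comm, trace_momentum hφ,
    col_conjTranspose_col, smul_eq_mul, ← mul_assoc, mul_neg, Complex.I_mul_I, neg_neg, one_mul]

theorem ham_Tt (hn : 1 ≤ n) (w : nullTt n) : (sysNt hn).ham (toNtOfTt hn w) = (sysTt n).ham w := by
  change linearHam (xPMt n) (JPMt w.1) = _
  rw [xPMt_eq, JPMt_eq, linearHam_momentum phiA_mul_phiA]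
  rfl

theorem ham_T (hn : 1 ≤ n) (v : nullT n) : (sysNt hn).ham (toNtOfT hn v) = (sysT n).ham v := by
  change linearHam (xPMt n) ((cayley n)ᴴ * JPM v.1 * cayley n) = _
  rw [linearHam_cayley, xPM_eq, JPM_eq, linearHam_momentum phiD_mul_phiD]
  rfl

theorem ham_O (hn : 1 ≤ n) (q : orbitO n 1 0) : (sysNt hn).ham (toNtOfO hn q) = (sysO n).ham q := by
  obtain ⟨hZ, ξ, hξ, hρ⟩ := (mem_orbitO_iff hn).1 q.2
  have h : J0 q.1 = JPM (q.1.1 *ᵥ ξ, ξ) := by rw [← J0_rankOne, ← hρ]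
  change linearHam (xPMt n) ((cayley n)ᴴ * J0 q.1 * cayley n) = (-2 * Complex.I * trace q.1.2).re
  rw [linearHam_cayley, h, xPM_eq, JPM_eq, linearHam_momentum phiD_mul_phiD, unitary_smul hZ, hρ,
    trace_smul, trace_vecMulVec, dotProduct_comm ξ, smul_eq_mul]
  congr 1
  linear_combination (2 * star ξ ⬝ᵥ ξ) * Complex.I_mul_I

theorem ham_Ot (hn : 1 ≤ n) (q : orbitOt n) :
    (sysNt hn).ham (toNtOfOt hn q) = (sysOt n).ham q := by
  obtain ⟨hY, ζ, hζ, hX⟩ := exists_of_mem_orbitOt q.2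
  have h : J0t q.1 = JPMt (q.1.1 *ᵥ ζ, ζ) := by rw [← J0t_rankOne hY, ← hX]
  change linearHam (xPMt n) (J0t q.1) = (trace (q.1.2 * (1 + q.1.1 ^ 2))).re
  rw [h, xPMt_eq, JPMt_eq, linearHam_momentum phiA_mul_phiA, hX, sq, Matrix.mul_add, Matrix.mul_one,
    trace_add, trace_vecMulVec, vecMulVec_mul, trace_vecMulVec, star_mulVec, hY, dotProduct_comm ζ,
    dotProduct_comm ζ, ← dotProduct_mulVec, ← dotProduct_mulVec, mulVec_mulVec, add_comm]

/-! ### The lifted Cayley transform -/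

/-- On twistors the lifted transform is multiplication by the Cayley matrix: with `X = ζ ζ⁺` it
gives `ξ = (1 - iY) ζ / √2` and `Zξ = (Y - i) ζ / √2`, the two components of `𝒞 (Yζ, ζ)`. -/
theorem cayleyT_mem (hn : 1 ≤ n) (q : orbitOt n) : ∃ h : cayleyT q.1 ∈ orbitO n 1 0,
    toNtOfO hn ⟨cayleyT q.1, h⟩ = toNtOfOt hn q := by
  obtain ⟨hY, ζ, hζ, hX⟩ := exists_of_mem_orbitOt q.2
  obtain ⟨Y, hYdef⟩ : ∃ Y, Y = q.1.1 := ⟨_, rfl⟩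
  obtain ⟨P, hP⟩ : ∃ P : Mat n, P = -(Complex.I • Y) + 1 := ⟨_, rfl⟩
  obtain ⟨s, hs⟩ : ∃ s : ℂ, s = ((1 / Real.sqrt 2 : ℝ) : ℂ) := ⟨_, rfl⟩
  have hss : s * s = 1 / 2 := hs ▸ inv_sqrt_two_sq
  have hs' : star s = s := hs ▸ Complex.conj_ofReal _
  rw [← hYdef] at hY
  have hPu : IsUnit P.det := by
    -- The denominator is a multiple of `Y + i`, invertible for hermitian `Y`.
    have h1 : P = -Complex.I • (Y + Complex.I • 1) := by
      rw [hP, smul_add, smul_smul, neg_mul, Complex.I_mul_I]; module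
    rw [h1, det_smul]
    exact isUnit_iff_ne_zero.2 (mul_ne_zero (pow_ne_zero _ (neg_ne_zero.2 Complex.I_ne_zero))
      (det_add_I_ne_zero hY))
  have hQ : (Y - Complex.I • 1)ᴴ * (Y - Complex.I • 1) = Pᴴ * P := by
    rw [hP]
    simp only [conjTranspose_add, conjTranspose_sub, conjTranspose_neg, conjTranspose_smul, hY,
      conjTranspose_one, Complex.star_def, Complex.conj_I, Matrix.add_mul, Matrix.mul_add,
      Matrix.sub_mul, Matrix.mul_sub, Matrix.smul_mul, Matrix.mul_smul, Matrix.one_mul,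
      Matrix.mul_one, neg_mul, mul_neg]
    match_scalars <;> ring_nf <;> simp
  have hZ : ((Y - Complex.I • 1) * P⁻¹)ᴴ * ((Y - Complex.I • 1) * P⁻¹) = 1 := by
    rw [conjTranspose_mul, Matrix.mul_assoc, ← Matrix.mul_assoc (Y - Complex.I • 1)ᴴ, hQ,
      Matrix.mul_assoc Pᴴ, mul_nonsing_inv _ hPu, Matrix.mul_one, ← conjTranspose_mul,
      mul_nonsing_inv _ hPu, conjTranspose_one]
  have hc : cayleyT q.1 = ((Y - Complex.I • 1) * P⁻¹,
      Complex.I • vecMulVec (s • P *ᵥ ζ) (star (s • P *ᵥ ζ))) := by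
    refine Prod.ext ?_ ?_
    · rw [cayleyT, ← hYdef, ← hP]
    · rw [cayleyT, ← hYdef, ← hP, hX, mul_vecMulVec_mul, star_smul, hs', smul_vecMulVec,
        vecMulVec_smul, smul_smul, smul_smul, mul_assoc, hss]
      congr 1
      ring_nf
  have hξ : s • P *ᵥ ζ ≠ 0 := by
    have h1 : s ≠ 0 := fun h => by rw [h] at hss; norm_num at hss
    refine smul_ne_zero h1 fun h => hζ ?_
    have h2 := congrArg (fun u => P⁻¹ *ᵥ u) h
    simpa [mulVec_mulVec, nonsing_inv_mul _ hPu] using h2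
  have hmem : cayleyT q.1 ∈ orbitO n 1 0 := by
    rw [hc]
    exact (mem_orbitO_iff hn).2 ⟨hZ, _, hξ, rfl⟩
  refine ⟨hmem, Subtype.ext ?_⟩
  change (cayley n)ᴴ * J0 (cayleyT q.1) * cayley n = J0t q.1
  have hη : ((Y - Complex.I • 1) * P⁻¹) *ᵥ (s • P *ᵥ ζ) = s • (Y - Complex.I • 1) *ᵥ ζ := by
    rw [mulVec_smul, mulVec_mulVec, Matrix.mul_assoc, nonsing_inv_mul _ hPu, Matrix.mul_one]
  have hJ : J0t q.1 = JPMt (Y *ᵥ ζ, ζ) := by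
    rw [← J0t_rankOne hY, ← hX, hYdef]
  rw [hc, J0_rankOne, hη, hJ, ← JPMt_cayleyEquiv]
  congr 1
  refine col_injective ?_
  rw [col_cayleyEquiv, cayley_conjTranspose, ← hs]
  have h1 : col (s • (Y - Complex.I • 1) *ᵥ ζ, s • P *ᵥ ζ) =
      s • col ((Y - Complex.I • 1) *ᵥ ζ, P *ᵥ ζ) := by
    rw [← col_smul]; rfl
  rw [h1, Matrix.smul_mul, Matrix.mul_smul, smul_smul, hss, col, col, fromBlocks_mul_fromRows]
  ext i j
  rcases i with i | i
  · simp [hP, sub_mulVec, add_mulVec, smul_mulVec, neg_mulVec, mul_add, ← mul_assoc]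
    ring
  · simp [hP, sub_mulVec, add_mulVec, smul_mulVec, neg_mulVec, mul_add, mul_sub, ← mul_assoc]
    ring

/-! ### Surjectivity of the momentum maps -/

theorem toNtOfT_surjective (hn : 1 ≤ n) : Function.Surjective (toNtOfT hn) := fun M => by
  obtain ⟨v, hv, hM, -⟩ := exists_mem_nullT hn M
  exact ⟨⟨v, hv⟩, Subtype.ext hM⟩

theorem toNtOfTt_surjective (hn : 1 ≤ n) : Function.Surjective (toNtOfTt hn) := fun M => by
  obtain ⟨w, hw, hM⟩ := (mem_orbitNt_iff hn).1 M.2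
  exact ⟨⟨w, hw⟩, Subtype.ext hM⟩

/-- A unitary `Z` with `Zξ = η` exists because both components of a null twistor have the same
length. The analogue for `(Y, X)` fails at `ζ = 0`, which is what the regularization adds. -/
theorem toNtOfO_surjective (hn : 1 ≤ n) : Function.Surjective (toNtOfO hn) := fun M => by
  obtain ⟨v, hv, hM, -⟩ := exists_mem_nullT hn M
  obtain ⟨h0, h1⟩ := nullT_components hv
  obtain ⟨Z, hZ, hZv⟩ := exists_unitary h0 h1.symm
  refine ⟨⟨(Z, Complex.I • vecMulVec v.2 (star v.2)),
    (mem_orbitO_iff hn).2 ⟨hZ, v.2, h0, rfl⟩⟩, Subtype.ext ?_⟩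
  change (cayley n)ᴴ * J0 (Z, Complex.I • vecMulVec v.2 (star v.2)) * cayley n = M
  rw [J0_rankOne, hZv, hM]

/-- An isomorphism onto `𝒩̃₁₀` composed with the Cayley transform is an isomorphism
onto `𝒩₁₀`. -/
theorem exists_isomorphism_sysN (hn : 1 ≤ n) {X : Type*} [DiffeologicalSpace X]
    {R : HamiltonianSystem X (2 * n - 1)} {f : X → orbitNt n 1 0}
    (hf : IsIsomorphism R (sysNt hn) f) :
    ∃ g : X → orbitN n 1 0, IsIsomorphism R (sysN hn) g ∧
      ∀ x, (g x : Mat2 n) = cayleyConj (f x) := by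
  obtain ⟨g, hg, hgf⟩ := IsExtension.exists_factor (isIsomorphism_toNtOfN hn) hf.toIsExtension
  have h : ∀ x, g x = toNOfNt hn (f x) := fun x => by rw [← hgf, toNOfNt_toNtOfN]
  refine ⟨g, ⟨hg, fun M => ?_⟩, fun x => by rw [h]; rfl⟩
  obtain ⟨x, hx⟩ := hf.surjective (toNtOfN hn M)
  exact ⟨x, by rw [h, hx, toNOfNt_toNtOfN]⟩

end Kepler

/-! ### Assembly of the reductions, isomorphisms and regularizations -/

theorem proposition4p3 (n : ℕ) (hn : 1 ≤ n) :
    ∃ (N : HamiltonianSystem (orbitN n 1 0) (2 * n - 1))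
      (Nt : HamiltonianSystem (orbitNt n 1 0) (2 * n - 1))
      (T : HamiltonianSystem (LeafSpace (sysT n).form) (2 * n - 1))
      (Tt : HamiltonianSystem (LeafSpace (sysTt n).form) (2 * n - 1))
      (O : HamiltonianSystem (LeafSpace (sysO n).form) (2 * n - 1))
      (Ot : HamiltonianSystem (LeafSpace (sysOt n).form) (2 * n - 1)),
      -- the two nilpotent orbits with their Kirillov forms and linear Hamiltonians
      (IsKirillovForm (phiD n) N.form ∧ ∀ M, N.ham M = linearHam (xPM n) M) ∧
      (IsKirillovForm (phiA n) Nt.form ∧ ∀ M, Nt.ham M = linearHam (xPMt n) M) ∧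
      -- the reduced systems
      IsReduction (sysT n) T ∧ IsReduction (sysTt n) Tt ∧
      IsReduction (sysO n) O ∧ IsReduction (sysOt n) Ot ∧
      -- (i) the isomorphisms induced by the momentum maps
      (∃ f : LeafSpace (sysT n).form → orbitN n 1 0, IsIsomorphism T N f ∧
        ∀ v, (f (leaf (sysT n).form v) : Mat2 n) = JPM v.1) ∧
      (∃ f : LeafSpace (sysTt n).form → orbitN n 1 0, IsIsomorphism Tt N f ∧
        ∀ v, (f (leaf (sysTt n).form v) : Mat2 n) = cayley n * JPMt v.1 * (cayley n)ᴴ) ∧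
      (∃ f : LeafSpace (sysO n).form → orbitN n 1 0, IsIsomorphism O N f ∧
        ∀ q, (f (leaf (sysO n).form q) : Mat2 n) = J0 q.1) ∧
      -- (ii) the two regularizations
      (∃ f : LeafSpace (sysOt n).form → LeafSpace (sysO n).form, IsExtension Ot O f ∧
        ∀ q, ∃ q' : orbitO n 1 0, q'.1 = cayleyT q.1 ∧
          f (leaf (sysOt n).form q) = leaf (sysO n).form q') ∧
      (∃ f : LeafSpace (sysOt n).form → orbitNt n 1 0, IsExtension Ot Nt f ∧
        ∀ q, (f (leaf (sysOt n).form q) : Mat2 n) = J0t q.1) := by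
  obtain ⟨T, fT, hT, hfT, hfT'⟩ := exists_reduction (sysT n) (sysNt hn) (dSmooth_toNtOfT hn)
    (kirillovForm_pullback_T hn) (ham_T hn) (hasLocalSplitting_T hn) (hasConnectedFibres_T hn)
  obtain ⟨Tt, fTt, hTt, hfTt, hfTt'⟩ := exists_reduction (sysTt n) (sysNt hn)
    (dSmooth_toNtOfTt hn) (kirillovForm_pullback_Tt hn) (ham_Tt hn) (hasLocalSplitting_Tt hn)
    (hasConnectedFibres_Tt hn)
  obtain ⟨O, fO, hO, hfO, hfO'⟩ := exists_reduction (sysO n) (sysNt hn) (dSmooth_toNtOfO hn)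
    (kirillovForm_pullback_O hn) (ham_O hn) (hasLocalSplitting_O hn) (hasConnectedFibres_O hn)
  obtain ⟨Ot, fOt, hOt, hfOt, hfOt'⟩ := exists_reduction (sysOt n) (sysNt hn)
    (dSmooth_toNtOfOt hn) (kirillovForm_pullback_Ot hn) (ham_Ot hn) (hasLocalSplitting_Ot hn)
    (hasConnectedFibres_Ot hn)
  have sT : Function.Surjective fT := fun M => by
    obtain ⟨v, hv⟩ := toNtOfT_surjective hn M
    exact ⟨leaf _ v, (hfT' v).trans hv⟩
  have sTt : Function.Surjective fTt := fun M => by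
    obtain ⟨v, hv⟩ := toNtOfTt_surjective hn M
    exact ⟨leaf _ v, (hfTt' v).trans hv⟩
  have sO : Function.Surjective fO := fun M => by
    obtain ⟨q, hq⟩ := toNtOfO_surjective hn M
    exact ⟨leaf _ q, (hfO' q).trans hq⟩
  obtain ⟨gT, hgT, hgT'⟩ := exists_isomorphism_sysN hn ⟨hfT, sT⟩
  obtain ⟨gTt, hgTt, hgTt'⟩ := exists_isomorphism_sysN hn ⟨hfTt, sTt⟩
  obtain ⟨gO, hgO, hgO'⟩ := exists_isomorphism_sysN hn ⟨hfO, sO⟩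
  -- This is `fO⁻¹ ∘ fOt`, defined without reference to the lifted Cayley transform.
  obtain ⟨h, hh, hh'⟩ := IsExtension.exists_factor ⟨hfO, sO⟩ hfOt
  refine ⟨sysN hn, sysNt hn, T, Tt, O, Ot,
    ⟨isKirillovForm_sysN hn, fun M => linearHam_cayley M.1⟩,
    ⟨isKirillovForm_kirillovForm hn, fun _ => rfl⟩, hT, hTt, hO, hOt,
    ⟨gT, hgT, fun v => ?_⟩, ⟨gTt, hgTt, fun v => ?_⟩, ⟨gO, hgO, fun q => ?_⟩,
    ⟨h, hh, fun q => ?_⟩, ⟨fOt, hfOt, fun q => ?_⟩⟩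
  · rw [hgT', hfT']
    exact cayleyConj_cancel _
  · rw [hgTt', hfTt']
    rfl
  · rw [hgO', hfO']
    exact cayleyConj_cancel _
  · obtain ⟨hm, hq⟩ := cayleyT_mem hn q
    -- The two leaves agree because they have the same momentum in `orbitNt`.
    refine ⟨⟨_, hm⟩, rfl, hfO.injective ?_⟩
    rw [hh', hfOt', hfO', hq]
  · rw [hfOt']
    rfl
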